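/- Notation. For $\omega$ in the upper half-plane $\mathbb H$ let $\Delta(\omega)=g_2(\omega)^3-27g_3(\omega)^2=(2\pi)^{12}\eta(\omega)^{24}$, let $j(\omega)=1728\,g_2(\omega)^3/\Delta(\omega)$, and for $\operatorname{Im}(\omega_1/\omega_2)>0$ put $\Delta(\omega_1,\omega_2)=\omega_2^{-12}\Delta(\omega_1/\omega_2)$. For an integral $2\times 2$ matrix $S$ of determinant $s>0$ let $$\varphi_S(\omega)=s^{12}\,\frac{\Delta\bigl(S\binom{\omega_1}{\omega_2}\bigr)}{\Delta\binom{\omega_1}{\omega_2}},\qquad \omega=\omega_1/\omega_2 .$$ Two such matrices $S,S'$ are called equivalent if $S'=MS$ with $M\in \mathrm{SL}_2(\mathbb Z)$. Let $p$ be a prime number and $P$ an integral matrix of determinant $p$. An entire integral function $f=f_P$ from $\mathbb Q_{\mathfrak M_P}=\mathbb Q(j(\omega),j(P(\omega)))$ is an element $f$ of this field of meromorphic functions that is holomorphic on $\mathbb H$ and such that all conjugates $f_S$ have $q$-expansions (with finitely many negative exponents, in powers of $q^{1/p}=e^{2\pi i\omega/p}$) whose coefficients are algebraic integers. Here, for an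 integral matrix $S$ of determinant $p$, the conjugate is $f_S(\omega)=f(M(\omega))$ for any $M\in\mathrm{SL}_2(\mathbb Z)\cap P^{-1}\mathrm{SL}_2(\mathbb Z)S$. Setting. Let $\Sigma\subset\mathbb C$ be an imaginary quadratic field with ring of integers $\mathcal O_\Sigma$, and let $p$ be a prime number with $p\,\mathcal O_\Sigma=\mathfrak p\,\bar{\mathfrak p}$ for two (equal or distinct) prime ideals $\mathfrak p,\bar{\mathfrak p}$. Let $R$ be an order of $\Sigma$ whose conductor is not divisible by $p$, and put $\mathfrak p_R=\mathfrak p\cap R$, $\bar{\mathfrak p}_R=\bar{\mathfrak p}\cap R$. Let $\alpha_1,\alpha_2$ be a $\mathbb Z$-basis of a (not necessarily integral) ideal $\mathfrak a_R$ of $R$ such that $\alpha=\alpha_1/\alpha_2$ has positive imaginary part. Theorem. 1. There is an integral matrix $P_{\mathfrak p}$ of determinant $p$, uniquely determined up to equivalence, for which $P_{\mathfrak p}\binom{\alpha_1}{\alpha_2}$ is a basis of $\mathfrak a_R\,\mathfrak p_R$. For every such matrix $\varphi_{P_{\mathfrak p}}(\alpha)\approx\bar{\mathfrak p}^{12}$,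 that is, $\varphi_{P_{\mathfrak p}}(\alpha)$ is an algebraic integer that generates the same ideal as $\bar{\mathfrak p}^{12}$ in the ring of all algebraic integers. 2. Suppose $\mathfrak p\neq\bar{\mathfrak p}$, and let $P_{\bar{\mathfrak p}}$ be an integral matrix of determinant $p$ for which $P_{\bar{\mathfrak p}}\binom{\alpha_1}{\alpha_2}$ is a basis of $\mathfrak a_R\,\bar{\mathfrak p}_R$. Let $f_P$ be an entire integral function from $\mathbb Q_{\mathfrak M_P}$, where $P$ is an integral matrix of determinant $p$, and suppose that the coefficients of the $q$-expansion of the conjugate $f_{\left(\begin{smallmatrix}p&0\\0&1\end{smallmatrix}\right)}$ are divisible by $p$. Then the complex number $f_{P_{\bar{\mathfrak p}}}(\alpha)$ is algebraic and divisible by $\mathfrak p$, that is, it is an algebraic integer lying in the ideal generated by $\mathfrak p$ in the ring of all algebraic integers. -/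

import Mathlib

open scoped NumberField MatrixGroups Manifold Matrix

noncomputable section

namespace CM

open UpperHalfPlane

/-! ### Modular functions -/

/-- The fractional linear transformation `S(ω) = (aω + b)/(cω + d)` of the upper half-plane given
by an integer matrix `S`. It is meant for `det S > 0` only, see `coe_moebius`. -/
def moebius (S : Matrix (Fin 2) (Fin 2) ℤ) (z : ℍ) : ℍ :=
  ofComplex (((S 0 0 : ℂ) * z + S 0 1) / ((S 1 0 : ℂ) * z + S 1 1))

lemma coe_moebius (S : Matrix (Fin 2) (Fin 2) ℤ) (hS : 0 < S.det) (z : ℍ) :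
    (moebius S z : ℂ) = ((S 0 0 : ℂ) * z + S 0 1) / ((S 1 0 : ℂ) * z + S 1 1) := by
  have hd : (0 : ℝ) < (S.map (Int.cast : ℤ → ℝ)).det := by
    have h : (S.map (Int.cast : ℤ → ℝ)).det = (S.det : ℝ) := by
      simp [Matrix.det_fin_two]
    rw [h]
    exact_mod_cast hS
  have hg := coe_smul_of_det_pos
    (g := Matrix.GeneralLinearGroup.mkOfDetNeZero (S.map (Int.cast : ℤ → ℝ)) hd.ne')
    (by simpa using hd) z
  have hw : ((Matrix.GeneralLinearGroup.mkOfDetNeZero (S.map (Int.cast : ℤ → ℝ)) hd.ne' • z : ℍ) : ℂ)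
      = ((S 0 0 : ℂ) * z + S 0 1) / ((S 1 0 : ℂ) * z + S 1 1) := by
    rw [hg]
    simp [num, denom, Matrix.GeneralLinearGroup.mkOfDetNeZero]
  rw [moebius, ← hw, ofComplex_apply]

/-- The homogeneous discriminant `Δ(ω₁, ω₂) = ω₂⁻¹² Δ(ω₁/ω₂)` for `Im (ω₁/ω₂) > 0`, where
`Δ(ω) = g₂(ω)³ - 27 g₃(ω)² = (2π)¹² η(ω)²⁴`. -/
def deltaHom (w₁ w₂ : ℂ) : ℂ :=
  (2 * Real.pi : ℂ) ^ 12 * ModularForm.eta (w₁ / w₂) ^ 24 / w₂ ^ 12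

/-- `φ_S(ω) = s¹² Δ(S(ω₁, ω₂)) / Δ(ω₁, ω₂)` with `s = det S` and `ω = ω₁/ω₂`; the quotient does not
depend on the choice of `ω₁, ω₂`, and we take `ω₁ = ω`, `ω₂ = 1`. -/
def phi (S : Matrix (Fin 2) (Fin 2) ℤ) (z : ℍ) : ℂ :=
  (S.det : ℂ) ^ 12 * deltaHom ((S 0 0 : ℂ) * z + S 0 1) ((S 1 0 : ℂ) * z + S 1 1) / deltaHom z 1

/-- The absolute invariant `j = 1728 g₂³/(g₂³ - 27 g₃²) = E₄³/η²⁴`; here `ModularForm.discriminant = η²⁴`. -/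
def j (z : ℍ) : ℂ := ModularForm.E₄ z ^ 3 / ModularForm.discriminant z

/-- A holomorphic function `f` on the upper half-plane belongs to the field `ℚ(j(ω), j(P(ω)))`, as a
meromorphic function: `f = A(j, j∘P) / B(j, j∘P)` for polynomials `A, B` over `ℚ` with
`B(j, j∘P)` not identically zero. -/
def MemRationalField (P : Matrix (Fin 2) (Fin 2) ℤ) (f : ℍ → ℂ) : Prop :=
  ∃ A B : MvPolynomial (Fin 2) ℚ,
    (∃ z : ℍ, MvPolynomial.aeval ![j z, j (moebius P z)] B ≠ 0) ∧
    ∀ z : ℍ, f z * MvPolynomial.aeval ![j z, j (moebius P z)] B =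
      MvPolynomial.aeval ![j z, j (moebius P z)] A

/-- `g = f_S` is the conjugate, indexed by the matrix `S`, of a function `f = f_P` for the group
`SL₂(ℤ) ∩ P⁻¹ SL₂(ℤ) P`: one has `g(ω) = f(M(ω))` with `M ∈ SL₂(ℤ) ∩ P⁻¹ SL₂(ℤ) S`. -/
def IsConjugate (P : Matrix (Fin 2) (Fin 2) ℤ) (f : ℍ → ℂ) (S : Matrix (Fin 2) (Fin 2) ℤ)
    (g : ℍ → ℂ) : Prop :=
  ∃ M N : SL(2, ℤ), P * (M : Matrix (Fin 2) (Fin 2) ℤ) = (N : Matrix (Fin 2) (Fin 2) ℤ) * S ∧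
    ∀ z : ℍ, g z = f (M • z)

/-- In some half-plane `Im ω > ρ` one has `g(ω) = ∑ a_ν q^{ν/h}`, `q^{1/h} = exp(2πiω/h)`, with only
finitely many nonzero coefficients of negative index. -/
def HasQExpansion (h : ℕ) (g : ℍ → ℂ) (a : ℤ → ℂ) : Prop :=
  (∃ n : ℤ, ∀ ν < n, a ν = 0) ∧
  ∃ ρ : ℝ, ∀ z : ℍ, ρ < z.im →
    HasSum (fun ν : ℤ => a ν * Function.Periodic.qParam (h : ℝ) (z : ℂ) ^ ν) (g z)

/-- Entire integral functions `f = f_P` from `ℚ(j(ω), j(P(ω)))`, for `P` of determinant `p`: `f` is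
holomorphic on the upper half-plane, and all its conjugates have `q`-expansions (in `q^{1/p}`)
whose coefficients are algebraic integers. -/
structure IsEntireIntegral (p : ℕ) (P : Matrix (Fin 2) (Fin 2) ℤ) (f : ℍ → ℂ) : Prop where
  holomorphic : MDifferentiable 𝓘(ℂ) 𝓘(ℂ) f
  mem : MemRationalField P f
  integral : ∀ S g, IsConjugate P f S g →
    ∃ a : ℤ → ℂ, HasQExpansion p g a ∧ ∀ ν, IsIntegral ℤ (a ν)

/-! ### Orders and their ideals -/

section Orders

variable {K : Type*} [Field K]

/-- Orders of a number field `K`: subrings of the maximal order `𝓞 K` that span `K` over `ℚ`. -/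
def IsOrder [CharZero K] (R : Subalgebra ℤ (𝓞 K)) : Prop :=
  Submodule.span ℚ ((fun x : 𝓞 K => (x : K)) '' (R : Set (𝓞 K))) = ⊤

/-- The conductor of `R`: the elements `x` with `x 𝓞 ⊆ R`, an ideal of the maximal order `𝓞`. -/
def conductor (R : Subalgebra ℤ (𝓞 K)) : Ideal (𝓞 K) where
  carrier := {x | ∀ y : 𝓞 K, x * y ∈ R}
  add_mem' {a b} ha hb y := by
    rw [add_mul]
    exact R.add_mem (ha y) (hb y)
  zero_mem' y := by
    rw [zero_mul]
    exact R.zero_mem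
  smul_mem' c x hx y := by
    rw [smul_eq_mul, mul_comm c x, mul_assoc]
    exact hx (c * y)

/-- The ideal `𝔭_R = 𝔭 ∩ R` of the order `R` associated to an integral ideal `𝔭` of the maximal order
(it is used only for `𝔭` prime to the conductor of `R`). -/
def idealIn (R : Subalgebra ℤ (𝓞 K)) (𝔭 : Ideal (𝓞 K)) : Ideal R :=
  𝔭.comap R.val.toRingHom

/-- `v 0, v 1` is a `ℤ`-basis of the ideal `𝔞` of `R`; ideals of `R` need not be integral. -/
def IsBasisOf {R : Subalgebra ℤ (𝓞 K)} (v : Fin 2 → K) (𝔞 : Submodule R K) : Prop :=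
  LinearIndependent ℤ v ∧ (Submodule.span ℤ (Set.range v) : Set K) = (𝔞 : Set K)

/-- `P` is an integer matrix of determinant `p` which sends the basis `v` of `𝔞` to a basis of
`𝔞 𝔭_R`. -/
def IsTransition {R : Subalgebra ℤ (𝓞 K)} (p : ℕ) (v : Fin 2 → K) (𝔞 : Submodule R K)
    (𝔭 : Ideal (𝓞 K)) (P : Matrix (Fin 2) (Fin 2) ℤ) : Prop :=
  P.det = p ∧ IsBasisOf (P.map (Int.cast : ℤ → K) *ᵥ v) (idealIn R 𝔭 • 𝔞)

end Orders

/-! ### Divisibility of algebraic numbers by divisors of a subfield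

`𝓞 ℂ` is the ring of all algebraic integers. -/

/-- `x ≈ I`: the complex number `x` is an algebraic integer, and the ideal it generates in the
ring of all algebraic integers is the one generated by the ideal `I` of `𝓞 K`. -/
def GeneratesSameDivisor {K : IntermediateField ℚ ℂ} (x : ℂ) (I : Ideal (𝓞 K)) : Prop :=
  ∃ y : 𝓞 ℂ, (y : ℂ) = x ∧ Ideal.span {y} = I.map (algebraMap (𝓞 K) (𝓞 ℂ))

/-- The complex number `x` is an algebraic integer divisible by `I`. -/
def DivisibleBy {K : IntermediateField ℚ ℂ} (x : ℂ) (I : Ideal (𝓞 K)) : Prop :=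
  ∃ y : 𝓞 ℂ, (y : ℂ) = x ∧ y ∈ I.map (algebraMap (𝓞 K) (𝓞 ℂ))

end CM

end

/-! The analytic input is a q-expansion principle. A holomorphic function invariant under SL₂(ℤ)
whose expansion at the cusp has algebraic integer coefficients is a polynomial in `j` over the
algebraic integers (`Expands.exists_polynomial`): multiples of powers of `j` are subtracted until no
pole is left. If functions g_S, indexed by the classes of matrices of determinant n, have such
expansions and are permuted by SL₂(ℤ), the coefficients of ∏(X − g_S) are of this kind, so every g_S
is integral wherever `j` is (`IsConjSystem.isIntegral`). For nonsquare n the function ∏(j − j∘S) is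
a polynomial in `j` with unit leading coefficient, so `j` is integral at fixed points of matrices of
determinant n (`isIntegral_j`).

Part 1. Choose l in R with (l) = 𝔭𝔢 and 𝔢 prime to p. Multiplication by l on 𝔞 is an integer matrix
A that fixes α and has determinant pn, with n the norm of 𝔢. The lattice 𝔞𝔭_R equals l𝔞 + p𝔞, which
has index p in 𝔞; this produces P and a factorization A = CP. The cocycle rule for φ gives φ_C(Pα)
φ_P(α) l¹² = (pn)¹². Since φ_C(Pα) divides n¹² and φ_P(α) divides p¹², comparison of the parts above
p gives (φ_P(α)) = 𝔭bar¹² (`IsMultiplier.generatesSameDivisor`).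

Part 2. Consider ∏(φ_S + f_S X) over the classes of determinant p. Each term f_S ∏_{S'≠S} φ_{S'} of
the coefficient of X contains either f or φ for diag(p,1), and both have expansions divisible by p;
so the coefficient is divisible by p at α. Isolating the factor of P' = P_𝔭bar, this reads φ_{P'}(α)
t + f_{P'}(α) w = p r, where w is the product of the other φ_S(α). By part 1 for 𝔭bar, (φ_{P'}(α)) =
𝔭¹²; since all φ_S multiply to p¹² times a unit (`exists_prod_phi`), (w) = 𝔭bar¹². Thus 𝔭 divides
f_{P'}(α) w while w is prime to 𝔭. -/

noncomputable section

namespace CM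

open UpperHalfPlane Filter Topology

/-! ### Convergent power series with algebraic integer coefficients -/

/-- The power series `c` converges at `q`, with sum `s`. -/
def HasEval (c : PowerSeries (𝓞 ℂ)) (q s : ℂ) : Prop :=
  HasSum (fun n : ℕ => ((c.coeff n : 𝓞 ℂ) : ℂ) * q ^ n) s

namespace HasEval

variable {c d : PowerSeries (𝓞 ℂ)} {q s t : ℂ}

lemma summable_norm (hc : HasEval c q s) :
    Summable fun n : ℕ => ‖((c.coeff n : 𝓞 ℂ) : ℂ) * q ^ n‖ :=
  hc.summable.norm

lemma add (hc : HasEval c q s) (hd : HasEval d q t) : HasEval (c + d) q (s + t) := by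
  refine (HasSum.add hc hd).congr_fun ?_
  intro n
  simp [add_mul]

lemma neg (hc : HasEval c q s) : HasEval (-c) q (-s) := by
  refine (HasSum.neg hc).congr_fun ?_
  intro n
  simp

lemma mul (hc : HasEval c q s) (hd : HasEval d q t) : HasEval (c * d) q (s * t) := by
  have hs := summable_norm_sum_mul_antidiagonal_of_summable_norm hc.summable_norm hd.summable_norm
  have ht := tsum_mul_tsum_eq_tsum_sum_antidiagonal_of_summable_norm hc.summable_norm
    hd.summable_norm
  rw [HasSum.tsum_eq hc, HasSum.tsum_eq hd] at ht
  rw [ht]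
  refine hs.of_norm.hasSum.congr_fun ?_
  intro n
  simp only [NumberField.RingOfIntegers.coe_eq_algebraMap]
  rw [PowerSeries.coeff_mul, map_sum, Finset.sum_mul]
  refine Finset.sum_congr rfl fun x hx => ?_
  rw [← Finset.HasAntidiagonal.mem_antidiagonal.mp hx, pow_add, map_mul]
  ring

lemma C (a : 𝓞 ℂ) (q : ℂ) : HasEval (PowerSeries.C a) q a := by
  have := hasSum_single (f := fun n : ℕ => (((PowerSeries.C a).coeff n : 𝓞 ℂ) : ℂ) * q ^ n) 0
    (fun n hn => by simp [PowerSeries.coeff_C, hn])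
  simpa [HasEval] using this

lemma X (q : ℂ) : HasEval PowerSeries.X q q := by
  have := hasSum_single
    (f := fun n : ℕ => (((PowerSeries.X : PowerSeries (𝓞 ℂ)).coeff n : 𝓞 ℂ) : ℂ) * q ^ n) 1
    (fun n hn => by simp [PowerSeries.coeff_X, hn])
  simpa [HasEval] using this

lemma one (q : ℂ) : HasEval 1 q 1 := by simpa using C 1 q

lemma pow (hc : HasEval c q s) (k : ℕ) : HasEval (c ^ k) q (s ^ k) := by
  induction k with
  | zero => simpa using one q
  | succ k ih => simpa [pow_succ] using ih.mul hc

lemma rescale {u : 𝓞 ℂ} (hc : HasEval c (u * q) s) : HasEval (PowerSeries.rescale u c) q s := by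
  refine HasSum.congr_fun hc ?_
  intro n
  simp [PowerSeries.coeff_rescale, mul_pow]
  ring

lemma expand {m : ℕ} (hm : m ≠ 0) (hc : HasEval c (q ^ m) s) :
    HasEval (PowerSeries.expand m hm c) q s := by
  have hinj : Function.Injective (fun n : ℕ => m * n) := fun a b h => by
    simpa [hm] using h
  refine (hinj.hasSum_iff ?_).mp (HasSum.congr_fun hc ?_)
  · intro x hx
    rw [PowerSeries.coeff_expand_of_not_dvd, NumberField.RingOfIntegers.coe_eq_algebraMap, map_zero,
      zero_mul]
    rintro ⟨k, rfl⟩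
    exact hx ⟨k, rfl⟩
  · intro n
    simp [pow_mul]

/-- The coefficients of a series that converges at some `q ≠ 0` grow at most geometrically. -/
lemma exists_bound (hc : HasEval c q s) (hq : q ≠ 0) :
    ∃ K r : ℝ, 0 ≤ K ∧ 0 < r ∧ ∀ n, ‖((c.coeff n : 𝓞 ℂ) : ℂ)‖ ≤ K * r ^ n := by
  obtain ⟨K, hK⟩ := hc.summable_norm.tendsto_atTop_zero.bddAbove_range
  have hq' : 0 < ‖q‖ := norm_pos_iff.mpr hq
  refine ⟨K, ‖q‖⁻¹, (norm_nonneg _).trans (hK ⟨0, rfl⟩), inv_pos.mpr hq', fun n => ?_⟩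
  have := hK ⟨n, rfl⟩
  simp only [norm_mul, norm_pow] at this
  rw [inv_pow, ← div_eq_mul_inv, le_div_iff₀ (pow_pos hq' n)]
  exact this

end HasEval

lemma summable_of_bound {c : PowerSeries (𝓞 ℂ)} {K r : ℝ}
    (h : ∀ n, ‖((c.coeff n : 𝓞 ℂ) : ℂ)‖ ≤ K * r ^ n) (hr : 0 < r) {q : ℂ} (hq : ‖q‖ < r⁻¹) :
    Summable fun n : ℕ => ((c.coeff n : 𝓞 ℂ) : ℂ) * q ^ n := by
  have h1 : r * ‖q‖ < 1 := by
    rwa [← lt_inv_mul_iff₀ hr, mul_one]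
  refine Summable.of_norm_bounded
    ((summable_geometric_of_lt_one (by positivity) h1).mul_left K) fun n => ?_
  rw [norm_mul, norm_pow, mul_pow, ← mul_assoc]
  gcongr
  exact h n

/-- The inverse of a power series of positive radius of convergence has again positive radius of
convergence. -/
lemma exists_bound_of_mul_eq_one {c d : PowerSeries (𝓞 ℂ)} (hcd : c * d = 1) {K r : ℝ}
    (hK : 0 ≤ K) (hr : 0 < r) (h : ∀ n, ‖((c.coeff n : 𝓞 ℂ) : ℂ)‖ ≤ K * r ^ n) :
    ∃ K' r' : ℝ, 0 ≤ K' ∧ 0 < r' ∧ ∀ n, ‖((d.coeff n : 𝓞 ℂ) : ℂ)‖ ≤ K' * r' ^ n := by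
  set D : ℝ := ‖((d.coeff 0 : 𝓞 ℂ) : ℂ)‖ with hD
  have hD0 : 0 ≤ D := norm_nonneg _
  have hcd0 : ((c.coeff 0 : 𝓞 ℂ) : ℂ) * ((d.coeff 0 : 𝓞 ℂ) : ℂ) = 1 := by
    have := congrArg (fun e : PowerSeries (𝓞 ℂ) => ((e.coeff 0 : 𝓞 ℂ) : ℂ)) hcd
    simpa [PowerSeries.coeff_mul] using this
  set M : ℝ := D * K with hM
  have hM0 : 0 ≤ M := mul_nonneg hD0 hK
  -- The growth rate is enlarged by 1 + M so that the recursion for the coefficients of `d` produces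
  -- the sum M ∑ (1 + M)^i, which telescopes to (1 + M)^(n+1) − 1.
  refine ⟨D, r * (1 + M), hD0, by positivity, fun n => ?_⟩
  induction n using Nat.strong_induction_on with
  | _ n ih =>
    rcases n with _ | n
    · simp [hD]
    have hrec : ((d.coeff (n + 1) : 𝓞 ℂ) : ℂ) = - ((d.coeff 0 : 𝓞 ℂ) : ℂ) *
        ∑ i ∈ Finset.range (n + 1),
          ((d.coeff i : 𝓞 ℂ) : ℂ) * ((c.coeff (n + 1 - i) : 𝓞 ℂ) : ℂ) := by
      have h1 := congrArg (fun e : PowerSeries (𝓞 ℂ) => ((e.coeff (n + 1) : 𝓞 ℂ) : ℂ)) hcd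
      simp only [mul_comm c d, PowerSeries.coeff_mul, PowerSeries.coeff_one,
        Finset.Nat.sum_antidiagonal_eq_sum_range_succ_mk, map_sum, map_mul] at h1
      rw [Finset.sum_range_succ] at h1
      simp only [Nat.sub_self, Nat.succ_ne_zero, if_false, map_zero] at h1
      linear_combination ((d.coeff 0 : 𝓞 ℂ) : ℂ) * h1 - ((d.coeff (n + 1) : 𝓞 ℂ) : ℂ) * hcd0
    have hgeom : M * ∑ i ∈ Finset.range (n + 1), (1 + M) ^ i = (1 + M) ^ (n + 1) - 1 := by
      have := mul_geom_sum (1 + M) (n + 1)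
      simpa using this
    calc ‖((d.coeff (n + 1) : 𝓞 ℂ) : ℂ)‖
        ≤ D * ∑ i ∈ Finset.range (n + 1), (D * (r * (1 + M)) ^ i) * (K * r ^ (n + 1 - i)) := by
          rw [hrec, norm_mul, norm_neg]
          refine mul_le_mul_of_nonneg_left ((norm_sum_le _ _).trans
            (Finset.sum_le_sum fun i hi => ?_)) hD0
          rw [norm_mul]
          exact mul_le_mul (ih i (Finset.mem_range.mp hi)) (h _) (norm_nonneg _) (by positivity)
      _ = D * r ^ (n + 1) * (M * ∑ i ∈ Finset.range (n + 1), (1 + M) ^ i) := by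
          rw [Finset.mul_sum, Finset.mul_sum, Finset.mul_sum]
          refine Finset.sum_congr rfl fun i hi => ?_
          have : r ^ (n + 1) = r ^ i * r ^ (n + 1 - i) := by
            rw [← pow_add]; congr 1; have := Finset.mem_range.mp hi; omega
          rw [this, mul_pow, hM]
          ring
      _ ≤ D * (r * (1 + M)) ^ (n + 1) := by
          rw [hgeom, mul_pow, mul_assoc]
          refine mul_le_mul_of_nonneg_left (mul_le_mul_of_nonneg_left ?_ (by positivity)) hD0
          linarith

/-! ### Laurent expansions at the cusp -/

/-- Near `i∞`, `q ^ N * g` is the sum of the power series `c` in `q = exp (2πiz/h)`. -/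
def Expands (h : ℕ) (g : ℍ → ℂ) (N : ℤ) (c : PowerSeries (𝓞 ℂ)) : Prop :=
  ∀ᶠ z : ℍ in atImInfty, HasEval c (Function.Periodic.qParam (h : ℝ) z)
    (Function.Periodic.qParam (h : ℝ) z ^ N * g z)

local notation "𝕢" => Function.Periodic.qParam

lemma tendsto_qParam {h : ℕ} [NeZero h] :
    Tendsto (fun z : ℍ => 𝕢 (h : ℝ) z) atImInfty (𝓝 0) :=
  qParam_tendsto_atImInfty (by exact_mod_cast NeZero.pos h)

namespace Expands

variable {h : ℕ} {f g : ℍ → ℂ} {M N : ℤ} {c d : PowerSeries (𝓞 ℂ)}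

lemma add (hf : Expands h f N c) (hg : Expands h g N d) : Expands h (f + g) N (c + d) := by
  filter_upwards [hf, hg] with z h1 h2
  simpa [mul_add] using h1.add h2

lemma neg (hf : Expands h f N c) : Expands h (-f) N (-c) := by
  filter_upwards [hf] with z h1
  simpa using h1.neg

lemma sub (hf : Expands h f N c) (hg : Expands h g N d) : Expands h (f - g) N (c - d) := by
  simpa [sub_eq_add_neg] using hf.add hg.neg

lemma mul (hf : Expands h f M c) (hg : Expands h g N d) :
    Expands h (f * g) (M + N) (c * d) := by
  filter_upwards [hf, hg] with z h1 h2
  have := h1.mul h2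
  rw [zpow_add₀ (Function.Periodic.qParam_ne_zero _)]
  convert this using 1
  simp only [Pi.mul_apply]
  ring

/-- `N` only bounds the pole order, since the constant term of `c` may vanish. Raising it brings two
expansions to a common exponent before they are added. -/
lemma shift (hf : Expands h f N c) (k : ℕ) : Expands h f (N + k) (PowerSeries.X ^ k * c) := by
  filter_upwards [hf] with z h1
  have := ((HasEval.X (𝕢 (h : ℝ) z)).pow k).mul h1
  rw [zpow_add₀ (Function.Periodic.qParam_ne_zero _), zpow_natCast]
  convert this using 1
  ring

/-- A vanishing constant term allows the bound on the pole order to be lowered; this is the descent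
step of `Expands.exists_polynomial`. -/
lemma unshift (hf : Expands h f N (PowerSeries.X * c)) : Expands h f (N - 1) c := by
  filter_upwards [hf] with z h1
  have hq : 𝕢 (h : ℝ) z ≠ 0 := Function.Periodic.qParam_ne_zero _
  rw [zpow_sub_one₀ hq]
  have h2 := (hasSum_nat_add_iff' 1).mpr h1
  simp only [Finset.range_one, Finset.sum_singleton, PowerSeries.coeff_zero_X_mul, map_zero,
    zero_mul, sub_zero, PowerSeries.coeff_succ_X_mul] at h2
  have h3 := h2.mul_right (𝕢 (h : ℝ) z)⁻¹
  rw [show 𝕢 (h : ℝ) z ^ N * (𝕢 (h : ℝ) z)⁻¹ * f z = 𝕢 (h : ℝ) z ^ N * f z * (𝕢 (h : ℝ) z)⁻¹ by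
    ring]
  refine h3.congr_fun fun n => ?_
  rw [pow_succ]
  field_simp

lemma const (h : ℕ) (a : 𝓞 ℂ) : Expands h (fun _ => (a : ℂ)) 0 (PowerSeries.C a) :=
  .of_forall fun z => by simpa using HasEval.C a _

lemma prod {ι : Type*} (s : Finset ι) {f : ι → ℍ → ℂ} {N : ι → ℤ} {c : ι → PowerSeries (𝓞 ℂ)}
    (hf : ∀ i ∈ s, Expands h (f i) (N i) (c i)) :
    Expands h (∏ i ∈ s, f i) (∑ i ∈ s, N i) (∏ i ∈ s, c i) := by
  classical
  induction s using Finset.induction_on with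
  | empty => simpa using! const h 1
  | insert i s hi ih =>
    rw [Finset.prod_insert hi, Finset.sum_insert hi, Finset.prod_insert hi]
    exact (hf i (Finset.mem_insert_self i s)).mul
      (ih fun k hk => hf k (Finset.mem_insert_of_mem hk))

lemma pow (hf : Expands h f N c) (k : ℕ) : Expands h (f ^ k) (k * N) (c ^ k) := by
  simpa using prod (Finset.range k) (fun i _ => hf)

lemma exists_bound [NeZero h] (hf : Expands h f N c) :
    ∃ K r : ℝ, 0 ≤ K ∧ 0 < r ∧ ∀ n, ‖((c.coeff n : 𝓞 ℂ) : ℂ)‖ ≤ K * r ^ n := by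
  obtain ⟨z, hz⟩ := hf.exists
  exact hz.exists_bound (Function.Periodic.qParam_ne_zero _)

/-- The formal inverse has positive radius of convergence and q tends to 0 at the cusp, so close to
the cusp it also sums to the inverse. -/
lemma inv [NeZero h] (hf : Expands h f N c) (hcd : c * d = 1) : Expands h f⁻¹ (-N) d := by
  obtain ⟨K, r, hK, hr, hb⟩ := hf.exists_bound
  obtain ⟨K', r', hK', hr', hb'⟩ := exists_bound_of_mul_eq_one hcd hK hr hb
  have hsmall : ∀ᶠ z : ℍ in atImInfty, ‖𝕢 (h : ℝ) z‖ < r'⁻¹ := by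
    have := (tendsto_qParam (h := h)).norm
    rw [norm_zero] at this
    exact this.eventually_lt_const (inv_pos.mpr hr')
  filter_upwards [hf, hsmall] with z h1 h2
  have h3 : HasEval d (𝕢 (h : ℝ) z) _ := (summable_of_bound hb' hr' h2).hasSum
  have h4 := h1.mul h3
  rw [hcd] at h4
  have h5 := HasSum.unique h4 (HasEval.one _)
  have h6 : 𝕢 (h : ℝ) z ^ (-N) * f⁻¹ z =
      ∑' n : ℕ, ((d.coeff n : 𝓞 ℂ) : ℂ) * 𝕢 (h : ℝ) z ^ n := by
    rw [Pi.inv_apply, zpow_neg, ← mul_inv]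
    exact inv_eq_of_mul_eq_one_right h5
  rw [h6]
  exact h3

lemma tendsto [NeZero h] (hf : Expands h f N c) :
    Tendsto (fun z : ℍ => 𝕢 (h : ℝ) z ^ N * f z) atImInfty
      (𝓝 ((PowerSeries.constantCoeff c : 𝓞 ℂ) : ℂ)) := by
  obtain ⟨K, r, hK, hr, hb⟩ := hf.exists_bound
  -- For |q| < 1/(2r) the terms are dominated by K·2⁻ⁿ, uniformly in z.
  have hsmall : ∀ᶠ z : ℍ in atImInfty, ‖𝕢 (h : ℝ) z‖ < (2 * r)⁻¹ := by
    have := (tendsto_qParam (h := h)).norm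
    rw [norm_zero] at this
    exact this.eventually_lt_const (by positivity)
  have h1 : Tendsto (fun z : ℍ => ∑' n : ℕ, ((c.coeff n : 𝓞 ℂ) : ℂ) * 𝕢 (h : ℝ) z ^ n) atImInfty
      (𝓝 (∑' n : ℕ, ((c.coeff n : 𝓞 ℂ) : ℂ) * 0 ^ n)) := by
    refine tendsto_tsum_of_dominated_convergence (bound := fun n => K * (1 / 2) ^ n)
      ((summable_geometric_of_lt_one (by norm_num) (by norm_num)).mul_left K) (fun n => ?_) ?_
    · exact ((tendsto_qParam (h := h)).pow n).const_mul _
    · filter_upwards [hsmall] with z hz n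
      rw [norm_mul, norm_pow]
      calc _ ≤ (K * r ^ n) * ((2 * r)⁻¹) ^ n := by
            gcongr
            exact hb n
        _ = K * (1 / 2) ^ n := by
            rw [mul_assoc, ← mul_pow]
            congr 2
            field_simp
  have h2 : ∑' n : ℕ, ((c.coeff n : 𝓞 ℂ) : ℂ) * 0 ^ n =
      ((PowerSeries.constantCoeff c : 𝓞 ℂ) : ℂ) := by
    rw [tsum_eq_single 0 (fun n hn => by simp [hn])]
    simp
  rw [h2] at h1
  refine h1.congr' ?_
  filter_upwards [hf] with z hz
  exact HasSum.tsum_eq hz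

/-- Substitution of a map `w` for which `q₁ (w z)` is a root of unity times a power of `q`. -/
lemma comp {n m : ℕ} (hm : m ≠ 0) (hf : Expands 1 f N c) {w : ℍ → ℍ}
    (hw : Tendsto w atImInfty atImInfty) (ζ : (𝓞 ℂ)ˣ)
    (hq : ∀ z, 𝕢 (1 : ℝ) (w z) = ((ζ : 𝓞 ℂ) : ℂ) * 𝕢 (n : ℝ) z ^ m) :
    Expands n (f ∘ w) (m * N) (PowerSeries.C ((ζ ^ (-N) : (𝓞 ℂ)ˣ) : 𝓞 ℂ) *
      PowerSeries.expand m hm (PowerSeries.rescale (ζ : 𝓞 ℂ) c)) := by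
  filter_upwards [hw.eventually hf] with z hz
  rw [Nat.cast_one, hq] at hz
  have h1 := (HasEval.C ((ζ ^ (-N) : (𝓞 ℂ)ˣ) : 𝓞 ℂ) (𝕢 (n : ℝ) z)).mul (hz.rescale.expand hm)
  have h2 : (((ζ ^ (-N) : (𝓞 ℂ)ˣ) : 𝓞 ℂ) : ℂ) * ((ζ : 𝓞 ℂ) : ℂ) ^ N = 1 := by
    have h3 : (((ζ ^ N : (𝓞 ℂ)ˣ) : 𝓞 ℂ) : ℂ) = ((ζ : 𝓞 ℂ) : ℂ) ^ N := by
      have := congrArg Units.val (map_zpow (Units.map (algebraMap (𝓞 ℂ) ℂ : 𝓞 ℂ →* ℂ)) ζ N)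
      rw [Units.val_zpow_eq_zpow_val] at this
      exact this
    rw [← h3, ← map_mul, ← Units.val_mul, ← zpow_add]
    simp
  convert h1 using 1
  rw [mul_zpow, ← mul_assoc, ← mul_assoc, h2, one_mul, zpow_mul, zpow_natCast, Function.comp_apply]

end Expands

/-! ### Expansions of the discriminant and of the absolute invariant -/

lemma Expands.of_const_mul {h : ℕ} {f g : ℍ → ℂ} {N : ℤ} {c : PowerSeries (𝓞 ℂ)} {a : 𝓞 ℂ}
    (ha : a ≠ 0) (hf : Expands h g N (PowerSeries.C a * c)) (hg : ∀ z, g z = a * f z) :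
    Expands h f N c := by
  have ha' : (a : ℂ) ≠ 0 := fun h0 => ha (NumberField.RingOfIntegers.ext (by simpa using h0))
  filter_upwards [hf] with z hz
  have h1 := HasSum.mul_left (a : ℂ)⁻¹ hz
  rw [hg, show (a : ℂ)⁻¹ * (𝕢 (h : ℝ) z ^ N * (a * f z)) = 𝕢 (h : ℝ) z ^ N * f z by
    field_simp] at h1
  refine h1.congr_fun fun n => ?_
  rw [PowerSeries.coeff_C_mul]
  simp only [NumberField.RingOfIntegers.coe_eq_algebraMap] at ha' ⊢
  rw [map_mul]
  field_simp

/-- The series `∑ σ_k(n) qⁿ`. -/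
def sigmaSeries (k : ℕ) : PowerSeries (𝓞 ℂ) :=
  PowerSeries.mk fun n => ((ArithmeticFunction.sigma k n : ℕ) : 𝓞 ℂ)

lemma expands_E₄ : Expands 1 ModularForm.E₄ 0 (1 + PowerSeries.C 240 * sigmaSeries 3) := by
  refine .of_forall fun z => ?_
  have := ModularForm.hasSum_qExpansion ModularForm.E₄ one_pos one_mem_strictPeriods_SL z
  rw [zpow_zero, one_mul, Nat.cast_one]
  refine this.congr_fun fun n => ?_
  rw [EisensteinSeries.E_qExpansion_coeff _ ⟨2, rfl⟩, show bernoulli 4 = -1 / 30 by decide +kernel]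
  rcases n with _ | n
  · simp [sigmaSeries]
  · simp [sigmaSeries, PowerSeries.coeff_C_mul, PowerSeries.coeff_one]
    norm_num
    exact .inl (map_ofNat (algebraMap (𝓞 ℂ) ℂ) 240)

lemma expands_E₆ : Expands 1 ModularForm.E₆ 0 (1 - PowerSeries.C 504 * sigmaSeries 5) := by
  refine .of_forall fun z => ?_
  have := ModularForm.hasSum_qExpansion ModularForm.E₆ one_pos one_mem_strictPeriods_SL z
  rw [zpow_zero, one_mul, Nat.cast_one]
  refine this.congr_fun fun n => ?_
  rw [EisensteinSeries.E_qExpansion_coeff _ ⟨3, rfl⟩, show bernoulli 6 = 1 / 42 by decide +kernel]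
  rcases n with _ | n
  · simp [sigmaSeries]
  · simp [sigmaSeries, PowerSeries.coeff_C_mul, PowerSeries.coeff_one]
    norm_num
    exact .inl (map_ofNat (algebraMap (𝓞 ℂ) ℂ) 504)

/-- The linear part of E₄³ − E₆² is 720 ∑σ₃qⁿ + 1008 ∑σ₅qⁿ, that is, 144 times 5σ₃ + 7σ₅. Division
by 1728 therefore needs one more factor 12, which 5d³ + 7d⁵ supplies for every divisor d. -/
lemma twelve_dvd_sigma (n : ℕ) :
    12 ∣ 5 * ArithmeticFunction.sigma 3 n + 7 * ArithmeticFunction.sigma 5 n := by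
  rw [ArithmeticFunction.sigma_apply, ArithmeticFunction.sigma_apply, Finset.mul_sum,
    Finset.mul_sum, ← Finset.sum_add_distrib]
  refine Finset.dvd_sum fun d _ => ?_
  have h : ∀ x : ZMod 12, 5 * x ^ 3 + 7 * x ^ 5 = 0 := by decide
  rw [← ZMod.natCast_eq_zero_iff]
  push_cast
  exact h d

lemma exists_expands_discriminant :
    ∃ c, Expands 1 ModularForm.discriminant (-1) c ∧ PowerSeries.constantCoeff c = 1 := by
  set A := sigmaSeries 3 with hA
  set B := sigmaSeries 5 with hB
  have hA0 : PowerSeries.constantCoeff A = 0 := by simp [hA, sigmaSeries]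
  have hB0 : PowerSeries.constantCoeff B = 0 := by simp [hB, sigmaSeries]
  let G : PowerSeries (𝓞 ℂ) := PowerSeries.mk fun n =>
    (((5 * ArithmeticFunction.sigma 3 n + 7 * ArithmeticFunction.sigma 5 n) / 12 : ℕ) : 𝓞 ℂ)
  have hG : PowerSeries.C 12 * G = PowerSeries.C 5 * A + PowerSeries.C 7 * B := by
    ext1 n
    have := Nat.mul_div_cancel' (twelve_dvd_sigma n)
    have := congrArg (Nat.cast : ℕ → 𝓞 ℂ) this
    simpa [G, hA, hB, sigmaSeries] using this
  obtain ⟨A', hA'⟩ := PowerSeries.X_dvd_iff.mpr hA0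
  obtain ⟨B', hB'⟩ := PowerSeries.X_dvd_iff.mpr hB0
  have hG0 : PowerSeries.constantCoeff G = 0 := by simp [G]
  obtain ⟨G', hG'⟩ := PowerSeries.X_dvd_iff.mpr hG0
  have hG'0 : PowerSeries.constantCoeff G' = 1 := by
    have : PowerSeries.coeff 1 G = 1 := by simp [G]
    rwa [hG', ← zero_add 1, PowerSeries.coeff_succ_X_mul, PowerSeries.coeff_zero_eq_constantCoeff]
      at this
  -- The coefficients are 100 = 3·240²/1728, 8000 = 240³/1728 and 147 = 504²/1728. The linear part
  -- is `G`, with first coefficient (5 + 7)/12 = 1.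
  let D : PowerSeries (𝓞 ℂ) := G' + PowerSeries.X * (PowerSeries.C 100 * A' ^ 2 +
    PowerSeries.C 8000 * PowerSeries.X * A' ^ 3 - PowerSeries.C 147 * B' ^ 2)
  have hid : (1 + PowerSeries.C 240 * A) ^ 3 - (1 - PowerSeries.C 504 * B) ^ 2 =
      PowerSeries.C 1728 * (PowerSeries.X * D) := by
    have hX : PowerSeries.X * D = G + PowerSeries.C 100 * A ^ 2 + PowerSeries.C 8000 * A ^ 3 -
        PowerSeries.C 147 * B ^ 2 := by
      simp only [D]
      rw [hG', hA', hB']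
      ring
    rw [hX]
    simp only [map_ofNat] at hG ⊢
    linear_combination -144 * hG
  refine ⟨D, ?_, by simp [D, hG'0]⟩
  have h1 : Expands 1 (⇑ModularForm.E₄ ^ 3 - ⇑ModularForm.E₆ ^ 2) 0
      (PowerSeries.C 1728 * (PowerSeries.X * D)) := by
    rw [← hid]
    have := expands_E₄.pow 3
    have h6 := expands_E₆.pow 2
    rw [mul_zero] at this h6
    exact this.sub h6
  have h2 : Expands 1 ModularForm.discriminant 0 (PowerSeries.X * D) := by
    refine h1.of_const_mul (by norm_num) fun z => ?_
    rw [ModularForm.discriminant_eq_E₄_cube_sub_E₆_sq, NumberField.RingOfIntegers.coe_eq_algebraMap,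
      map_ofNat]
    simp only [Pi.sub_apply, Pi.pow_apply]
    ring
  exact h2.unshift

lemma exists_expands_j : ∃ c, Expands 1 j 1 c ∧ PowerSeries.constantCoeff c = 1 := by
  obtain ⟨c, hc, hc0⟩ := exists_expands_discriminant
  obtain ⟨u, hu⟩ : IsUnit c := PowerSeries.isUnit_iff_constantCoeff.mpr (by simp [hc0])
  have hcd : c * (u⁻¹ : (PowerSeries (𝓞 ℂ))ˣ) = 1 := by rw [← hu]; simp
  have h := (expands_E₄.pow 3).mul (hc.inv hcd)
  refine ⟨_, h, ?_⟩
  have h1 := congrArg PowerSeries.constantCoeff hcd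
  simp only [map_mul, hc0, one_mul, map_one] at h1
  simp [h1, sigmaSeries]

/-! ### Modular functions of level one -/

lemma discriminant_smul (γ : SL(2, ℤ)) (z : ℍ) : ModularForm.discriminant (γ • z) =
    ((γ 1 0 : ℂ) * z + γ 1 1) ^ 12 * ModularForm.discriminant z := by
  have := SlashInvariantForm.slash_action_eqn'' CuspForm.discriminant
    (γ := Matrix.SpecialLinearGroup.mapGL ℝ γ) (MonoidHom.mem_range.mpr ⟨γ, rfl⟩) z
  simpa [denom] using! this

lemma j_smul (γ : SL(2, ℤ)) (z : ℍ) : j (γ • z) = j z := by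
  have h := SlashInvariantForm.slash_action_eqn'' ModularForm.E₄
    (γ := Matrix.SpecialLinearGroup.mapGL ℝ γ) (MonoidHom.mem_range.mpr ⟨γ, rfl⟩) z
  have h4 : ModularForm.E₄ (γ • z) = ((γ 1 0 : ℂ) * z + γ 1 1) ^ 4 * ModularForm.E₄ z := by
    simpa [denom] using! h
  have hd := discriminant_smul γ z
  have h0 := ModularForm.discriminant_ne_zero (γ • z)
  have h1 : ((γ 1 0 : ℂ) * z + γ 1 1) ≠ 0 := by
    intro h2
    rw [hd, h2] at h0
    simp at h0
  rw [j, j, h4, hd]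
  have := ModularForm.discriminant_ne_zero z
  field_simp

lemma mdifferentiable_discriminant :
    MDifferentiable 𝓘(ℂ) 𝓘(ℂ) ModularForm.discriminant :=
  CuspForm.discriminant.holo'

lemma mdifferentiable_j : MDifferentiable 𝓘(ℂ) 𝓘(ℂ) j :=
  (ModularForm.E₄.holo'.pow 3).div mdifferentiable_discriminant ModularForm.discriminant_ne_zero

/-- A holomorphic function of level one which has a limit at the cusp is constant. -/
lemma eq_of_tendsto {F : ℍ → ℂ} (hF : MDifferentiable 𝓘(ℂ) 𝓘(ℂ) F)
    (hinv : ∀ (γ : SL(2, ℤ)) z, F (γ • z) = F z) {l : ℂ} (hl : Tendsto F atImInfty (𝓝 l)) (z : ℍ) :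
    F z = l := by
  have hslash : ∀ γ : SL(2, ℤ), SlashAction.map (0 : ℤ) γ F = F := by
    intro γ
    ext z
    rw [ModularForm.SL_slash_apply, hinv]
    simp
  -- An invariant function is a form of weight 0. All cusps are equivalent to i∞, where the limit
  -- gives boundedness, and level-one forms of weight 0 are constant.
  let f : ModularForm (Matrix.SpecialLinearGroup.mapGL ℝ (R := ℤ) (n := Fin 2)).range 0 :=
    { toFun := F
      slash_action_eq' := fun _ ⟨γ, hγ⟩ => hγ ▸ hslash γ
      holo' := hF
      bdd_at_cusps' := fun {c} hc => by
        rw [Subgroup.IsArithmetic.isCusp_iff_isCusp_SL2Z] at hc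
        rw [OnePoint.isBoundedAt_iff_forall_SL2Z hc]
        intro γ _
        rw [hslash γ]
        exact hl.isBigO_one ℝ }
  obtain ⟨c, hc⟩ := ModularFormClass.levelOne_weight_zero_const f
  have hc' : F = Function.const ℍ c := hc
  rw [hc'] at hl ⊢
  exact tendsto_nhds_unique tendsto_const_nhds hl

/-- Since q^N F has a limit and N < 0, F itself tends to 0 at the cusp. -/
lemma Expands.eq_zero_of_neg {h : ℕ} [NeZero h] {F : ℍ → ℂ} (hF : MDifferentiable 𝓘(ℂ) 𝓘(ℂ) F)
    (hinv : ∀ (γ : SL(2, ℤ)) z, F (γ • z) = F z) {N : ℤ} (hN : N < 0) {c : PowerSeries (𝓞 ℂ)}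
    (hc : Expands h F N c) (z : ℍ) : F z = 0 := by
  refine eq_of_tendsto hF hinv ?_ z
  have h1 := ((tendsto_qParam (h := h)).pow (-N).toNat).mul hc.tendsto
  rw [zero_pow (by omega), zero_mul] at h1
  refine h1.congr fun z => ?_
  have hq : 𝕢 (h : ℝ) z ≠ 0 := Function.Periodic.qParam_ne_zero _
  rw [← mul_assoc, ← zpow_natCast, ← zpow_add₀ hq, Int.toNat_of_nonneg (by omega)]
  simp

lemma Expands.eq_of_zero {h : ℕ} [NeZero h] {F : ℍ → ℂ} (hF : MDifferentiable 𝓘(ℂ) 𝓘(ℂ) F)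
    (hinv : ∀ (γ : SL(2, ℤ)) z, F (γ • z) = F z) {c : PowerSeries (𝓞 ℂ)}
    (hc : Expands h F 0 c) (z : ℍ) : F z = (PowerSeries.constantCoeff c : 𝓞 ℂ) := by
  refine eq_of_tendsto hF hinv ?_ z
  simpa using hc.tendsto

/-- A function of level one without zeros and poles is constant. -/
lemma Expands.eq_of_ne_zero {h : ℕ} [NeZero h] {F : ℍ → ℂ} (hF : MDifferentiable 𝓘(ℂ) 𝓘(ℂ) F)
    (hinv : ∀ (γ : SL(2, ℤ)) z, F (γ • z) = F z) (hF0 : ∀ z, F z ≠ 0) {N : ℤ}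
    {c : PowerSeries (𝓞 ℂ)} (hc : Expands h F N c) (hu : IsUnit (PowerSeries.constantCoeff c))
    (z : ℍ) : F z = (PowerSeries.constantCoeff c : 𝓞 ℂ) := by
  -- A zero at the cusp would force F = 0, and a pole would force 1/F = 0, the unit constant term
  -- making the expansion of 1/F available. Only N = 0 survives.
  rcases lt_trichotomy N 0 with hN | rfl | hN
  · exact absurd (hc.eq_zero_of_neg hF hinv hN z) (hF0 z)
  · exact hc.eq_of_zero hF hinv z
  · obtain ⟨u, hu⟩ := PowerSeries.isUnit_iff_constantCoeff.mpr hu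
    have hcd : c * (u⁻¹ : (PowerSeries (𝓞 ℂ))ˣ) = 1 := by rw [← hu]; simp
    have h1 := (hc.inv hcd).eq_zero_of_neg (hF.inv hF0)
      (fun γ z => by rw [Pi.inv_apply, Pi.inv_apply, hinv]) (neg_lt_zero.mpr hN) z
    exact absurd (inv_eq_zero.mp h1) (hF0 z)

/-! ### Integrality of exponents and polynomials in `j` -/

lemma im_T_smul (z : ℍ) : (ModularGroup.T • z).im = z.im := by
  rw [modular_T_smul]
  simp

lemma tendsto_T_smul : Tendsto (fun z : ℍ => ModularGroup.T • z) atImInfty atImInfty := by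
  rw [atImInfty, tendsto_comap_iff]
  exact tendsto_comap.congr fun z => (im_T_smul z).symm

/-- The exponents of the expansion in `q^{1/h}` of a function of level one are integers. -/
lemma Expands.dvd_of_ne_zero {h : ℕ} [NeZero h] {F : ℍ → ℂ}
    (hinv : ∀ (γ : SL(2, ℤ)) z, F (γ • z) = F z) {N : ℤ} {c : PowerSeries (𝓞 ℂ)}
    (hc : Expands h F N c) (hc0 : PowerSeries.constantCoeff c ≠ 0) : (h : ℤ) ∣ N := by
  have hh : (h : ℂ) ≠ 0 := by exact_mod_cast NeZero.ne h
  set ζ : ℂ := Complex.exp (2 * Real.pi * Complex.I / h) with hζ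
  have hprim : IsPrimitiveRoot ζ h := Complex.isPrimitiveRoot_exp h (NeZero.ne h)
  -- Translation by 1 multiplies q^{1/h} by ζ and leaves F unchanged, so the nonzero limit of
  -- q^{N/h} F is multiplied by ζ^N; hence ζ^N = 1.
  have hq : ∀ z : ℍ, 𝕢 (h : ℝ) (ModularGroup.T • z : ℍ) = ζ * 𝕢 (h : ℝ) z := by
    intro z
    rw [modular_T_smul, hζ]
    simp only [Function.Periodic.qParam, coe_vadd, ← Complex.exp_add]
    congr 1
    push_cast
    field_simp
  have h1 := hc.tendsto
  have h2 := h1.comp tendsto_T_smul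
  have h3 := (h1.const_mul (ζ ^ N))
  have h4 := tendsto_nhds_unique h2 (h3.congr fun z => by
    simp only [Function.comp_apply]
    rw [hq, hinv, mul_zpow, mul_assoc])
  have h5 : ((PowerSeries.constantCoeff c : 𝓞 ℂ) : ℂ) ≠ 0 := fun h0 =>
    hc0 (NumberField.RingOfIntegers.ext (by simpa using h0))
  have h6 : ζ ^ N = 1 := by
    have := mul_right_cancel₀ h5 ((one_mul _).trans h4)
    exact this.symm
  exact (hprim.zpow_eq_one_iff_dvd N).mp h6

/-- An expansion in powers of `q` is an expansion in powers of `q^{1/h}`. -/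
lemma Expands.ramify {F : ℍ → ℂ} {N : ℤ} {c : PowerSeries (𝓞 ℂ)} (hc : Expands 1 F N c) (h : ℕ)
    [NeZero h] : ∃ d, Expands h F (h * N) d ∧
      PowerSeries.constantCoeff d = PowerSeries.constantCoeff c := by
  refine ⟨_, hc.comp (n := h) (NeZero.ne h) (w := id) tendsto_id 1 fun z => ?_, by simp⟩
  have hh : (h : ℂ) ≠ 0 := by exact_mod_cast NeZero.ne h
  simp only [id, Units.val_one, map_one, one_mul, Function.Periodic.qParam,
    ← Complex.exp_nat_mul]
  congr 1
  push_cast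
  field_simp

/-- A holomorphic function of level one with integral expansion is an integral polynomial in `j`. -/
theorem Expands.exists_polynomial {h : ℕ} [NeZero h] {F : ℍ → ℂ}
    (hF : MDifferentiable 𝓘(ℂ) 𝓘(ℂ) F) (hinv : ∀ (γ : SL(2, ℤ)) z, F (γ • z) = F z) {N : ℕ}
    {c : PowerSeries (𝓞 ℂ)} (hc : Expands h F N c) :
    ∃ Q : Polynomial (𝓞 ℂ), (∀ z, F z = Polynomial.aeval (j z) Q) ∧ h * Q.natDegree ≤ N ∧
      (PowerSeries.constantCoeff c ≠ 0 →
        ∃ m, h * m = N ∧ Q.coeff m = PowerSeries.constantCoeff c) := by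
  induction N generalizing F c with
  | zero =>
    refine ⟨Polynomial.C (PowerSeries.constantCoeff c), fun z => ?_, by simp, fun _ => ⟨0, by simp⟩⟩
    rw [hc.eq_of_zero hF hinv z]
    simp [NumberField.RingOfIntegers.coe_eq_algebraMap]
  | succ N ih =>
    by_cases hc0 : PowerSeries.constantCoeff c = 0
    · obtain ⟨d, rfl⟩ := PowerSeries.X_dvd_iff.mpr hc0
      have h1 := hc.unshift
      rw [Nat.cast_succ, add_sub_cancel_right] at h1
      obtain ⟨Q, hQ, hdeg, -⟩ := ih hF hinv h1
      exact ⟨Q, hQ, by omega, fun h0 => absurd hc0 h0⟩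
    · obtain ⟨m, hm⟩ : h ∣ N + 1 := by
        have := hc.dvd_of_ne_zero hinv hc0
        exact_mod_cast this
      obtain ⟨cj, hcj, hcj0⟩ := exists_expands_j
      obtain ⟨cj', hj, hcj0'⟩ := hcj.ramify h
      rw [hcj0] at hcj0'
      -- `j` has leading coefficient 1, so c₀ j^m has the same leading term as F and the difference
      -- has smaller pole order.
      have hjm := (Expands.const h (PowerSeries.constantCoeff c)).mul (hj.pow m)
      rw [show (0 : ℤ) + m * (h * 1) = (N + 1 : ℕ) by rw [hm]; push_cast; ring] at hjm
      have hdiff := hc.sub hjm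
      generalize hd' : c - _ = d' at hdiff
      obtain ⟨d, rfl⟩ := PowerSeries.X_dvd_iff.mpr
        (show PowerSeries.constantCoeff d' = 0 by rw [← hd']; simp [hcj0'])
      have h1 := hdiff.unshift
      rw [Nat.cast_succ, add_sub_cancel_right] at h1
      obtain ⟨Q, hQ, hdeg, -⟩ := ih (hF.sub (mdifferentiable_const.mul (mdifferentiable_j.pow m)))
        (fun γ z => by simp only [Pi.sub_apply, Pi.mul_apply, Pi.pow_apply, hinv, j_smul]) h1
      have hh : 0 < h := NeZero.pos h
      -- The remainder has pole order at most N < hm. Its polynomial therefore has degree below m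
      -- and leaves the coefficient of X^m equal to c₀.
      have hQm : Q.natDegree < m := by
        by_contra! hle
        have := Nat.mul_le_mul_left h hle
        omega
      refine ⟨Polynomial.C (PowerSeries.constantCoeff c) * Polynomial.X ^ m + Q, fun z => ?_, ?_,
        fun _ => ⟨m, hm.symm, ?_⟩⟩
      · rw [map_add, ← hQ z]
        simp [NumberField.RingOfIntegers.coe_eq_algebraMap]
      · rw [hm]
        refine Nat.mul_le_mul_left h (Polynomial.natDegree_add_le_of_degree_le ?_ hQm.le)
        exact Polynomial.natDegree_C_mul_X_pow_le _ _
      · rw [Polynomial.coeff_add, Polynomial.coeff_C_mul_X_pow, if_pos rfl,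
          Polynomial.coeff_eq_zero_of_natDegree_lt hQm, add_zero]

/-! ### Functions with integral expansions -/

/-- The ring of holomorphic functions on the upper half-plane with an expansion in `q^{1/h}` whose
coefficients are algebraic integers. -/
def integralRing (h : ℕ) : Subring (ℍ → ℂ) where
  carrier := {F | MDifferentiable 𝓘(ℂ) 𝓘(ℂ) F ∧ ∃ N c, Expands h F N c}
  mul_mem' := fun ⟨hf, M, c, hc⟩ ⟨hg, N, d, hd⟩ => ⟨hf.mul hg, _, _, hc.mul hd⟩
  one_mem' := ⟨mdifferentiable_const, 0, _, by simpa using! Expands.const h 1⟩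
  add_mem' := fun {f g} ⟨hf, M, c, hc⟩ ⟨hg, N, d, hd⟩ => by
    refine ⟨hf.add hg, ?_⟩
    rcases le_total M N with h | h
    · have := hc.shift (N - M).toNat
      rw [Int.toNat_of_nonneg (by omega), add_sub_cancel] at this
      exact ⟨_, _, this.add hd⟩
    · have := hd.shift (M - N).toNat
      rw [Int.toNat_of_nonneg (by omega), add_sub_cancel] at this
      exact ⟨_, _, hc.add this⟩
  zero_mem' := ⟨mdifferentiable_const, 0, _, by simpa using! Expands.const h 0⟩
  neg_mem' := fun ⟨hf, M, c, hc⟩ => ⟨hf.neg, _, _, hc.neg⟩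

lemma exists_coe_eq {x : ℂ} (hx : IsIntegral ℤ x) : ∃ y : 𝓞 ℂ, (y : ℂ) = x :=
  ⟨⟨x, hx⟩, rfl⟩

/-- Values of integral functions of level one are integral where `j` is. -/
lemma isIntegral_of_mem_integralRing {h : ℕ} [NeZero h] {F : ℍ → ℂ} (hF : F ∈ integralRing h)
    (hinv : ∀ (γ : SL(2, ℤ)) z, F (γ • z) = F z) {z : ℍ} (hz : IsIntegral ℤ (j z)) :
    IsIntegral ℤ (F z) := by
  obtain ⟨hF, N, c, hc⟩ := hF
  have h1 := hc.shift (-N).toNat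
  obtain ⟨M, hM⟩ := Int.eq_ofNat_of_zero_le (show 0 ≤ N + (-N).toNat by omega)
  rw [hM] at h1
  obtain ⟨Q, hQ, -⟩ := h1.exists_polynomial hF hinv
  rw [hQ z]
  obtain ⟨y, hy⟩ := exists_coe_eq hz
  rw [← hy, NumberField.RingOfIntegers.coe_eq_algebraMap, Polynomial.aeval_algebraMap_apply]
  exact NumberField.RingOfIntegers.isIntegral_coe _

/-! ### Integer matrices acting on the upper half-plane -/

/-- The factor `cω + d` of an integer matrix. -/
def autFactor (S : Matrix (Fin 2) (Fin 2) ℤ) (z : ℍ) : ℂ := (S 1 0 : ℂ) * z + S 1 1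

lemma autFactor_ne_zero {S : Matrix (Fin 2) (Fin 2) ℤ} (hS : 0 < S.det) (z : ℍ) :
    autFactor S z ≠ 0 := by
  intro h
  have him := congrArg Complex.im h
  have h10 : S 1 0 = 0 := by
    simpa [autFactor, z.im_ne_zero] using him
  have h11 : S 1 1 = 0 := by
    simpa [autFactor, h10] using h
  simp [Matrix.det_fin_two, h10, h11] at hS

lemma moebius_mul_autFactor {S : Matrix (Fin 2) (Fin 2) ℤ} (hS : 0 < S.det) (z : ℍ) :
    (moebius S z : ℂ) * autFactor S z = (S 0 0 : ℂ) * z + S 0 1 := by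
  rw [coe_moebius S hS]
  exact div_mul_cancel₀ _ (autFactor_ne_zero hS z)

lemma autFactor_mul (S : Matrix (Fin 2) (Fin 2) ℤ) {T : Matrix (Fin 2) (Fin 2) ℤ}
    (hT : 0 < T.det) (z : ℍ) :
    autFactor (S * T) z = autFactor S (moebius T z) * autFactor T z := by
  have h := moebius_mul_autFactor hT z
  simp only [autFactor, Matrix.mul_apply, Fin.sum_univ_two] at h ⊢
  push_cast
  linear_combination (-(S 1 0 : ℂ)) * h

lemma moebius_mul {S T : Matrix (Fin 2) (Fin 2) ℤ} (hS : 0 < S.det) (hT : 0 < T.det) (z : ℍ) :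
    moebius (S * T) z = moebius S (moebius T z) := by
  have hST : 0 < (S * T).det := by rw [Matrix.det_mul]; positivity
  have h1 := moebius_mul_autFactor hST z
  have h2 := moebius_mul_autFactor hS (moebius T z)
  have h3 := moebius_mul_autFactor hT z
  have h4 := autFactor_mul S hT z
  ext
  refine mul_right_cancel₀ (autFactor_ne_zero hST z) ?_
  rw [h1, h4, ← mul_assoc, h2]
  have h5 : autFactor T z = (T 1 0 : ℂ) * z + T 1 1 := rfl
  simp only [Matrix.mul_apply, Fin.sum_univ_two]
  push_cast
  linear_combination (-(S 0 0 : ℂ)) * h3 - (S 0 1 : ℂ) * h5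

lemma moebius_SL (γ : SL(2, ℤ)) (z : ℍ) : moebius (γ : Matrix (Fin 2) (Fin 2) ℤ) z = γ • z := by
  ext
  rw [coe_moebius _ (by simp), UpperHalfPlane.coe_specialLinearGroup_apply]
  simp

lemma mdifferentiable_moebius {S : Matrix (Fin 2) (Fin 2) ℤ} (hS : 0 < S.det) :
    MDifferentiable 𝓘(ℂ) 𝓘(ℂ) (moebius S) := by
  have hd : (0 : ℝ) < (S.map (Int.cast : ℤ → ℝ)).det := by
    have h : (S.map (Int.cast : ℤ → ℝ)).det = (S.det : ℝ) := by simp [Matrix.det_fin_two]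
    rw [h]
    exact_mod_cast hS
  set g := Matrix.GeneralLinearGroup.mkOfDetNeZero (S.map (Int.cast : ℤ → ℝ)) hd.ne' with hg
  have hgd : 0 < g.det.val := hd
  suffices h : moebius S = fun z : ℍ => g • z from h ▸ mdifferentiable_smul hgd
  funext z
  ext
  rw [coe_moebius S hS, coe_smul_of_det_pos hgd]
  simp [num, denom, hg, Matrix.GeneralLinearGroup.mkOfDetNeZero]

lemma mdifferentiable_autFactor (S : Matrix (Fin 2) (Fin 2) ℤ) :
    MDifferentiable 𝓘(ℂ) 𝓘(ℂ) (autFactor S) :=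
  (mdifferentiable_const.mul mdifferentiable_coe).add mdifferentiable_const

lemma exists_smul_mem_reps {n : ℕ} [NeZero n] (A : FixedDetMatrix (Fin 2) ℤ n) :
    ∃ γ : SL(2, ℤ), γ • A ∈ FixedDetMatrices.reps (n : ℤ) := by
  have hn : (n : ℤ) ≠ 0 := by exact_mod_cast NeZero.ne n
  induction A using FixedDetMatrices.induction_on hn with
  | h0 A h1 h2 h3 h4 => exact ⟨1, by rw [one_smul]; exact ⟨h1, h2, h3, h4⟩⟩
  | hS B hB =>
    obtain ⟨γ, hγ⟩ := hB
    exact ⟨γ * ModularGroup.S⁻¹, by rwa [smul_smul, inv_mul_cancel_right]⟩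
  | hT B hB =>
    obtain ⟨γ, hγ⟩ := hB
    exact ⟨γ * ModularGroup.T⁻¹, by rwa [smul_smul, inv_mul_cancel_right]⟩

/-- Upper triangular substitutions preserve the cusp i∞, so expansions of functions attached to a
class are computed on such a representative. -/
lemma exists_upper_triangular {n : ℕ} [NeZero n] (A : FixedDetMatrix (Fin 2) ℤ n) :
    ∃ (γ : SL(2, ℤ)) (a d : ℕ) (b : ℤ), a ≠ 0 ∧ d ≠ 0 ∧ a * d = n ∧
      (γ • A).1 = !![(a : ℤ), b; 0, (d : ℤ)] := by
  obtain ⟨γ, h10, h00, -, -⟩ := exists_smul_mem_reps A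
  have hdet := (γ • A).2
  rw [Matrix.det_fin_two, h10, mul_zero, sub_zero] at hdet
  have hnpos : (0 : ℤ) < n := by exact_mod_cast NeZero.pos n
  have h11 : 0 < (γ • A).1 1 1 := by
    rw [← hdet] at hnpos
    exact pos_of_mul_pos_right hnpos h00.le
  obtain ⟨a, ha⟩ := Int.eq_ofNat_of_zero_le h00.le
  obtain ⟨d, hd⟩ := Int.eq_ofNat_of_zero_le h11.le
  refine ⟨γ, a, d, (γ • A).1 0 1, by omega, by omega, ?_, ?_⟩
  · rw [ha, hd] at hdet
    exact_mod_cast hdet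
  · rw [Matrix.eta_fin_two (γ • A).1, ha, hd, h10]
    rfl

/-! ### Classes of matrices of given determinant -/

/-- Equivalence classes of integer matrices of determinant `n`. -/
abbrev Cls (n : ℕ) : Type :=
  MulAction.orbitRel.Quotient SL(2, ℤ) (FixedDetMatrix (Fin 2) ℤ (n : ℤ))

/-- The class of a matrix. -/
def Cls.mk {n : ℕ} (A : FixedDetMatrix (Fin 2) ℤ (n : ℤ)) : Cls n := Quotient.mk'' A

lemma Cls.mk_eq_mk {n : ℕ} {A B : FixedDetMatrix (Fin 2) ℤ (n : ℤ)} :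
    Cls.mk A = Cls.mk B ↔ ∃ γ : SL(2, ℤ), γ • B = A := by
  rw [Cls.mk, Cls.mk, Quotient.eq'']
  exact MulAction.orbitRel_apply

lemma Cls.mk_out {n : ℕ} (s : Cls n) : Cls.mk s.out = s := Quotient.out_eq' s

instance Cls.instFinite (n : ℕ) [NeZero n] : Finite (Cls n) := by
  refine Finite.of_surjective
    (fun A : FixedDetMatrices.reps (n : ℤ) => Cls.mk A.1) fun s => ?_
  obtain ⟨A, rfl⟩ : ∃ A, Cls.mk A = s := ⟨_, s.mk_out⟩
  obtain ⟨γ, hγ⟩ := exists_smul_mem_reps A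
  exact ⟨⟨_, hγ⟩, Cls.mk_eq_mk.mpr ⟨γ, rfl⟩⟩

instance Cls.instFintype (n : ℕ) [NeZero n] : Fintype (Cls n) := Fintype.ofFinite _

/-- Multiplication by `γ` from the right. -/
def mulRight {n : ℕ} (A : FixedDetMatrix (Fin 2) ℤ (n : ℤ)) (γ : SL(2, ℤ)) :
    FixedDetMatrix (Fin 2) ℤ (n : ℤ) :=
  ⟨A.1 * γ, by rw [Matrix.det_mul, A.2, γ.2, mul_one]⟩

lemma mulRight_mulRight {n : ℕ} (A : FixedDetMatrix (Fin 2) ℤ (n : ℤ)) (γ δ : SL(2, ℤ)) :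
    mulRight (mulRight A γ) δ = mulRight A (γ * δ) :=
  FixedDetMatrices.ext' _ _ (by simp [mulRight, mul_assoc])

lemma mulRight_one {n : ℕ} (A : FixedDetMatrix (Fin 2) ℤ (n : ℤ)) : mulRight A 1 = A :=
  FixedDetMatrices.ext' _ _ (by simp [mulRight])

lemma smul_mulRight {n : ℕ} (A : FixedDetMatrix (Fin 2) ℤ (n : ℤ)) (γ δ : SL(2, ℤ)) :
    δ • mulRight A γ = mulRight (δ • A) γ :=
  FixedDetMatrices.ext' _ _ (by
    rw [FixedDetMatrices.smul_coe]
    simp only [mulRight, FixedDetMatrices.smul_coe, mul_assoc])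

lemma Cls.mk_mulRight_out {n : ℕ} (A : FixedDetMatrix (Fin 2) ℤ (n : ℤ)) (γ : SL(2, ℤ)) :
    Cls.mk (mulRight (Cls.mk A).out γ) = Cls.mk (mulRight A γ) := by
  obtain ⟨δ, hδ⟩ := Cls.mk_eq_mk.mp (Cls.mk A).mk_out
  rw [← hδ, ← smul_mulRight]
  exact Cls.mk_eq_mk.mpr ⟨δ, rfl⟩

/-- The permutation of the classes given by multiplication from the right. -/
def Cls.rightEquiv {n : ℕ} (γ : SL(2, ℤ)) : Cls n ≃ Cls n where
  toFun s := Cls.mk (mulRight s.out γ)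
  invFun s := Cls.mk (mulRight s.out γ⁻¹)
  left_inv s := by
    simp only [Cls.mk_mulRight_out]
    rw [mulRight_mulRight, mul_inv_cancel, mulRight_one, Cls.mk_out]
  right_inv s := by
    simp only [Cls.mk_mulRight_out]
    rw [mulRight_mulRight, inv_mul_cancel, mulRight_one, Cls.mk_out]

/-! ### Norms from level `n` to level one -/

/-- The substitution `F ↦ F ∘ γ`. -/
def pullback (γ : SL(2, ℤ)) : (ℍ → ℂ) →+* (ℍ → ℂ) := RingHom.pi fun z => Pi.evalRingHom _ (γ • z)

@[simp] lemma pullback_apply (γ : SL(2, ℤ)) (F : ℍ → ℂ) (z : ℍ) : pullback γ F z = F (γ • z) := rfl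

lemma coeff_prod_mem_integralRing {h : ℕ} {ι : Type*} (s : Finset ι) (G : ι → Polynomial (ℍ → ℂ))
    (hG : ∀ i ∈ s, ∀ k, (G i).coeff k ∈ integralRing h) (k : ℕ) :
    (∏ i ∈ s, G i).coeff k ∈ integralRing h := by
  have h1 : ∏ i ∈ s, G i ∈ Polynomial.lifts (integralRing h).subtype := by
    refine Subsemiring.prod_mem _ fun i hi => ?_
    rw [Polynomial.lifts_iff_coeff_lifts]
    exact fun k => ⟨⟨_, hG i hi k⟩, rfl⟩
  rw [Polynomial.lifts_iff_coeff_lifts] at h1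
  obtain ⟨x, hx⟩ := h1 k
  rw [← hx]
  exact x.2

/-- A family of polynomials with functions as coefficients, indexed by the integer matrices of
determinant `n`, which depends only on the classes and is permuted by the modular group. -/
structure IsConjFamily {n : ℕ} (G : FixedDetMatrix (Fin 2) ℤ (n : ℤ) → Polynomial (ℍ → ℂ)) :
    Prop where
  smul_eq : ∀ (γ : SL(2, ℤ)) A, G (γ • A) = G A
  map_eq : ∀ (γ : SL(2, ℤ)) A, (G A).map (pullback γ) = G (mulRight A γ)
  mem : ∀ A k, (G A).coeff k ∈ integralRing n

/-- The product of a family of polynomials over the classes of matrices of determinant `n`. -/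
def clsProd {n : ℕ} [NeZero n] (G : FixedDetMatrix (Fin 2) ℤ (n : ℤ) → Polynomial (ℍ → ℂ)) :
    Polynomial (ℍ → ℂ) := ∏ s : Cls n, G s.out

namespace IsConjFamily

variable {n : ℕ} {G : FixedDetMatrix (Fin 2) ℤ (n : ℤ) → Polynomial (ℍ → ℂ)}

lemma out_mk (hG : IsConjFamily G) (A : FixedDetMatrix (Fin 2) ℤ (n : ℤ)) :
    G (Cls.mk A).out = G A := by
  obtain ⟨δ, hδ⟩ := Cls.mk_eq_mk.mp (Cls.mk A).mk_out
  rw [← hδ, hG.smul_eq]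

variable [NeZero n]

/-- Substituting γ turns the factor of a class into that of the class multiplied by γ from the
right, and this merely permutes the factors. -/
lemma map_clsProd (hG : IsConjFamily G) (γ : SL(2, ℤ)) :
    (clsProd G).map (pullback γ) = clsProd G := by
  rw [clsProd, Polynomial.map_prod,
    ← Equiv.prod_comp (Cls.rightEquiv γ) fun s : Cls n => G s.out]
  refine Finset.prod_congr rfl fun s _ => ?_
  rw [hG.map_eq]
  exact (hG.out_mk _).symm

lemma coeff_clsProd_smul (hG : IsConjFamily G) (k : ℕ) (γ : SL(2, ℤ)) (z : ℍ) :
    (clsProd G).coeff k (γ • z) = (clsProd G).coeff k z := by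
  have := congrArg (fun P : Polynomial (ℍ → ℂ) => P.coeff k z) (hG.map_clsProd γ)
  simpa only [Polynomial.coeff_map, pullback_apply] using this

lemma coeff_clsProd_mem (hG : IsConjFamily G) (k : ℕ) : (clsProd G).coeff k ∈ integralRing n :=
  coeff_prod_mem_integralRing _ _ (fun _ _ => hG.mem _) k

lemma isIntegral_coeff (hG : IsConjFamily G) (k : ℕ) {z : ℍ} (hz : IsIntegral ℤ (j z)) :
    IsIntegral ℤ ((clsProd G).coeff k z) :=
  isIntegral_of_mem_integralRing (hG.coeff_clsProd_mem k) (hG.coeff_clsProd_smul k) hz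

end IsConjFamily

lemma isIntegral_of_monic {P : Polynomial ℂ} (hP : P.Monic) (hcoeff : ∀ k, IsIntegral ℤ (P.coeff k))
    {x : ℂ} (hx : P.eval x = 0) : IsIntegral ℤ x := by
  have h1 : P ∈ Polynomial.lifts (algebraMap (𝓞 ℂ) ℂ) := by
    rw [Polynomial.lifts_iff_coeff_lifts]
    exact fun k => exists_coe_eq (hcoeff k)
  obtain ⟨Q, hQ, -, hmon⟩ := Polynomial.lifts_and_natDegree_eq_and_monic h1 hP
  have h2 : IsIntegral (𝓞 ℂ) x := ⟨Q, hmon, by rw [← Polynomial.eval_map, hQ, hx]⟩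
  exact isIntegral_trans _ h2

/-! ### Conjugate systems and integrality of their values -/

/-- A family of functions, indexed by the integer matrices of determinant `n`, which depends only on
the classes and is permuted by the modular group. -/
structure IsConjSystem {n : ℕ} (g : FixedDetMatrix (Fin 2) ℤ (n : ℤ) → ℍ → ℂ) : Prop where
  smul_eq : ∀ (γ : SL(2, ℤ)) A, g (γ • A) = g A
  apply_smul : ∀ (γ : SL(2, ℤ)) A z, g A (γ • z) = g (mulRight A γ) z
  mem : ∀ A, g A ∈ integralRing n

namespace IsConjSystem

variable {n : ℕ} {f g : FixedDetMatrix (Fin 2) ℤ (n : ℤ) → ℍ → ℂ}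

/-- The family of linear polynomials `g + f X`. -/
lemma linear (hg : IsConjSystem g) (hf : IsConjSystem f) :
    IsConjFamily fun A => Polynomial.C (g A) + Polynomial.C (f A) * Polynomial.X where
  smul_eq γ A := by simp only [hg.smul_eq, hf.smul_eq]
  map_eq γ A := by
    have h1 : pullback γ (g A) = g (mulRight A γ) := funext fun z => hg.apply_smul γ A z
    have h2 : pullback γ (f A) = f (mulRight A γ) := funext fun z => hf.apply_smul γ A z
    simp only [Polynomial.map_add, Polynomial.map_mul, Polynomial.map_C, Polynomial.map_X, h1, h2]
  mem A k := by
    rw [Polynomial.coeff_add, Polynomial.coeff_C, Polynomial.coeff_C_mul, Polynomial.coeff_X]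
    refine add_mem ?_ (mul_mem (hf.mem A) ?_)
    · split_ifs
      exacts [hg.mem A, zero_mem _]
    · split_ifs
      exacts [one_mem _, zero_mem _]

lemma neg (hg : IsConjSystem g) : IsConjSystem fun A => -g A where
  smul_eq γ A := by rw [hg.smul_eq]
  apply_smul γ A z := by simp only [Pi.neg_apply, hg.apply_smul]
  mem A := neg_mem (hg.mem A)

lemma const {F : ℍ → ℂ} (hF : F ∈ integralRing n) (hinv : ∀ (γ : SL(2, ℤ)) z, F (γ • z) = F z) :
    IsConjSystem fun _ : FixedDetMatrix (Fin 2) ℤ (n : ℤ) => F where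
  smul_eq _ _ := rfl
  apply_smul γ _ z := hinv γ z
  mem _ := hF

lemma one : IsConjSystem fun _ : FixedDetMatrix (Fin 2) ℤ (n : ℤ) => (1 : ℍ → ℂ) :=
  const (one_mem _) fun _ _ => rfl

lemma sub (hg : IsConjSystem g) (hf : IsConjSystem f) : IsConjSystem fun A => g A - f A where
  smul_eq γ A := by rw [hg.smul_eq, hf.smul_eq]
  apply_smul γ A z := by simp only [Pi.sub_apply, hg.apply_smul, hf.apply_smul]
  mem A := sub_mem (hg.mem A) (hf.mem A)

lemma out_mk (hg : IsConjSystem g) (A : FixedDetMatrix (Fin 2) ℤ (n : ℤ)) :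
    g (Cls.mk A).out = g A := by
  obtain ⟨δ, hδ⟩ := Cls.mk_eq_mk.mp (Cls.mk A).mk_out
  rw [← hδ, hg.smul_eq]

variable [NeZero n]

lemma prod_smul (hg : IsConjSystem g) (γ : SL(2, ℤ)) (z : ℍ) :
    (∏ s : Cls n, g s.out) (γ • z) = (∏ s : Cls n, g s.out) z := by
  rw [Finset.prod_apply, Finset.prod_apply,
    ← Equiv.prod_comp (Cls.rightEquiv γ) fun s : Cls n => g s.out z]
  refine Finset.prod_congr rfl fun s _ => ?_
  rw [hg.apply_smul]
  exact congrFun (hg.out_mk _).symm z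

/-- The values of a conjugate system are integral where `j` is. -/
theorem isIntegral (hg : IsConjSystem g) (A : FixedDetMatrix (Fin 2) ℤ (n : ℤ)) {z : ℍ}
    (hz : IsIntegral ℤ (j z)) : IsIntegral ℤ (g A z) := by
  -- With constant terms −g and slope 1 the class product is ∏(X − g_S); evaluated at z it is monic
  -- with integral coefficients and has g_A(z) as a root.
  have hG := hg.neg.linear one
  set P := (clsProd fun A => Polynomial.C (-g A) + Polynomial.C (1 : ℍ → ℂ) * Polynomial.X).map
    (Pi.evalRingHom (fun _ : ℍ => ℂ) z) with hP
  have hP' : P = ∏ s : Cls n, (Polynomial.X - Polynomial.C (g s.out z)) := by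
    rw [hP, clsProd, Polynomial.map_prod]
    refine Finset.prod_congr rfl fun s _ => ?_
    rw [Polynomial.map_add, Polynomial.map_mul, Polynomial.map_C, Polynomial.map_C, Polynomial.map_X,
      Pi.evalRingHom_apply, Pi.evalRingHom_apply, Pi.neg_apply, Pi.one_apply, map_neg, map_one]
    ring
  refine isIntegral_of_monic (P := P) ?_ (fun k => ?_) ?_
  · rw [hP']
    exact Polynomial.monic_prod_of_monic _ _ fun s _ => Polynomial.monic_X_sub_C _
  · rw [hP, Polynomial.coeff_map]
    exact hG.isIntegral_coeff k hz
  · rw [hP', Polynomial.eval_prod]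
    refine Finset.prod_eq_zero (Finset.mem_univ (Cls.mk A)) ?_
    rw [hg.out_mk]
    simp

end IsConjSystem

/-! ### Expansions after an upper triangular substitution -/

lemma exists_unit_coe_eq {x : ℂ} {k : ℕ} (hk : k ≠ 0) (hx : x ^ k = 1) :
    ∃ u : (𝓞 ℂ)ˣ, ((u : 𝓞 ℂ) : ℂ) = x := by
  have hint : IsIntegral ℤ x := IsIntegral.of_pow (Nat.pos_of_ne_zero hk) (hx ▸ isIntegral_one)
  obtain ⟨y, hy⟩ := exists_coe_eq hint
  have hyk : y ^ k = 1 := NumberField.RingOfIntegers.ext (by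
    have : ((y ^ k : 𝓞 ℂ) : ℂ) = (y : ℂ) ^ k := map_pow (algebraMap (𝓞 ℂ) ℂ) y k
    rw [this, hy, hx]
    exact (map_one (algebraMap (𝓞 ℂ) ℂ)).symm)
  exact ⟨Units.ofPowEqOne y k hyk hk, hy⟩

section UpperTriangular

variable {a d : ℕ} {b : ℤ}

lemma det_upper (a d : ℕ) (b : ℤ) : (!![(a : ℤ), b; 0, (d : ℤ)]).det = ((a * d : ℕ) : ℤ) := by
  simp [Matrix.det_fin_two]

lemma coe_moebius_upper (ha : a ≠ 0) (hd : d ≠ 0) (z : ℍ) :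
    (moebius !![(a : ℤ), b; 0, (d : ℤ)] z : ℂ) = ((a : ℂ) * z + b) / d := by
  rw [coe_moebius _ (by rw [det_upper]; positivity)]
  simp

lemma tendsto_moebius_upper (ha : a ≠ 0) (hd : d ≠ 0) :
    Tendsto (moebius !![(a : ℤ), b; 0, (d : ℤ)]) atImInfty atImInfty := by
  have him : ∀ z : ℍ, (moebius !![(a : ℤ), b; 0, (d : ℤ)] z).im = (a / d : ℝ) * z.im := by
    intro z
    rw [← coe_im, coe_moebius_upper ha hd]
    have : ((a : ℂ) * z + b) / d = ((a / d : ℝ) : ℂ) * z + ((b / d : ℝ) : ℂ) := by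
      push_cast
      ring
    rw [this, Complex.add_im, Complex.im_ofReal_mul, Complex.ofReal_im, add_zero, coe_im]
  rw [atImInfty, tendsto_comap_iff]
  have h1 : Tendsto (fun z : ℍ => (a / d : ℝ) * z.im) (comap UpperHalfPlane.im atTop) atTop :=
    tendsto_comap.const_mul_atTop (by positivity)
  exact h1.congr fun z => (him z).symm

/-- Since ad = n, the substitution (aω + b)/d sends q to e^{2πib/d} q^{a/d} = ζ (q^{1/n})^{a²}. As ζ
is a root of unity, leading coefficients change only by units. -/
lemma Expands.comp_upper {n : ℕ} (ha : a ≠ 0) (hd : d ≠ 0) (hn : a * d = n) {f : ℍ → ℂ} {N : ℤ}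
    {c : PowerSeries (𝓞 ℂ)} (hf : Expands 1 f N c) :
    ∃ (ζ : (𝓞 ℂ)ˣ) (c' : PowerSeries (𝓞 ℂ)),
      Expands n (f ∘ moebius !![(a : ℤ), b; 0, (d : ℤ)]) ((a ^ 2 : ℕ) * N) c' ∧
      PowerSeries.constantCoeff c' = ζ * PowerSeries.constantCoeff c := by
  have ha' : (a : ℂ) ≠ 0 := by exact_mod_cast ha
  have hd' : (d : ℂ) ≠ 0 := by exact_mod_cast hd
  obtain ⟨ζ, hζ⟩ := exists_unit_coe_eq (x := Complex.exp (2 * Real.pi * Complex.I * b / d)) hd (by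
    rw [← Complex.exp_nat_mul, mul_div_cancel₀ _ hd', mul_comm]
    exact Complex.exp_int_mul_two_pi_mul_I b)
  refine ⟨ζ ^ (-N), _, hf.comp (pow_ne_zero 2 ha) (tendsto_moebius_upper ha hd) ζ fun z => ?_, ?_⟩
  swap
  · rw [map_mul, PowerSeries.constantCoeff_expand, PowerSeries.constantCoeff_C,
      ← PowerSeries.coeff_zero_eq_constantCoeff_apply, PowerSeries.coeff_rescale]
    simp
  rw [hζ, Function.Periodic.qParam, Function.Periodic.qParam, ← Complex.exp_nat_mul,
    ← Complex.exp_add, coe_moebius_upper ha hd, ← hn]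
  congr 1
  push_cast
  field_simp
  ring

end UpperTriangular

/-! ### Integrality of `j` at fixed points of integer matrices -/

lemma isConjSystem_j_comp (n : ℕ) [NeZero n] :
    IsConjSystem fun A : FixedDetMatrix (Fin 2) ℤ (n : ℤ) => j ∘ moebius A.1 := by
  have hn : (0 : ℤ) < n := by exact_mod_cast NeZero.pos n
  have hsmul : ∀ (γ : SL(2, ℤ)) (A : FixedDetMatrix (Fin 2) ℤ (n : ℤ)),
      j ∘ moebius (γ • A).1 = j ∘ moebius A.1 := fun γ A => by
    funext z
    rw [Function.comp_apply, Function.comp_apply, FixedDetMatrices.smul_coe,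
      moebius_mul (by simp) (by rw [A.2]; exact hn), moebius_SL, j_smul]
  refine ⟨hsmul, fun γ A z => ?_, fun A => ⟨mdifferentiable_j.comp
    (mdifferentiable_moebius (by rw [A.2]; exact hn)), ?_⟩⟩
  · rw [Function.comp_apply, Function.comp_apply, mulRight,
      moebius_mul (by rw [A.2]; exact hn) (by simp), moebius_SL]
  · obtain ⟨γ, a, d, b, ha, hd, had, hA⟩ := exists_upper_triangular A
    obtain ⟨c, hc, -⟩ := exists_expands_j
    obtain ⟨ζ, c', hc', -⟩ := hc.comp_upper (b := b) ha hd had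
    rw [← hsmul γ A, hA]
    exact ⟨_, _, hc'⟩

lemma j_mem_integralRing (n : ℕ) [NeZero n] : j ∈ integralRing n := by
  obtain ⟨c, hc, -⟩ := exists_expands_j
  obtain ⟨d, hd, -⟩ := hc.ramify n
  exact ⟨mdifferentiable_j, _, _, hd⟩

/-- If `z` is a fixed point of an integer matrix whose determinant is not a square, then `j(z)` is an
algebraic integer. -/
theorem isIntegral_j {n : ℕ} [NeZero n] (hn : ¬ IsSquare n) (A : FixedDetMatrix (Fin 2) ℤ (n : ℤ))
    {z : ℍ} (hz : moebius A.1 z = z) : IsIntegral ℤ (j z) := by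
  have hsys : IsConjSystem fun A : FixedDetMatrix (Fin 2) ℤ (n : ℤ) => j - j ∘ moebius A.1 :=
    (IsConjSystem.const (j_mem_integralRing n) j_smul).sub (isConjSystem_j_comp n)
  have hexp : ∀ A : FixedDetMatrix (Fin 2) ℤ (n : ℤ), ∃ (N : ℕ) (c : PowerSeries (𝓞 ℂ)),
      Expands n (j - j ∘ moebius A.1) N c ∧ IsUnit (PowerSeries.constantCoeff c) := by
    intro A
    obtain ⟨γ, a, d, b, ha, hd, had, hA⟩ := exists_upper_triangular A
    obtain ⟨c, hc, hc0⟩ := exists_expands_j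
    obtain ⟨ζ, c₁, hc₁, hc₁0⟩ := hc.comp_upper (b := b) ha hd had
    obtain ⟨c₂, hc₂, hc₂0⟩ := hc.ramify n
    rw [hc0] at hc₂0
    rw [hc0, mul_one] at hc₁0
    rw [mul_one] at hc₁ hc₂
    -- In q^{1/n} the pole orders of `j` and `j ∘ S` are n and a². As n is not a square they differ,
    -- so the leading terms cannot cancel and the difference has a unit as leading coefficient.
    have hne : a ^ 2 ≠ n := fun h => hn ⟨a, by rw [← h, sq]⟩
    have hfun : j - j ∘ moebius A.1 = j - j ∘ moebius !![(a : ℤ), b; 0, (d : ℤ)] := by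
      rw [← hA]
      exact (hsys.smul_eq γ A).symm
    rw [hfun]
    rcases lt_or_gt_of_ne hne with hlt | hgt
    · have h1 := hc₁.shift (n - a ^ 2)
      rw [← Nat.cast_add, Nat.add_sub_cancel' hlt.le] at h1
      refine ⟨n, _, hc₂.sub h1, ?_⟩
      have : n - a ^ 2 ≠ 0 := by omega
      simp [hc₂0, this]
    · have h1 := hc₂.shift (a ^ 2 - n)
      rw [← Nat.cast_add, Nat.add_sub_cancel' hgt.le] at h1
      refine ⟨a ^ 2, _, h1.sub hc₁, ?_⟩
      have : a ^ 2 - n ≠ 0 := by omega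
      simp [hc₁0, this]
  choose N c hc hcu using fun s : Cls n => hexp s.out
  have hprod := Expands.prod Finset.univ fun s _ => hc s
  rw [← Nat.cast_sum] at hprod
  obtain ⟨Q, hQ, hdeg, hlead⟩ := hprod.exists_polynomial
    (show MDifferentiable 𝓘(ℂ) 𝓘(ℂ) _ from
      (Subring.prod_mem (integralRing n) fun s _ => hsys.mem _).1)
    hsys.prod_smul
  have hu : IsUnit (PowerSeries.constantCoeff (∏ s : Cls n, c s)) := by
    rw [map_prod]
    exact IsUnit.prod_univ_iff.mpr hcu
  obtain ⟨m, hm, hQm⟩ := hlead hu.ne_zero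
  have hQdeg : Q.natDegree ≤ m := by
    rw [← hm] at hdeg
    exact Nat.le_of_mul_le_mul_left hdeg (NeZero.pos n)
  obtain ⟨u, hu⟩ := hu
  -- The factor belonging to the class of A vanishes because A fixes z.
  have hroot : Polynomial.aeval (j z) Q = 0 := by
    rw [← hQ z, Finset.prod_apply]
    refine Finset.prod_eq_zero (Finset.mem_univ (Cls.mk A)) ?_
    have h0 := congrFun (hsys.out_mk A) z
    refine h0.trans ?_
    rw [Pi.sub_apply, Function.comp_apply, hz, sub_self]
  have hint : IsIntegral (𝓞 ℂ) (j z) := by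
    refine ⟨Polynomial.C ((u⁻¹ : (𝓞 ℂ)ˣ) : 𝓞 ℂ) * Q, ?_, ?_⟩
    · refine Polynomial.monic_of_natDegree_le_of_coeff_eq_one m
        ((Polynomial.natDegree_C_mul_le _ _).trans hQdeg) ?_
      rw [Polynomial.coeff_C_mul, hQm, ← hu, Units.inv_mul]
    · rw [← Polynomial.aeval_def, map_mul, hroot, mul_zero]
  exact isIntegral_trans _ hint

/-! ### The functions `φ_S` -/

lemma phi_eq {S : Matrix (Fin 2) (Fin 2) ℤ} (hS : 0 < S.det) (z : ℍ) :
    phi S z = (S.det : ℂ) ^ 12 * ModularForm.discriminant (moebius S z) /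
      (autFactor S z ^ 12 * ModularForm.discriminant z) := by
  have hpi : (2 * Real.pi : ℂ) ≠ 0 := by
    simp [Real.pi_ne_zero]
  have h1 : deltaHom ((S 0 0 : ℂ) * z + S 0 1) ((S 1 0 : ℂ) * z + S 1 1) =
      (2 * Real.pi : ℂ) ^ 12 * ModularForm.discriminant (moebius S z) / autFactor S z ^ 12 := by
    rw [deltaHom, ← coe_moebius S hS]
    rfl
  have h2 : deltaHom z 1 = (2 * Real.pi : ℂ) ^ 12 * ModularForm.discriminant z := by
    rw [deltaHom, div_one, one_pow, div_one]
    rfl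
  rw [phi, h1, h2]
  have := ModularForm.discriminant_ne_zero z
  have := autFactor_ne_zero hS z
  field_simp

lemma phi_ne_zero {S : Matrix (Fin 2) (Fin 2) ℤ} (hS : 0 < S.det) (z : ℍ) : phi S z ≠ 0 := by
  rw [phi_eq hS]
  have h1 := ModularForm.discriminant_ne_zero z
  have h2 := ModularForm.discriminant_ne_zero (moebius S z)
  have h3 := autFactor_ne_zero hS z
  have h4 : (S.det : ℂ) ≠ 0 := by exact_mod_cast hS.ne'
  exact div_ne_zero (mul_ne_zero (pow_ne_zero _ h4) h2) (mul_ne_zero (pow_ne_zero _ h3) h1)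

/-- The determinant is multiplicative, the automorphy factor is a cocycle, and the intermediate
discriminant cancels. Through this rule factorizations of matrices become factorizations of values
of φ. -/
lemma phi_mul {S T : Matrix (Fin 2) (Fin 2) ℤ} (hS : 0 < S.det) (hT : 0 < T.det) (z : ℍ) :
    phi (S * T) z = phi S (moebius T z) * phi T z := by
  have hST : 0 < (S * T).det := by rw [Matrix.det_mul]; positivity
  rw [phi_eq hS, phi_eq hT, phi_eq hST, moebius_mul hS hT, autFactor_mul S hT, Matrix.det_mul]
  have h1 := ModularForm.discriminant_ne_zero z
  have h2 := ModularForm.discriminant_ne_zero (moebius T z)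
  have h3 := autFactor_ne_zero hT z
  have h4 := autFactor_ne_zero hS (moebius T z)
  rw [Int.cast_mul, mul_pow, mul_pow, div_mul_div_comm, div_eq_div_iff (by simp [h1, h3, h4])
    (by simp [h1, h2, h3, h4])]
  ring

lemma phi_SL (γ : SL(2, ℤ)) (z : ℍ) : phi (γ : Matrix (Fin 2) (Fin 2) ℤ) z = 1 := by
  rw [phi_eq (by simp), moebius_SL, discriminant_smul]
  have h1 := ModularForm.discriminant_ne_zero z
  have h3 : autFactor (γ : Matrix (Fin 2) (Fin 2) ℤ) z ≠ 0 := autFactor_ne_zero (by simp) z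
  have h4 : (γ 1 0 : ℂ) * z + γ 1 1 = autFactor (γ : Matrix (Fin 2) (Fin 2) ℤ) z := rfl
  rw [h4]
  simp [h1, h3]

/-- The quotient `Δ(S(ω))/Δ(ω)` for an upper triangular matrix `S`. -/
lemma exists_expands_discriminant_quotient {n : ℕ} [NeZero n] {a d : ℕ} {b : ℤ} (ha : a ≠ 0)
    (hd : d ≠ 0) (hn : a * d = n) : ∃ (N : ℤ) (c : PowerSeries (𝓞 ℂ)),
      Expands n (fun z => ModularForm.discriminant (moebius !![(a : ℤ), b; 0, (d : ℤ)] z) /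
        ModularForm.discriminant z) N c ∧ IsUnit (PowerSeries.constantCoeff c) := by
  obtain ⟨c, hc, hc0⟩ := exists_expands_discriminant
  obtain ⟨ζ, c₁, hc₁, hc₁0⟩ := hc.comp_upper (b := b) ha hd hn
  obtain ⟨c₂, hc₂, hc₂0⟩ := hc.ramify n
  obtain ⟨u, hu⟩ : IsUnit c₂ := PowerSeries.isUnit_iff_constantCoeff.mpr (by simp [hc₂0, hc0])
  have hcd : c₂ * (u⁻¹ : (PowerSeries (𝓞 ℂ))ˣ) = 1 := by rw [← hu]; simp
  refine ⟨_, _, hc₁.mul (hc₂.inv hcd), ?_⟩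
  rw [map_mul, hc₁0, hc0, mul_one]
  exact ζ.isUnit.mul (PowerSeries.isUnit_iff_constantCoeff.mp (u⁻¹).isUnit)

/-- The automorphy factor is d, so only (ad)¹²/d¹² = a¹² is left in front of the discriminant
quotient. That quotient has a unit as leading coefficient, so a¹² is all that can meet p at the
cusp. -/
lemma phi_upper {a d : ℕ} {b : ℤ} (ha : a ≠ 0) (hd : d ≠ 0) (z : ℍ) :
    phi !![(a : ℤ), b; 0, (d : ℤ)] z =
    (a : ℂ) ^ 12 * (ModularForm.discriminant (moebius !![(a : ℤ), b; 0, (d : ℤ)] z) /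
      ModularForm.discriminant z) := by
  have hd' : (d : ℂ) ≠ 0 := by exact_mod_cast hd
  rw [phi_eq (by rw [det_upper]; positivity), det_upper]
  have h : autFactor !![(a : ℤ), b; 0, (d : ℤ)] z = d := by simp [autFactor]
  rw [h]
  have := ModularForm.discriminant_ne_zero z
  push_cast
  field_simp

lemma mdifferentiable_phi {S : Matrix (Fin 2) (Fin 2) ℤ} (hS : 0 < S.det) :
    MDifferentiable 𝓘(ℂ) 𝓘(ℂ) (phi S) := by
  rw [show phi S = _ from funext fun z => phi_eq hS z]
  refine MDifferentiable.div (mdifferentiable_const.mul (mdifferentiable_discriminant.comp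
    (mdifferentiable_moebius hS))) (((mdifferentiable_autFactor S).pow 12).mul
    mdifferentiable_discriminant) fun z => ?_
  exact mul_ne_zero (pow_ne_zero _ (autFactor_ne_zero hS z)) (ModularForm.discriminant_ne_zero z)

lemma isConjSystem_phi (n : ℕ) [NeZero n] :
    IsConjSystem fun A : FixedDetMatrix (Fin 2) ℤ (n : ℤ) => phi A.1 := by
  have hn : (0 : ℤ) < n := by exact_mod_cast NeZero.pos n
  have hsmul : ∀ (γ : SL(2, ℤ)) (A : FixedDetMatrix (Fin 2) ℤ (n : ℤ)),
      phi (γ • A).1 = phi A.1 := fun γ A => by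
    funext z
    rw [FixedDetMatrices.smul_coe, phi_mul (by simp) (by rw [A.2]; exact hn), phi_SL, one_mul]
  refine ⟨hsmul, fun γ A z => ?_, fun A => ⟨mdifferentiable_phi (by rw [A.2]; exact hn), ?_⟩⟩
  · rw [mulRight, phi_mul (by rw [A.2]; exact hn) (by simp), phi_SL, mul_one, moebius_SL]
  · obtain ⟨γ, a, d, b, ha, hd, had, hA⟩ := exists_upper_triangular A
    obtain ⟨N, c, hc, -⟩ := exists_expands_discriminant_quotient (b := b) ha hd had
    have h := (Expands.const n ((a : 𝓞 ℂ) ^ 12)).mul hc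
    refine ⟨0 + N, PowerSeries.C ((a : 𝓞 ℂ) ^ 12) * c, ?_⟩
    rw [← hsmul γ A, hA, show phi _ = _ from funext fun z => phi_upper (b := b) ha hd z]
    convert h using 1
    funext z
    simp [NumberField.RingOfIntegers.coe_eq_algebraMap]

/-! ### Values at fixed points -/

/-- Fixed points of integer matrices whose determinant is positive and not a square. -/
def IsFixedPoint (z : ℍ) : Prop :=
  ∃ (n : ℕ) (A : Matrix (Fin 2) (Fin 2) ℤ), ¬ IsSquare n ∧ A.det = n ∧ moebius A z = z

lemma IsFixedPoint.isIntegral_j {z : ℍ} (hz : IsFixedPoint z) : IsIntegral ℤ (j z) := by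
  obtain ⟨n, A, hn, hA, hfix⟩ := hz
  have : NeZero n := ⟨fun h => hn (h ▸ IsSquare.zero)⟩
  exact CM.isIntegral_j hn ⟨A, hA⟩ hfix

lemma det_smul_one (n : ℤ) : (n • (1 : Matrix (Fin 2) (Fin 2) ℤ)).det = n ^ 2 := by
  rw [Matrix.det_smul, Matrix.det_one, Fintype.card_fin, mul_one]

lemma moebius_smul_one {n : ℕ} (hn : 0 < n) (z : ℍ) :
    moebius ((n : ℤ) • (1 : Matrix (Fin 2) (Fin 2) ℤ)) z = z := by
  have hn' : (n : ℂ) ≠ 0 := by exact_mod_cast hn.ne'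
  ext
  rw [coe_moebius _ (by rw [det_smul_one]; positivity)]
  simp [hn']

lemma phi_smul_one {n : ℕ} (hn : 0 < n) (z : ℍ) :
    phi ((n : ℤ) • (1 : Matrix (Fin 2) (Fin 2) ℤ)) z = (n : ℂ) ^ 12 := by
  have hn' : (n : ℂ) ≠ 0 := by exact_mod_cast hn.ne'
  rw [phi_eq (by rw [det_smul_one]; positivity), moebius_smul_one hn]
  have h1 : autFactor ((n : ℤ) • (1 : Matrix (Fin 2) (Fin 2) ℤ)) z = n := by simp [autFactor]
  have h2 := ModularForm.discriminant_ne_zero z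
  rw [h1, det_smul_one]
  push_cast
  field_simp

lemma det_adjugate_two (S : Matrix (Fin 2) (Fin 2) ℤ) : S.adjugate.det = S.det := by
  rw [Matrix.det_adjugate]
  simp

/-- The point S z is fixed by S A adj(S), whose determinant n s² is a square only if n is. -/
lemma IsFixedPoint.moebius {z : ℍ} (hz : IsFixedPoint z) {S : Matrix (Fin 2) (Fin 2) ℤ} {s : ℕ}
    (hs : 0 < s) (hS : S.det = s) : IsFixedPoint (moebius S z) := by
  obtain ⟨n, A, hn, hA, hfix⟩ := hz
  have hn0 : 0 < n := Nat.pos_of_ne_zero fun h => hn (h ▸ IsSquare.zero)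
  have hSd : 0 < S.det := by rw [hS]; exact_mod_cast hs
  have hS'd : 0 < S.adjugate.det := by rwa [det_adjugate_two]
  have hAd : 0 < A.det := by rw [hA]; exact_mod_cast hn0
  have hSA : 0 < (S * A).det := by rw [Matrix.det_mul]; positivity
  refine ⟨n * s ^ 2, S * A * S.adjugate, ?_, ?_, ?_⟩
  · rintro ⟨m, hm⟩
    have hsm : s ∣ m := by
      rw [← Nat.pow_dvd_pow_iff two_ne_zero]
      exact ⟨n, by rw [sq m, ← hm, mul_comm]⟩
    obtain ⟨k, rfl⟩ := hsm
    refine hn ⟨k, ?_⟩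
    have h2 : 0 < s ^ 2 := by positivity
    refine Nat.eq_of_mul_eq_mul_right h2 ?_
    rw [hm]
    ring
  · rw [Matrix.det_mul, Matrix.det_mul, det_adjugate_two, hS, hA]
    push_cast
    ring
  · rw [moebius_mul hSA hS'd, ← moebius_mul hS'd hSd, Matrix.adjugate_mul, hS, moebius_smul_one hs,
      moebius_mul hSd hAd, hfix]

lemma IsFixedPoint.isIntegral_phi {z : ℍ} (hz : IsFixedPoint z) {S : Matrix (Fin 2) (Fin 2) ℤ}
    {n : ℕ} (hn : 0 < n) (hS : S.det = n) : IsIntegral ℤ (phi S z) := by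
  have : NeZero n := ⟨hn.ne'⟩
  exact (isConjSystem_phi n).isIntegral ⟨S, hS⟩ hz.isIntegral_j

/-- At a fixed point `φ_S` is an algebraic integer that divides a power of the determinant. -/
lemma IsFixedPoint.exists_phi {z : ℍ} (hz : IsFixedPoint z) {S : Matrix (Fin 2) (Fin 2) ℤ}
    {n : ℕ} (hn : 0 < n) (hS : S.det = n) :
    ∃ x y : 𝓞 ℂ, (x : ℂ) = phi S z ∧ x * y = (n : 𝓞 ℂ) ^ 12 := by
  obtain ⟨x, hx⟩ := exists_coe_eq (hz.isIntegral_phi hn hS)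
  -- The cofactor is φ_{adj S} at S z: since adj(S) S = n·1, the cocycle rule makes the product n¹².
  obtain ⟨y, hy⟩ := exists_coe_eq
    ((hz.moebius hn hS).isIntegral_phi hn ((det_adjugate_two S).trans hS))
  have hSd : 0 < S.det := by rw [hS]; exact_mod_cast hn
  refine ⟨x, y, hx, NumberField.RingOfIntegers.ext ?_⟩
  have h1 : ((x * y : 𝓞 ℂ) : ℂ) = (x : ℂ) * y := map_mul (algebraMap (𝓞 ℂ) ℂ) x y
  have h2 : (((n : 𝓞 ℂ) ^ 12 : 𝓞 ℂ) : ℂ) = (n : ℂ) ^ 12 := by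
    simp [NumberField.RingOfIntegers.coe_eq_algebraMap]
  rw [h1, h2, hx, hy, mul_comm, ← phi_mul (by rwa [det_adjugate_two]) hSd, Matrix.adjugate_mul, hS,
    phi_smul_one hn]

/-! ### Matrices of prime determinant -/

/-- The matrix `diag(n, 1)`. -/
def diagMat (n : ℕ) : FixedDetMatrix (Fin 2) ℤ (n : ℤ) := ⟨!![(n : ℤ), 0; 0, 1], by simp⟩

lemma upper_eq_T_zpow_mul (n : ℕ) (b : ℤ) : !![(n : ℤ), b; 0, (1 : ℕ)] =
    ((ModularGroup.T ^ b : SL(2, ℤ)) : Matrix (Fin 2) (Fin 2) ℤ) * (diagMat n).1 := by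
  rw [ModularGroup.coe_T_zpow, diagMat]
  ext i k
  fin_cases i <;> fin_cases k <;> simp [Matrix.mul_apply]

/-- Conjugation by the inversion S turns diag(n, 1) into diag(1, n); the translation then supplies
b. -/
lemma upper_eq_S_mul (n : ℕ) (b : ℤ) : !![((1 : ℕ) : ℤ), b; 0, (n : ℤ)] =
    (ModularGroup.S : Matrix (Fin 2) (Fin 2) ℤ) * (diagMat n).1 *
      ((ModularGroup.S⁻¹ * ModularGroup.T ^ b : SL(2, ℤ)) : Matrix (Fin 2) (Fin 2) ℤ) := by
  rw [Matrix.SpecialLinearGroup.coe_mul, ModularGroup.coe_T_zpow, diagMat,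
    Matrix.SpecialLinearGroup.coe_inv, ModularGroup.S]
  ext i k
  fin_cases i <;> fin_cases k <;> simp [Matrix.mul_apply, Matrix.adjugate_fin_two]

lemma upper_cases {p : ℕ} (hp : p.Prime) {a d : ℕ} (h : a * d = p) :
    (a = 1 ∧ d = p) ∨ (a = p ∧ d = 1) := by
  rcases (Nat.dvd_prime hp).mp (Dvd.intro d h) with rfl | rfl
  · exact .inl ⟨rfl, by simpa using h⟩
  · refine .inr ⟨rfl, ?_⟩
    exact Nat.eq_of_mul_eq_mul_left hp.pos (h.trans (mul_one a).symm)

/-- The matrices of prime determinant form one double coset. -/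
lemma exists_eq_mul_diagMat_mul {p : ℕ} (hp : p.Prime) (A : FixedDetMatrix (Fin 2) ℤ (p : ℤ)) :
    ∃ M N : SL(2, ℤ), A.1 = (N : Matrix (Fin 2) (Fin 2) ℤ) * (diagMat p).1 * M := by
  have : NeZero p := ⟨hp.ne_zero⟩
  obtain ⟨γ, a, d, b, ha, hd, had, hA⟩ := exists_upper_triangular A
  have h1 : A.1 = ((γ⁻¹ : SL(2, ℤ)) : Matrix (Fin 2) (Fin 2) ℤ) * (γ • A).1 := by
    rw [← FixedDetMatrices.smul_coe, inv_smul_smul]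
  rcases upper_cases hp had with ⟨rfl, rfl⟩ | ⟨rfl, rfl⟩
  · refine ⟨ModularGroup.S⁻¹ * ModularGroup.T ^ b, γ⁻¹ * ModularGroup.S, ?_⟩
    rw [h1, hA, upper_eq_S_mul, Matrix.SpecialLinearGroup.coe_mul γ⁻¹]
    simp only [mul_assoc]
  · refine ⟨1, γ⁻¹ * ModularGroup.T ^ b, ?_⟩
    rw [h1, hA, upper_eq_T_zpow_mul, Matrix.SpecialLinearGroup.coe_mul γ⁻¹]
    simp only [mul_assoc, Matrix.SpecialLinearGroup.coe_one, mul_one]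

/-- Because there is a single double coset, every matrix of determinant p indexes some conjugate of
f_P. -/
lemma exists_mul_eq_mul {p : ℕ} (hp : p.Prime) {P : Matrix (Fin 2) (Fin 2) ℤ} (hP : P.det = p)
    (A : FixedDetMatrix (Fin 2) ℤ (p : ℤ)) : ∃ M N : SL(2, ℤ),
      P * (M : Matrix (Fin 2) (Fin 2) ℤ) = (N : Matrix (Fin 2) (Fin 2) ℤ) * A.1 := by
  obtain ⟨M₁, N₁, h₁⟩ := exists_eq_mul_diagMat_mul hp ⟨P, hP⟩
  obtain ⟨M₂, N₂, h₂⟩ := exists_eq_mul_diagMat_mul hp A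
  refine ⟨M₁⁻¹ * M₂, N₁ * N₂⁻¹, ?_⟩
  have e1 : (M₁ : Matrix (Fin 2) (Fin 2) ℤ) * ((M₁⁻¹ : SL(2, ℤ)) : Matrix (Fin 2) (Fin 2) ℤ) = 1 := by
    rw [← Matrix.SpecialLinearGroup.coe_mul]; simp
  have e2 : ((N₂⁻¹ : SL(2, ℤ)) : Matrix (Fin 2) (Fin 2) ℤ) * (N₂ : Matrix (Fin 2) (Fin 2) ℤ) = 1 := by
    rw [← Matrix.SpecialLinearGroup.coe_mul]; simp
  simp only at h₁
  rw [h₁, h₂, Matrix.SpecialLinearGroup.coe_mul, Matrix.SpecialLinearGroup.coe_mul]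
  calc _ = (N₁ : Matrix (Fin 2) (Fin 2) ℤ) * (diagMat p).1 *
        (M₁ * ((M₁⁻¹ : SL(2, ℤ)) : Matrix (Fin 2) (Fin 2) ℤ)) * M₂ := by simp only [mul_assoc]
    _ = (N₁ : Matrix (Fin 2) (Fin 2) ℤ) * (((N₂⁻¹ : SL(2, ℤ)) : Matrix (Fin 2) (Fin 2) ℤ) * N₂) *
        (diagMat p).1 * M₂ := by rw [e1, e2, mul_one, mul_one]
    _ = _ := by simp only [mul_assoc]

/-- The part of `φ_{diag(p, 1)}` that is prime to `p` has an integral expansion. -/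
lemma exists_expands_phi_diagMat_div {p : ℕ} [NeZero p] : ∃ (N : ℤ) (c : PowerSeries (𝓞 ℂ)),
    Expands p (fun z => phi (diagMat p).1 z / (p : ℂ) ^ 12) N c ∧
      IsUnit (PowerSeries.constantCoeff c) := by
  obtain ⟨N, c, hc, hc0⟩ := exists_expands_discriminant_quotient (b := 0) (NeZero.ne p)
    one_ne_zero (mul_one p)
  refine ⟨N, c, ?_, hc0⟩
  have hp' : (p : ℂ) ≠ 0 := by exact_mod_cast NeZero.ne p
  convert hc using 1
  funext z
  have h := phi_upper (b := 0) (NeZero.ne p) one_ne_zero z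
  rw [show (diagMat p).1 = !![(p : ℤ), 0; 0, ((1 : ℕ) : ℤ)] by simp [diagMat], h,
    mul_div_cancel_left₀ _ (pow_ne_zero 12 hp')]

/-- The product of the functions `φ_S` over all classes of matrices of determinant `p` is `p¹²` up to
a unit. -/
theorem exists_prod_phi {p : ℕ} (hp : p.Prime) [NeZero p] :
    ∃ u : (𝓞 ℂ)ˣ, ∀ z, ∏ s : Cls p, phi s.out.1 z = (p : ℂ) ^ 12 * ((u : 𝓞 ℂ) : ℂ) := by
  classical
  have hp0 : (0 : ℤ) < p := by exact_mod_cast hp.pos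
  have hp' : (p : ℂ) ≠ 0 := by exact_mod_cast hp.ne_zero
  set s₀ : Cls p := Cls.mk (diagMat p) with hs₀
  have hphi := isConjSystem_phi p
  -- Representatives with a = 1 already have a unit as leading coefficient of φ; those with a = p
  -- all lie in the class of diag(p, 1), where p¹² is divided out. The normalized product has
  -- neither zeros nor poles on ℍ and a unit as leading coefficient, hence is a constant unit.
  have hexp : ∀ s : Cls p, ∃ (N : ℤ) (c : PowerSeries (𝓞 ℂ)),
      Expands p (fun z => phi s.out.1 z / (if s = s₀ then (p : ℂ) ^ 12 else 1)) N c ∧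
        IsUnit (PowerSeries.constantCoeff c) := by
    intro s
    by_cases hs : s = s₀
    · obtain ⟨N, c, hc⟩ := exists_expands_phi_diagMat_div (p := p)
      refine ⟨N, c, ?_⟩
      have h1 : phi s₀.out.1 = phi (diagMat p).1 := hphi.out_mk (diagMat p)
      simp only [hs, if_true, h1]
      exact hc
    · simp only [hs, if_false, div_one]
      obtain ⟨γ, a, d, b, ha, hd, had, hA⟩ := exists_upper_triangular s.out
      rcases upper_cases hp had with ⟨rfl, rfl⟩ | ⟨rfl, rfl⟩
      · obtain ⟨N, c, hc⟩ := exists_expands_discriminant_quotient (b := b) ha hd had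
        refine ⟨N, c, ?_⟩
        have h1 : phi s.out.1 = phi (γ • s.out).1 := (hphi.smul_eq γ s.out).symm
        rw [h1, hA, show phi _ = _ from funext fun z => phi_upper (b := b) ha hd z]
        simpa using! hc
      · refine absurd ?_ hs
        rw [← s.mk_out, hs₀, Cls.mk_eq_mk]
        refine ⟨γ⁻¹ * ModularGroup.T ^ b, ?_⟩
        rw [mul_smul, inv_smul_eq_iff]
        refine FixedDetMatrices.ext' _ _ ?_
        rw [hA, FixedDetMatrices.smul_coe, upper_eq_T_zpow_mul]
  choose N c hc hcu using hexp
  have hprod := Expands.prod Finset.univ fun s _ => hc s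
  have hF : (∏ s : Cls p, fun z => phi s.out.1 z / (if s = s₀ then (p : ℂ) ^ 12 else 1)) =
      fun z => (∏ s : Cls p, phi s.out.1 z) / (p : ℂ) ^ 12 := by
    funext z
    rw [Finset.prod_apply, Finset.prod_div_distrib, Finset.prod_ite_eq' Finset.univ s₀]
    simp
  rw [hF] at hprod
  have hu : IsUnit (PowerSeries.constantCoeff (∏ s : Cls p, c s)) := by
    rw [map_prod]
    exact IsUnit.prod_univ_iff.mpr hcu
  have hdiff : MDifferentiable 𝓘(ℂ) 𝓘(ℂ)
      (fun z => (∏ s : Cls p, phi s.out.1 z) / (p : ℂ) ^ 12) := by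
    have h1 : (fun z => (∏ s : Cls p, phi s.out.1 z) / (p : ℂ) ^ 12) =
        (∏ s : Cls p, phi s.out.1) * fun _ => ((p : ℂ) ^ 12)⁻¹ := by
      funext z
      rw [Pi.mul_apply, Finset.prod_apply, div_eq_mul_inv]
    rw [h1]
    exact (Subring.prod_mem (integralRing p) fun s _ => hphi.mem _).1.mul mdifferentiable_const
  have hinv : ∀ (γ : SL(2, ℤ)) z, (∏ s : Cls p, phi s.out.1 (γ • z)) / (p : ℂ) ^ 12 =
      (∏ s : Cls p, phi s.out.1 z) / (p : ℂ) ^ 12 := fun γ z => by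
    have := hphi.prod_smul γ z
    rw [Finset.prod_apply, Finset.prod_apply] at this
    rw [this]
  have h := hprod.eq_of_ne_zero hdiff hinv (fun z => div_ne_zero
    (Finset.prod_ne_zero_iff.mpr fun s _ => phi_ne_zero (by rw [s.out.2]; exact hp0) z)
    (pow_ne_zero _ hp')) hu
  obtain ⟨u, hu⟩ := hu
  refine ⟨u, fun z => ?_⟩
  rw [hu, ← h z, mul_div_cancel₀ _ (pow_ne_zero _ hp')]

/-! ### The conjugates of an entire integral function -/

lemma HasQExpansion.exists_expands {h : ℕ} {g : ℍ → ℂ} {a : ℤ → ℂ} (hg : HasQExpansion h g a)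
    (ha : ∀ ν, IsIntegral ℤ (a ν)) : ∃ N c, Expands h g N c := by
  obtain ⟨⟨n, hn⟩, ρ, hρ⟩ := hg
  choose b hb using fun ν => exists_coe_eq (ha ν)
  refine ⟨-n, PowerSeries.mk fun k => b (n + k), ?_⟩
  have hev : ∀ᶠ z : ℍ in atImInfty, ρ < z.im := tendsto_comap.eventually_gt_atTop ρ
  filter_upwards [hev] with z hz
  have hq : 𝕢 (h : ℝ) z ≠ 0 := Function.Periodic.qParam_ne_zero _
  have h1 := (hρ z hz).mul_left (𝕢 (h : ℝ) z ^ (-n))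
  have hinj : Function.Injective fun k : ℕ => n + (k : ℤ) := fun k l hkl => by simpa using hkl
  refine ((hinj.hasSum_iff fun ν hν => ?_).mpr h1).congr_fun fun k => ?_
  · rw [hn ν, zero_mul, mul_zero]
    by_contra! hle
    exact hν ⟨(ν - n).toNat, by simp only; omega⟩
  · rw [PowerSeries.coeff_mk, hb, Function.comp_apply, zpow_add₀ hq, zpow_neg, zpow_natCast]
    field_simp

lemma mdifferentiable_smul_SL (γ : SL(2, ℤ)) :
    MDifferentiable 𝓘(ℂ) 𝓘(ℂ) (fun z : ℍ => γ • z) := by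
  rw [← show moebius (γ : Matrix (Fin 2) (Fin 2) ℤ) = fun z : ℍ => γ • z from
    funext fun z => moebius_SL γ z]
  exact mdifferentiable_moebius (by simp)

lemma mdifferentiable_aeval (B : MvPolynomial (Fin 2) ℚ) {f g : ℍ → ℂ}
    (hf : MDifferentiable 𝓘(ℂ) 𝓘(ℂ) f) (hg : MDifferentiable 𝓘(ℂ) 𝓘(ℂ) g) :
    MDifferentiable 𝓘(ℂ) 𝓘(ℂ) (fun z => MvPolynomial.aeval ![f z, g z] B) := by
  induction B using MvPolynomial.induction_on with
  | C a => simpa using! mdifferentiable_const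
  | add p q hp hq =>
    simp only [map_add]
    exact hp.add hq
  | mul_X p i hp =>
    simp only [map_mul, MvPolynomial.aeval_X]
    refine hp.mul ?_
    fin_cases i
    exacts [hf, hg]

/-- Elements of `ℚ(j(ω), j(P(ω)))` are invariant under `SL₂(ℤ) ∩ P⁻¹ SL₂(ℤ) P`. -/
lemma MemRationalField.apply_smul {P : Matrix (Fin 2) (Fin 2) ℤ} (hP : 0 < P.det) {f : ℍ → ℂ}
    (hf : MDifferentiable 𝓘(ℂ) 𝓘(ℂ) f) (hmem : MemRationalField P f) {M N : SL(2, ℤ)}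
    (hMN : P * (M : Matrix (Fin 2) (Fin 2) ℤ) = (N : Matrix (Fin 2) (Fin 2) ℤ) * P) (z : ℍ) :
    f (M • z) = f z := by
  obtain ⟨A, B, ⟨w, hw⟩, hAB⟩ := hmem
  have hjP : ∀ z, j (moebius P (M • z)) = j (moebius P z) := fun z => by
    rw [← moebius_SL, ← moebius_mul hP (by simp), hMN, moebius_mul (by simp) hP, moebius_SL, j_smul]
  have hB := mdifferentiable_aeval B mdifferentiable_j
    (mdifferentiable_j.comp (mdifferentiable_moebius hP))
  have hd : MDifferentiable 𝓘(ℂ) 𝓘(ℂ) ((fun z => f (M • z)) - f) :=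
    (hf.comp (mdifferentiable_smul_SL M)).sub hf
  have hzero : ((fun z => f (M • z)) - f) *
      (fun z => MvPolynomial.aeval ![j z, (j ∘ moebius P) z] B) = 0 := by
    funext z
    have h1 := hAB (M • z)
    rw [j_smul, hjP, ← hAB z] at h1
    simp only [Pi.mul_apply, Pi.sub_apply, Pi.zero_apply, Function.comp_apply]
    rw [sub_mul, h1, sub_self]
  -- The holomorphic functions on ℍ form a domain, and the denominator is not identically zero.
  rcases (mul_eq_zero_iff hd hB).mp hzero with h | h
  · exact sub_eq_zero.mp (congrFun h z)
  · exact absurd (congrFun h w) hw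

/-- Two admissible choices satisfy M' M⁻¹ ∈ SL₂(ℤ) ∩ P⁻¹ SL₂(ℤ) P, and f is invariant under this
group. -/
lemma IsConjugate.unique {P S : Matrix (Fin 2) (Fin 2) ℤ} (hP : 0 < P.det) {f g g' : ℍ → ℂ}
    (hf : MDifferentiable 𝓘(ℂ) 𝓘(ℂ) f) (hmem : MemRationalField P f) (hg : IsConjugate P f S g)
    (hg' : IsConjugate P f S g') : g = g' := by
  obtain ⟨M, N, hMN, h⟩ := hg
  obtain ⟨M', N', hMN', h'⟩ := hg'
  have key : P * ((M' * M⁻¹ : SL(2, ℤ)) : Matrix (Fin 2) (Fin 2) ℤ) =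
      ((N' * N⁻¹ : SL(2, ℤ)) : Matrix (Fin 2) (Fin 2) ℤ) * P := by
    have e1 : (M : Matrix (Fin 2) (Fin 2) ℤ) * ((M⁻¹ : SL(2, ℤ)) : Matrix (Fin 2) (Fin 2) ℤ) = 1 := by
      rw [← Matrix.SpecialLinearGroup.coe_mul]; simp
    have e2 : ((N⁻¹ : SL(2, ℤ)) : Matrix (Fin 2) (Fin 2) ℤ) * (N : Matrix (Fin 2) (Fin 2) ℤ) = 1 := by
      rw [← Matrix.SpecialLinearGroup.coe_mul]; simp
    have h1 : ((N⁻¹ : SL(2, ℤ)) : Matrix (Fin 2) (Fin 2) ℤ) * P * M = S := by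
      rw [mul_assoc, hMN, ← mul_assoc, e2, one_mul]
    rw [Matrix.SpecialLinearGroup.coe_mul, Matrix.SpecialLinearGroup.coe_mul, ← mul_assoc, hMN',
      ← h1]
    simp only [mul_assoc, e1, mul_one]
  funext z
  rw [h z, h' z, ← hmem.apply_smul hP hf key (M • z), mul_smul, inv_smul_smul]

/-- The conjugates of an entire integral function form a conjugate system. -/
lemma IsEntireIntegral.exists_isConjSystem {p : ℕ} (hp : p.Prime) {P : Matrix (Fin 2) (Fin 2) ℤ}
    (hP : P.det = p) {f : ℍ → ℂ} (hf : IsEntireIntegral p P f) :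
    ∃ F : FixedDetMatrix (Fin 2) ℤ (p : ℤ) → ℍ → ℂ, IsConjSystem F ∧
      ∀ A, IsConjugate P f A.1 (F A) := by
  have hP0 : 0 < P.det := by rw [hP]; exact_mod_cast hp.pos
  choose M N hMN using exists_mul_eq_mul hp hP
  have hconj : ∀ A, IsConjugate P f A.1 fun z => f (M A • z) := fun A =>
    ⟨M A, N A, hMN A, fun _ => rfl⟩
  refine ⟨fun A z => f (M A • z), ⟨fun γ A => ?_, fun γ A z => ?_, fun A => ?_⟩, hconj⟩
  · refine (hconj (γ • A)).unique hP0 hf.holomorphic hf.mem ⟨M A, N A * γ⁻¹, ?_, fun _ => rfl⟩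
    have e : ((γ⁻¹ : SL(2, ℤ)) : Matrix (Fin 2) (Fin 2) ℤ) * (γ : Matrix (Fin 2) (Fin 2) ℤ) = 1 := by
      rw [← Matrix.SpecialLinearGroup.coe_mul]; simp
    rw [hMN, FixedDetMatrices.smul_coe, Matrix.SpecialLinearGroup.coe_mul, mul_assoc,
      ← mul_assoc _ _ A.1, e, one_mul]
  · have h : IsConjugate P f (mulRight A γ).1 fun z => f (M A • γ • z) :=
      ⟨M A * γ, N A, by
        rw [Matrix.SpecialLinearGroup.coe_mul, ← mul_assoc, hMN, mulRight, mul_assoc],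
        fun z => by rw [mul_smul]⟩
    exact congrFun (h.unique hP0 hf.holomorphic hf.mem (hconj (mulRight A γ))) z
  · obtain ⟨a, ha, hint⟩ := hf.integral _ _ (hconj A)
    exact ⟨hf.holomorphic.comp (mdifferentiable_smul_SL _), ha.exists_expands hint⟩

lemma isIntegral_coeff_prod {ι : Type*} (s : Finset ι) (G : ι → Polynomial ℂ)
    (hG : ∀ i ∈ s, ∀ k, IsIntegral ℤ ((G i).coeff k)) (k : ℕ) :
    IsIntegral ℤ ((∏ i ∈ s, G i).coeff k) := by
  have h1 : ∏ i ∈ s, G i ∈ Polynomial.lifts (algebraMap (𝓞 ℂ) ℂ) := by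
    refine Subsemiring.prod_mem _ fun i hi => ?_
    rw [Polynomial.lifts_iff_coeff_lifts]
    exact fun k => exists_coe_eq (hG i hi k)
  rw [Polynomial.lifts_iff_coeff_lifts] at h1
  obtain ⟨x, hx⟩ := h1 k
  rw [← hx]
  exact NumberField.RingOfIntegers.isIntegral_coe x

/-- If `f_{diag(p,1)}` is divisible by `p`, then so is the sum of the products
`f_S ∏_{S' ≠ S} φ_{S'}` at each point where `j` is integral. -/
lemma isIntegral_coeff_one_div {p : ℕ} [NeZero p]
    {F : FixedDetMatrix (Fin 2) ℤ (p : ℤ) → ℍ → ℂ} (hF : IsConjSystem F)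
    (hdiag : ∃ N c, Expands p (fun z => F (diagMat p) z / p) N c) {z : ℍ}
    (hz : IsIntegral ℤ (j z)) :
    IsIntegral ℤ ((clsProd fun A => Polynomial.C (phi A.1) +
      Polynomial.C (F A) * Polynomial.X).coeff 1 z / p) := by
  classical
  have hp' : (p : ℂ) ≠ 0 := by exact_mod_cast NeZero.ne p
  have hG := (isConjSystem_phi p).linear hF
  set G := fun A : FixedDetMatrix (Fin 2) ℤ (p : ℤ) => Polynomial.C (phi A.1) +
      Polynomial.C (F A) * Polynomial.X with hGdef
  set s₀ : Cls p := Cls.mk (diagMat p) with hs₀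
  set W := ∏ s ∈ Finset.univ.erase s₀, G (Quotient.out s) with hW
  have hprod : clsProd G = G (diagMat p) * W := by
    rw [clsProd, ← Finset.mul_prod_erase _ _ (Finset.mem_univ s₀), hs₀, hG.out_mk]
  set φ' : ℍ → ℂ := fun z => phi (diagMat p).1 z / p with hφ'
  set f' : ℍ → ℂ := fun z => F (diagMat p) z / p with hf'
  have hφ'mem : φ' ∈ integralRing p := by
    obtain ⟨N, c, hc, -⟩ := exists_expands_phi_diagMat_div (p := p)
    have h := (Expands.const p ((p : 𝓞 ℂ) ^ 11)).mul hc
    refine ⟨?_, 0 + N, PowerSeries.C ((p : 𝓞 ℂ) ^ 11) * c, ?_⟩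
    · exact ((isConjSystem_phi p).mem (diagMat p)).1.div mdifferentiable_const fun _ => hp'
    · convert h using 1
      funext z
      simp only [hφ', Pi.mul_apply, map_pow, map_natCast]
      field_simp
  have hf'mem : f' ∈ integralRing p :=
    ⟨(hF.mem (diagMat p)).1.div mdifferentiable_const fun _ => hp', hdiag⟩
  have hWmem : ∀ k, W.coeff k ∈ integralRing p := fun k =>
    coeff_prod_mem_integralRing _ _ (fun s _ k => hG.mem _ k) k
  -- Splitting off the factor of diag(p, 1), the coefficient of X is φ_diag W₁ + f_diag W₀. Both
  -- φ_diag and f_diag stay integral at the cusp after division by p. The summands need not be of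
  -- level one, but their sum is.
  set H : ℍ → ℂ := φ' * W.coeff 1 + f' * W.coeff 0 with hH
  have hHmem : H ∈ integralRing p :=
    add_mem (mul_mem hφ'mem (hWmem 1)) (mul_mem hf'mem (hWmem 0))
  have hHeq : ∀ z, (clsProd G).coeff 1 z / p = H z := fun z => by
    rw [hprod, Polynomial.mul_coeff_one]
    simp only [hGdef, hH, hφ', hf', Pi.add_apply, Pi.mul_apply, Polynomial.coeff_add,
      Polynomial.coeff_C_zero, Polynomial.coeff_C_mul, Polynomial.coeff_X_one,
      Polynomial.coeff_X_zero, Polynomial.coeff_C_succ, mul_one, mul_zero, add_zero, zero_add]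
    ring
  rw [hHeq]
  refine isIntegral_of_mem_integralRing hHmem (fun γ z => ?_) hz
  rw [← hHeq, ← hHeq, hG.coeff_clsProd_smul]

/-- The divisibility relation at a fixed point behind the second part of the main theorem. -/
theorem IsEntireIntegral.exists_relation {p : ℕ} (hp : p.Prime) {P : Matrix (Fin 2) (Fin 2) ℤ}
    (hP : P.det = p) {f : ℍ → ℂ} (hf : IsEntireIntegral p P f)
    (hdiag : ∀ g, IsConjugate P f !![(p : ℤ), 0; 0, 1] g → ∃ a : ℤ → ℂ, HasQExpansion 1 g a ∧
      ∀ ν, ∃ c : ℂ, IsIntegral ℤ c ∧ a ν = p * c)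
    {P' : Matrix (Fin 2) (Fin 2) ℤ} (hP' : P'.det = p) {g : ℍ → ℂ} (hg : IsConjugate P f P' g)
    {z : ℍ} (hz : IsFixedPoint z) :
    ∃ (x y w t r : 𝓞 ℂ) (u : (𝓞 ℂ)ˣ), (x : ℂ) = phi P' z ∧ (y : ℂ) = g z ∧
      x * w = (p : 𝓞 ℂ) ^ 12 * u ∧ x * t + y * w = p * r := by
  classical
  have : NeZero p := ⟨hp.ne_zero⟩
  have hp' : (p : ℂ) ≠ 0 := by exact_mod_cast hp.ne_zero
  have hP0 : 0 < P.det := by rw [hP]; exact_mod_cast hp.pos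
  obtain ⟨F, hF, hconj⟩ := hf.exists_isConjSystem hp hP
  have hdiag' : ∃ N c, Expands p (fun z => F (diagMat p) z / p) N c := by
    obtain ⟨a, ⟨⟨n, hn⟩, ρ, hρ⟩, ha⟩ := hdiag _ (hconj (diagMat p))
    choose c hc hac using ha
    have h1 : HasQExpansion 1 (fun z => F (diagMat p) z / p) c := by
      refine ⟨⟨n, fun ν hν => ?_⟩, ρ, fun z hz => ?_⟩
      · have := hac ν
        rw [hn ν hν] at this
        simpa [hp'] using this.symm
      · refine ((hρ z hz).div_const (p : ℂ)).congr_fun fun ν => ?_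
        rw [hac ν]
        field_simp
    obtain ⟨N, d, hd⟩ := h1.exists_expands hc
    obtain ⟨d', hd', -⟩ := hd.ramify p
    exact ⟨_, _, hd'⟩
  have hphi := isConjSystem_phi p
  have hG := hphi.linear hF
  set A : FixedDetMatrix (Fin 2) ℤ (p : ℤ) := ⟨P', hP'⟩ with hA
  have hgF : g = F A := hg.unique hP0 hf.holomorphic hf.mem (hconj A)
  have hj := hz.isIntegral_j
  set G := fun A : FixedDetMatrix (Fin 2) ℤ (p : ℤ) => Polynomial.C (phi A.1) +
      Polynomial.C (F A) * Polynomial.X with hGdef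
  set s₁ : Cls p := Cls.mk A with hs₁
  set ev := Pi.evalRingHom (fun _ : ℍ => ℂ) z with hev
  have hGev : ∀ B, (G B).map ev = Polynomial.C (phi B.1 z) + Polynomial.C (F B z) * Polynomial.X := by
    intro B
    rw [hGdef]
    simp only [Polynomial.map_add, Polynomial.map_mul, Polynomial.map_C, Polynomial.map_X, hev,
      Pi.evalRingHom_apply]
  -- For the product over the classes other than that of P', the constant coefficient is the product
  -- w of the remaining φ_S(z) and the linear coefficient is t.
  set W := ∏ s ∈ Finset.univ.erase s₁, (G (Quotient.out s)).map ev with hW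
  have hprod : (clsProd G).map ev = (G A).map ev * W := by
    rw [clsProd, Polynomial.map_prod, ← Finset.mul_prod_erase _ _ (Finset.mem_univ s₁), hs₁,
      hG.out_mk]
  have hWint : ∀ k, IsIntegral ℤ (W.coeff k) := fun k => by
    refine isIntegral_coeff_prod _ _ (fun s _ k => ?_) k
    rw [hGev, Polynomial.coeff_add, Polynomial.coeff_C, Polynomial.coeff_C_mul, Polynomial.coeff_X]
    refine IsIntegral.add ?_ (IsIntegral.mul (hF.isIntegral _ hj) ?_)
    · split_ifs
      exacts [hphi.isIntegral _ hj, isIntegral_zero]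
    · split_ifs
      exacts [isIntegral_one, isIntegral_zero]
  obtain ⟨x, hx⟩ := exists_coe_eq (hphi.isIntegral A hj)
  obtain ⟨y, hy⟩ := exists_coe_eq (hF.isIntegral A hj)
  obtain ⟨w, hw⟩ := exists_coe_eq (hWint 0)
  obtain ⟨t, ht⟩ := exists_coe_eq (hWint 1)
  obtain ⟨r, hr⟩ := exists_coe_eq (isIntegral_coeff_one_div hF hdiag' hj)
  obtain ⟨u, hu⟩ := exists_prod_phi hp
  refine ⟨x, y, w, t, r, u, hx, by rw [hy, hgF], NumberField.RingOfIntegers.ext ?_,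
    NumberField.RingOfIntegers.ext ?_⟩
  · have h1 := hu z
    have h2 : W.coeff 0 = ∏ s ∈ Finset.univ.erase s₁, phi (Quotient.out s).1 z := by
      rw [hW, Polynomial.coeff_zero_prod]
      refine Finset.prod_congr rfl fun s _ => ?_
      rw [hGev]
      simp
    rw [← Finset.mul_prod_erase _ _ (Finset.mem_univ s₁), ← h2,
      show phi s₁.out.1 z = phi A.1 z from congrFun (hphi.out_mk A) z] at h1
    simp only [NumberField.RingOfIntegers.coe_eq_algebraMap] at *
    rw [map_mul, map_mul, map_pow, map_natCast, hx, hw, h1]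
  · have h1 := congrArg (fun Q : Polynomial ℂ => Q.coeff 1) hprod
    simp only [Polynomial.mul_coeff_one, hGev, Polynomial.coeff_map] at h1
    simp only [Polynomial.coeff_add, Polynomial.coeff_C_zero, Polynomial.coeff_C_mul,
      Polynomial.coeff_X_one, Polynomial.coeff_X_zero, Polynomial.coeff_C_succ, mul_one, mul_zero,
      add_zero, zero_add] at h1
    simp only [NumberField.RingOfIntegers.coe_eq_algebraMap] at *
    rw [map_add, map_mul, map_mul, map_mul, map_natCast, hx, hy, hw, ht, hr,
      mul_div_cancel₀ _ hp']
    exact h1.symm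

/-! ### Orders of quadratic fields -/

section QuadraticField

variable {K : Type*} [Field K] [NumberField K]

lemma not_isUnit_natCast_of_prime {p : ℕ} (hp : p.Prime) : ¬ IsUnit (p : 𝓞 K) := by
  intro h
  have h1 := h.map (Algebra.norm ℤ)
  rw [show (p : 𝓞 K) = algebraMap ℤ (𝓞 K) p by simp, Algebra.norm_algebraMap,
    isUnit_pow_iff Module.finrank_pos.ne', Int.isUnit_iff_natAbs_eq, Int.natAbs_natCast] at h1
  exact hp.one_lt.ne' h1

/-- The ring of integers of a quadratic field is generated by one element. -/
lemma exists_generator (hK : Module.finrank ℚ K = 2) :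
    ∃ ω : 𝓞 K, ∀ y : 𝓞 K, ∃ s t : ℤ, y = s + t * ω := by
  have hrank : Module.finrank ℤ (𝓞 K) = 2 := (NumberField.RingOfIntegers.rank K).trans hK
  let b := Module.finBasisOfFinrankEq ℤ (𝓞 K) hrank
  have hb : ∀ y : 𝓞 K, ∃ s t : ℤ, y = s * b 0 + t * b 1 := fun y => by
    refine ⟨b.repr y 0, b.repr y 1, ?_⟩
    have := (b.sum_repr y).symm
    simpa [Fin.sum_univ_two] using this
  obtain ⟨m, n, hmn⟩ := hb 1
  have hcop : Int.gcd m n = 1 := by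
    by_contra hne
    obtain ⟨q, hq, hqd⟩ := Nat.exists_prime_and_dvd hne
    obtain ⟨m', hm'⟩ := (Int.natCast_dvd_natCast.mpr hqd).trans (Int.gcd_dvd_left m n)
    obtain ⟨n', hn'⟩ := (Int.natCast_dvd_natCast.mpr hqd).trans (Int.gcd_dvd_right m n)
    refine not_isUnit_natCast_of_prime (K := K) hq (IsUnit.of_mul_eq_one (m' * b 0 + n' * b 1) ?_)
    rw [hmn, hm', hn']
    push_cast
    ring
  have hbez := Int.gcd_eq_gcd_ab m n
  rw [hcop] at hbez
  set u := Int.gcdA m n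
  set v := Int.gcdB m n
  have hbez' : (m : 𝓞 K) * u + n * v = 1 := by exact_mod_cast hbez.symm
  -- With 1 = m b₀ + n b₁ and mu + nv = 1, this ω completes 1 to a basis, the change of basis having
  -- determinant 1.
  refine ⟨-v * b 0 + u * b 1, fun y => ?_⟩
  obtain ⟨s, t, rfl⟩ := hb y
  refine ⟨s * u + t * v, -s * n + t * m, ?_⟩
  push_cast
  linear_combination (-((s : 𝓞 K) * u + t * v)) * hmn - ((s : 𝓞 K) * b 0 + t * b 1) * hbez'

/-- An order whose conductor is not divisible by `p` contains `c 𝓞` for an integer `c` prime to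
`p`. -/
lemma exists_int_mem_conductor (hK : Module.finrank ℚ K = 2) {p : ℕ} (R : Subalgebra ℤ (𝓞 K))
    (hcond : ¬ Ideal.span {(p : 𝓞 K)} ∣ conductor R) :
    ∃ c : ℤ, ¬ (p : ℤ) ∣ c ∧ (c : 𝓞 K) ∈ conductor R := by
  obtain ⟨ω, hω⟩ := exists_generator hK
  rw [Ideal.dvd_iff_le, SetLike.not_le_iff_exists] at hcond
  obtain ⟨x, hx, hxp⟩ := hcond
  obtain ⟨a, b, hab⟩ := hω x
  obtain ⟨s, t, hst⟩ := hω (ω * ω)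
  have hint : ∀ n : ℤ, (n : 𝓞 K) ∈ R := fun n => by
    simp
  have key : ∀ c : ℤ, (c : 𝓞 K) * ω ∈ R → (c : 𝓞 K) ∈ conductor R := fun c hc y => by
    obtain ⟨m, n, rfl⟩ := hω y
    rw [show (c : 𝓞 K) * (m + n * ω) = ((c * m : ℤ) : 𝓞 K) + n * (c * ω) by push_cast; ring]
    exact R.add_mem (hint _) (R.mul_mem (hint n) hc)
  have h1 : (b : 𝓞 K) * ω ∈ R := by
    have h2 := R.sub_mem (hx 1) (hint a)
    rwa [mul_one, hab, add_sub_cancel_left] at h2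
  have h2 : ((a + b * t : ℤ) : 𝓞 K) * ω ∈ R := by
    have h3 := R.sub_mem (hx ω) (hint (b * s))
    have h4 : x * ω - ((b * s : ℤ) : 𝓞 K) = ((a + b * t : ℤ) : 𝓞 K) * ω := by
      rw [hab]
      push_cast
      linear_combination (b : 𝓞 K) * hst
    rwa [h4] at h3
  -- Both bω and (a + bt)ω lie in R, so b and a + bt lie in the conductor. If p divided both, it
  -- would divide x = a + bω.
  by_cases hb : (p : ℤ) ∣ b
  · refine ⟨a + b * t, fun h => hxp ?_, key _ h2⟩
    obtain ⟨a', rfl⟩ := (Int.dvd_add_left (hb.mul_right t)).mp h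
    obtain ⟨b', rfl⟩ := hb
    rw [hab, Ideal.mem_span_singleton]
    exact ⟨a' + b' * ω, by push_cast; ring⟩
  · exact ⟨b, hb, key _ h1⟩

variable {p : ℕ} {𝔭 𝔭bar : Ideal (𝓞 K)}

lemma absNorm_span_natCast (hK : Module.finrank ℚ K = 2) (n : ℕ) :
    Ideal.absNorm (Ideal.span {(n : 𝓞 K)}) = n ^ 2 := by
  have hrank : Module.finrank ℤ (𝓞 K) = 2 := (NumberField.RingOfIntegers.rank K).trans hK
  rw [Ideal.absNorm_span_singleton, show (n : 𝓞 K) = algebraMap ℤ (𝓞 K) n by simp,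
    Algebra.norm_algebraMap, hrank, Int.natAbs_pow, Int.natAbs_natCast]

lemma absNorm_eq_of_mul_eq (hK : Module.finrank ℚ K = 2) (hp : p.Prime) (h𝔭 : 𝔭.IsPrime)
    (h𝔭bar : 𝔭bar.IsPrime) (hsplit : 𝔭 * 𝔭bar = Ideal.span {(p : 𝓞 K)}) :
    Ideal.absNorm 𝔭 = p := by
  have h1 : Ideal.absNorm 𝔭 * Ideal.absNorm 𝔭bar = p ^ 2 := by
    rw [← map_mul, hsplit, absNorm_span_natCast hK]
  obtain ⟨k, hk, hk'⟩ := (Nat.dvd_prime_pow hp).mp (Dvd.intro _ h1)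
  interval_cases k
  · rw [pow_zero, Ideal.absNorm_eq_one_iff] at hk'
    exact absurd hk' h𝔭.ne_top
  · simpa using hk'
  · rw [hk'] at h1
    have h2 : Ideal.absNorm 𝔭bar = 1 :=
      Nat.eq_of_mul_eq_mul_left (pow_pos hp.pos 2) (h1.trans (mul_one _).symm)
    rw [Ideal.absNorm_eq_one_iff] at h2
    exact absurd h2 h𝔭bar.ne_top

/-- Otherwise Cauchy's theorem yields an element of order p in 𝓞/𝔢, although p is invertible there.
-/
lemma not_dvd_absNorm_of_isCoprime (hp : p.Prime) {𝔢 : Ideal (𝓞 K)} (h𝔢 : 𝔢 ≠ ⊥)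
    (hcop : IsCoprime 𝔢 (Ideal.span {(p : 𝓞 K)})) : ¬ p ∣ Ideal.absNorm 𝔢 := by
  intro hdvd
  have := Ideal.finiteQuotientOfFreeOfNeBot 𝔢 h𝔢
  have : Fact p.Prime := ⟨hp⟩
  rw [Ideal.absNorm_apply, Submodule.cardQuot_apply] at hdvd
  obtain ⟨x, hx⟩ := exists_prime_addOrderOf_dvd_card' p hdvd
  obtain ⟨y, rfl⟩ := Ideal.Quotient.mk_surjective x
  have hpy : (p : 𝓞 K) * y ∈ 𝔢 := by
    rw [← Ideal.Quotient.eq_zero_iff_mem, map_mul, map_natCast, ← nsmul_eq_mul, ← hx]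
    exact addOrderOf_nsmul_eq_zero _
  rw [Ideal.isCoprime_iff_exists] at hcop
  obtain ⟨e, he, f, hf, hef⟩ := hcop
  obtain ⟨r, rfl⟩ := Ideal.mem_span_singleton.mp hf
  have hy : y ∈ 𝔢 := by
    rw [← one_mul y, ← hef, show (e + p * r) * y = y * e + r * (p * y) by ring]
    exact 𝔢.add_mem (𝔢.mul_mem_left _ he) (𝔢.mul_mem_left _ hpy)
  rw [Ideal.Quotient.eq_zero_iff_mem.mpr hy, addOrderOf_zero] at hx
  exact hp.one_lt.ne hx

/-- A prime ideal of degree one prime to the conductor contains an element of the order that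
generates it up to an ideal prime to `p`. -/
lemma exists_mem_span_eq_mul (hK : Module.finrank ℚ K = 2) (hp : p.Prime) (h𝔭 : 𝔭.IsPrime)
    (h𝔭bar : 𝔭bar.IsPrime) (hsplit : 𝔭 * 𝔭bar = Ideal.span {(p : 𝓞 K)}) {R : Subalgebra ℤ (𝓞 K)}
    {c : ℤ} (hc : ¬ (p : ℤ) ∣ c) (hcR : (c : 𝓞 K) ∈ conductor R) :
    ∃ (l : 𝓞 K) (𝔢 : Ideal (𝓞 K)), l ∈ R ∧ l ≠ 0 ∧ Ideal.span {l} = 𝔭 * 𝔢 ∧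
      IsCoprime 𝔢 (Ideal.span {(p : 𝓞 K)}) := by
  have hN := absNorm_eq_of_mul_eq hK hp h𝔭 h𝔭bar hsplit
  have hN' := absNorm_eq_of_mul_eq hK hp h𝔭bar h𝔭 ((mul_comm _ _).trans hsplit)
  have hbot : 𝔭 ≠ ⊥ := fun h => hp.ne_zero (by rw [← hN, h, Ideal.absNorm_bot])
  have hbot' : 𝔭bar ≠ ⊥ := fun h => hp.ne_zero (by rw [← hN', h, Ideal.absNorm_bot])
  have hprop : ∀ 𝔮 : Ideal (𝓞 K), Ideal.absNorm 𝔮 = p → ¬ 𝔭 ≤ 𝔭 * 𝔮 := fun 𝔮 h𝔮 hle => by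
    have heq := le_antisymm hle Ideal.mul_le_left
    have h1 := congrArg Ideal.absNorm heq
    rw [map_mul, hN, h𝔮] at h1
    have := hp.one_lt
    nlinarith
  -- An ideal contained in a union of two ideals lies in one of them, which the norms exclude. So l₀
  -- contains 𝔭 once and 𝔭bar not at all; if 𝔭 = 𝔭bar, exactly once.
  obtain ⟨l₀, hl₀, hl₁, hl₂⟩ : ∃ l₀ ∈ 𝔭, l₀ ∉ 𝔭 * 𝔭 ∧ l₀ ∉ 𝔭 * 𝔭bar := by
    by_contra! hcon
    have : (𝔭 : Set (𝓞 K)) ⊆ (𝔭 * 𝔭 : Ideal (𝓞 K)) ∪ (𝔭 * 𝔭bar : Ideal (𝓞 K)) := fun x hx => by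
      by_cases h : x ∈ 𝔭 * 𝔭
      exacts [.inl h, .inr (hcon x hx h)]
    rcases Ideal.subset_union.mp this with h | h
    exacts [hprop 𝔭 hN h, hprop 𝔭bar hN' h]
  obtain ⟨𝔢, h𝔢⟩ := Ideal.dvd_span_singleton.mpr hl₀
  have hmem : l₀ ∈ 𝔭 * 𝔢 := h𝔢 ▸ Ideal.mem_span_singleton_self l₀
  have hcop : ∀ 𝔮 : Ideal (𝓞 K), 𝔮.IsPrime → 𝔮 ≠ ⊥ → l₀ ∉ 𝔭 * 𝔮 → IsCoprime 𝔢 𝔮 :=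
    fun 𝔮 hq hq0 hl => by
      rw [Ideal.isCoprime_iff_sup_eq]
      rcases (hq.isMaximal hq0).out.le_iff.mp (le_sup_right : 𝔮 ≤ 𝔢 ⊔ 𝔮) with h | h
      · exact h
      · exact absurd (Ideal.mul_mono_right (le_sup_left.trans h.le) hmem) hl
  have hcp : IsCoprime (Ideal.span {(c : 𝓞 K)}) (Ideal.span {(p : 𝓞 K)}) := by
    rw [Ideal.isCoprime_span_singleton_iff]
    have h1 : IsCoprime c (p : ℤ) :=
      ((Nat.prime_iff_prime_int.mp hp).coprime_iff_not_dvd.mpr hc).symm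
    simpa using h1.map (Int.castRingHom (𝓞 K))
  -- Multiplication by c moves l₀ into R, and (c), being prime to p, is absorbed into 𝔢.
  refine ⟨c * l₀, Ideal.span {(c : 𝓞 K)} * 𝔢, hcR l₀, mul_ne_zero ?_ ?_, ?_, hcp.mul_left ?_⟩
  · rintro h0
    rw [Int.cast_eq_zero] at h0
    exact hc (h0 ▸ dvd_zero _)
  · rintro rfl
    exact hl₁ (zero_mem _)
  · rw [← Ideal.span_singleton_mul_span_singleton, h𝔢, mul_left_comm]
  · rw [← hsplit]
    exact (hcop 𝔭 h𝔭 hbot hl₁).mul_right (hcop 𝔭bar h𝔭bar hbot' hl₂)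

/-- The ideal `𝔭 ∩ R` is generated by `p` and the element `l` of the previous lemma. -/
lemma exists_eq_mul_add_mul (hp : p.Prime) (hsplit : 𝔭 * 𝔭bar = Ideal.span {(p : 𝓞 K)})
    {R : Subalgebra ℤ (𝓞 K)} {c : ℤ} (hc : ¬ (p : ℤ) ∣ c) (hcR : (c : 𝓞 K) ∈ conductor R)
    {l : 𝓞 K} {𝔢 : Ideal (𝓞 K)} (hl𝔢 : Ideal.span {l} = 𝔭 * 𝔢)
    (hcop : IsCoprime 𝔢 (Ideal.span {(p : 𝓞 K)})) {x : 𝓞 K} (hxR : x ∈ R) (hx : x ∈ 𝔭) :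
    ∃ y ∈ R, ∃ z ∈ R, x = l * y + p * z := by
  have h1 : 𝔭 = Ideal.span {l} ⊔ Ideal.span {(p : 𝓞 K)} := by
    have h2 : 𝔢 ⊔ 𝔭bar = ⊤ := by
      rw [Ideal.isCoprime_iff_sup_eq] at hcop
      rw [eq_top_iff, ← hcop]
      exact sup_le_sup_left (hsplit ▸ Ideal.mul_le_right) _
    rw [hl𝔢, ← hsplit, ← Ideal.mul_sup, h2, Ideal.mul_top]
  rw [h1, Submodule.mem_sup] at hx
  obtain ⟨_, hy, _, hz, rfl⟩ := hx
  obtain ⟨y, rfl⟩ := Ideal.mem_span_singleton.mp hy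
  obtain ⟨z, rfl⟩ := Ideal.mem_span_singleton.mp hz
  -- The coefficients y, z found so far lie only in 𝓞. Writing x = sc·x + tp·x with tp + sc = 1, the
  -- first term brings them into R through c, and the second is p times an element of R.
  obtain ⟨t, s, hst⟩ := (Nat.prime_iff_prime_int.mp hp).coprime_iff_not_dvd.mpr hc
  have hint : ∀ n : ℤ, (n : 𝓞 K) ∈ R := fun n => by simp
  refine ⟨s * (c * y), R.mul_mem (hint s) (hcR y),
    s * (c * z) + t * (l * y + p * z), R.add_mem (R.mul_mem (hint s) (hcR z))
      (R.mul_mem (hint t) hxR), ?_⟩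
  have hst' : (t : 𝓞 K) * p + s * c = 1 := by exact_mod_cast congrArg (Int.cast : ℤ → 𝓞 K) hst
  linear_combination (-(l * y + p * z)) * hst'

end QuadraticField

/-! ### Lattices and matrices -/

section Lattice

variable {K : Type*} [Field K]

lemma map_mul_mulVec (M N : Matrix (Fin 2) (Fin 2) ℤ) (v : Fin 2 → K) :
    (M * N).map (Int.cast : ℤ → K) *ᵥ v =
      M.map (Int.cast : ℤ → K) *ᵥ (N.map (Int.cast : ℤ → K) *ᵥ v) := by
  rw [Matrix.mulVec_mulVec]
  congr 1
  exact Matrix.map_mul (f := Int.castRingHom K)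

lemma map_mulVec_mem_span (M : Matrix (Fin 2) (Fin 2) ℤ) (v : Fin 2 → K) (i : Fin 2) :
    (M.map (Int.cast : ℤ → K) *ᵥ v) i ∈ Submodule.span ℤ (Set.range v) := by
  rw [Submodule.mem_span_range_iff_exists_fun]
  exact ⟨M i, by simp [Matrix.mulVec, dotProduct]⟩

lemma exists_eq_map_mulVec {v w : Fin 2 → K}
    (h : ∀ i, w i ∈ Submodule.span ℤ (Set.range v)) :
    ∃ M : Matrix (Fin 2) (Fin 2) ℤ, w = M.map (Int.cast : ℤ → K) *ᵥ v := by
  choose M hM using fun i => (Submodule.mem_span_range_iff_exists_fun ℤ).mp (h i)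
  refine ⟨Matrix.of M, funext fun i => ?_⟩
  rw [← hM i]
  simp [Matrix.mulVec, dotProduct]

lemma eq_of_map_mulVec_eq {v : Fin 2 → K} (hv : LinearIndependent ℤ v)
    {M N : Matrix (Fin 2) (Fin 2) ℤ}
    (h : M.map (Int.cast : ℤ → K) *ᵥ v = N.map (Int.cast : ℤ → K) *ᵥ v) : M = N := by
  ext i k
  have h1 := congrFun h i
  have h2 := Fintype.linearIndependent_iff.mp hv (fun k => M i k - N i k) (by
    simp only [Matrix.mulVec, dotProduct, Fin.sum_univ_two, Matrix.map_apply] at h1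
    simp only [Fin.sum_univ_two, zsmul_eq_mul, Int.cast_sub]
    linear_combination h1) k
  exact sub_eq_zero.mp h2

lemma linearIndependent_map_mulVec {v : Fin 2 → K} (hv : LinearIndependent ℤ v)
    {P : Matrix (Fin 2) (Fin 2) ℤ} (hP : P.det ≠ 0) :
    LinearIndependent ℤ (P.map (Int.cast : ℤ → K) *ᵥ v) := by
  rw [Fintype.linearIndependent_iff]
  intro g hg
  have h1 : g ᵥ* P = 0 := by
    funext k
    refine Fintype.linearIndependent_iff.mp hv (g ᵥ* P) ?_ k
    rw [← hg]
    simp only [Matrix.vecMul, Matrix.mulVec, dotProduct, Fin.sum_univ_two, zsmul_eq_mul,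
      Matrix.map_apply]
    push_cast
    ring
  have h2 := Matrix.eq_zero_of_vecMul_eq_zero hP h1
  exact fun i => congrFun h2 i

/-- Elements of `𝔞 𝔭_R`. -/
lemma mem_idealIn_smul_iff {p : ℕ} {𝔭 : Ideal (𝓞 K)} {R : Subalgebra ℤ (𝓞 K)} {l : 𝓞 K} (hlR : l ∈ R) (hl : l ∈ 𝔭)
    (hp𝔭 : (p : 𝓞 K) ∈ 𝔭)
    (hgen : ∀ x ∈ R, x ∈ 𝔭 → ∃ y ∈ R, ∃ z ∈ R, x = l * y + p * z) (𝔞 : Submodule R K) (x : K) :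
    x ∈ idealIn R 𝔭 • 𝔞 ↔ ∃ a ∈ 𝔞, ∃ b ∈ 𝔞, x = (l : K) * a + p * b := by
  have hsm : ∀ (r : R) (m : K), r • m = ((r : 𝓞 K) : K) * m := fun r m => rfl
  constructor
  · intro hx
    induction hx using Submodule.smul_induction_on' with
    | smul r hr m hm =>
      obtain ⟨y, hy, z, hz, h⟩ := hgen r r.2 hr
      refine ⟨_, 𝔞.smul_mem ⟨y, hy⟩ hm, _, 𝔞.smul_mem ⟨z, hz⟩ hm, ?_⟩
      simp only [hsm, h, NumberField.RingOfIntegers.coe_eq_algebraMap, map_add, map_mul, map_natCast]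
      ring
    | add x _ y _ hx hy =>
      obtain ⟨a, ha, b, hb, rfl⟩ := hx
      obtain ⟨a', ha', b', hb', rfl⟩ := hy
      exact ⟨_, 𝔞.add_mem ha ha', _, 𝔞.add_mem hb hb', by ring⟩
  · rintro ⟨a, ha, b, hb, rfl⟩
    refine Submodule.add_mem _ ?_ ?_
    · exact Submodule.smul_mem_smul (r := (⟨l, hlR⟩ : R)) hl ha
    · have h1 := Submodule.smul_mem_smul (I := idealIn R 𝔭) (N := 𝔞) (r := (p : R))
        (show ((p : R) : 𝓞 K) ∈ 𝔭 by simpa using hp𝔭) hb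
      rwa [hsm, show (((p : R) : 𝓞 K) : K) = p by simp] at h1

/-- Transition matrices to the same lattice are equivalent. -/
lemma IsTransition.unique {R : Subalgebra ℤ (𝓞 K)} {p : ℕ} (hp : p ≠ 0) {v : Fin 2 → K}
    (hv : LinearIndependent ℤ v) {𝔞 : Submodule R K} {𝔭 : Ideal (𝓞 K)}
    {P P' : Matrix (Fin 2) (Fin 2) ℤ} (h : IsTransition p v 𝔞 𝔭 P) (h' : IsTransition p v 𝔞 𝔭 P') :
    ∃ M : SL(2, ℤ), P' = (M : Matrix (Fin 2) (Fin 2) ℤ) * P := by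
  obtain ⟨M, hM⟩ := exists_eq_map_mulVec (v := P.map (Int.cast : ℤ → K) *ᵥ v)
    (w := P'.map (Int.cast : ℤ → K) *ᵥ v) fun i => by
      rw [← SetLike.mem_coe, h.2.2, ← h'.2.2]
      exact Submodule.subset_span ⟨i, rfl⟩
  rw [← map_mul_mulVec] at hM
  have hPM := eq_of_map_mulVec_eq hv hM
  have hdet := congrArg Matrix.det hPM
  rw [Matrix.det_mul, h.1, h'.1] at hdet
  have hp' : (p : ℤ) ≠ 0 := by exact_mod_cast hp
  have hM1 : M.det = 1 := mul_right_cancel₀ hp' (by rw [← hdet, one_mul])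
  exact ⟨⟨M, hM1⟩, hPM⟩

end Lattice

/-- If `p` divides `det A` exactly once, then the rows of `A` and `p ℤ²` generate a lattice of
index `p`. -/
lemma exists_det_eq_prime {p n : ℕ} (hp : p.Prime) (hn : ¬ p ∣ n) (A : Matrix (Fin 2) (Fin 2) ℤ)
    (hA : A.det = ((p * n : ℕ) : ℤ)) : ∃ P C D U V : Matrix (Fin 2) (Fin 2) ℤ, P.det = p ∧
      A = C * P ∧ (p : ℤ) • (1 : Matrix (Fin 2) (Fin 2) ℤ) = D * P ∧ P = U * A + (p : ℤ) • V := by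
  have hn0 : n ≠ 0 := fun h => hn (h ▸ dvd_zero p)
  have : NeZero (p * n) := ⟨mul_ne_zero hp.ne_zero hn0⟩
  obtain ⟨γ, a, d, b, ha, hd, had, hT⟩ := exists_upper_triangular (n := p * n) ⟨A, hA⟩
  replace hT : (γ : Matrix (Fin 2) (Fin 2) ℤ) * A = !![(a : ℤ), b; 0, (d : ℤ)] := hT
  have e : ((γ⁻¹ : SL(2, ℤ)) : Matrix (Fin 2) (Fin 2) ℤ) * (γ : Matrix (Fin 2) (Fin 2) ℤ) = 1 := by
    rw [← Matrix.SpecialLinearGroup.coe_mul]; simp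
  suffices h : ∃ P C D U V : Matrix (Fin 2) (Fin 2) ℤ, P.det = p ∧
      !![(a : ℤ), b; 0, (d : ℤ)] = C * P ∧ (p : ℤ) • (1 : Matrix (Fin 2) (Fin 2) ℤ) = D * P ∧
      P = U * !![(a : ℤ), b; 0, (d : ℤ)] + (p : ℤ) • V by
    obtain ⟨P, C, D, U, V, h1, h2, h3, h4⟩ := h
    refine ⟨P, ((γ⁻¹ : SL(2, ℤ)) : Matrix (Fin 2) (Fin 2) ℤ) * C, D,
      U * (γ : Matrix (Fin 2) (Fin 2) ℤ), V, h1, ?_, h3, ?_⟩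
    · rw [mul_assoc, ← h2, ← hT, ← mul_assoc, e, one_mul]
    · rw [mul_assoc, hT]
      exact h4
  have hcop : ∀ m : ℕ, ¬ p ∣ m → ∃ s t : ℤ, s * m + t * p = 1 := fun m hm => by
    have h1 : IsCoprime (m : ℤ) (p : ℤ) := by
      rw [Nat.isCoprime_iff_coprime]
      exact ((Nat.Prime.coprime_iff_not_dvd hp).mpr hm).symm
    exact h1
  -- Modulo p the rows of the triangular matrix span a line: that of (0, 1) if p ∣ a, and that of
  -- (1, sb) with s inverse to a if p ∣ d. The rows of P lift this line.
  rcases (Nat.Prime.dvd_mul hp).mp (Dvd.intro n had.symm : p ∣ a * d) with ⟨a', rfl⟩ | ⟨d', rfl⟩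
  · have h1 : a' * d = n := Nat.eq_of_mul_eq_mul_left hp.pos (by rw [← had]; ring)
    obtain ⟨s, t, hst⟩ := hcop d fun h => hn (h1 ▸ h.mul_left a')
    refine ⟨!![(p : ℤ), 0; 0, 1], !![(a' : ℤ), b; 0, d], !![1, 0; 0, (p : ℤ)], !![0, 0; 0, s],
      !![1, 0; 0, t], by simp, ?_, ?_, ?_⟩ <;>
    · ext i k
      fin_cases i <;> fin_cases k <;> simp [Matrix.mul_apply] <;> linarith
  · have h1 : a * d' = n := Nat.eq_of_mul_eq_mul_left hp.pos (by rw [← had]; ring)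
    obtain ⟨s, t, hst⟩ := hcop a fun h => hn (h1 ▸ h.mul_right d')
    refine ⟨!![1, s * b; 0, (p : ℤ)], !![(a : ℤ), b * t; 0, d'], !![(p : ℤ), -s * b; 0, 1],
      !![s, 0; 0, 0], !![t, 0; 0, 1], by simp, ?_, ?_, ?_⟩ <;>
    · ext i k
      fin_cases i <;> fin_cases k <;> simp [Matrix.mul_apply] <;>
      first | ring1 | linear_combination (-b) * hst | linear_combination -hst

/-! ### Complex multiplication by an element of the order -/

/-- The transpose of A is the matrix of multiplication by l in the ℚ-basis v, so det A is the norm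
of l. -/
lemma natAbs_det_eq_absNorm {K : Type*} [Field K] [NumberField K] (hK : Module.finrank ℚ K = 2)
    {v : Fin 2 → K} (hv : LinearIndependent ℤ v) {l : 𝓞 K} {A : Matrix (Fin 2) (Fin 2) ℤ}
    (hA : (l : K) • v = A.map (Int.cast : ℤ → K) *ᵥ v) :
    A.det.natAbs = Ideal.absNorm (Ideal.span {l}) := by
  have hv' : LinearIndependent ℚ v := (LinearIndependent.iff_fractionRing ℤ ℚ).mp hv
  let b := basisOfLinearIndependentOfCardEqFinrank hv' (by rw [hK, Fintype.card_fin])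
  have hb : ∀ i, b i = v i := fun i => by
    rw [coe_basisOfLinearIndependentOfCardEqFinrank]
  have hmat : Algebra.leftMulMatrix b (l : K) = (A.map (Int.cast : ℤ → ℚ))ᵀ := by
    ext i k
    have h1 : (l : K) * b k = ∑ m, (A k m : ℚ) • b m := by
      have := congrFun hA k
      simp only [Pi.smul_apply, smul_eq_mul, Matrix.mulVec, dotProduct, Matrix.map_apply] at this
      simp only [hb, this, Fin.sum_univ_two, Algebra.smul_def]
      simp
    rw [Algebra.leftMulMatrix_eq_repr_mul, h1, b.repr_sum_self]
    simp
  have hdet : (Algebra.norm ℤ l : ℚ) = A.det := by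
    rw [Algebra.coe_norm_int, Algebra.norm_eq_matrix_det b, hmat, Matrix.det_transpose]
    simp [Matrix.det_fin_two]
  rw [Ideal.absNorm_span_singleton]
  congr 1
  exact_mod_cast hdet.symm

/-- An integral matrix with the eigenvector `(z, 1)` for the eigenvalue `l`. -/
lemma det_eq_normSq {A : Matrix (Fin 2) (Fin 2) ℤ} {z : ℍ} {l : ℂ}
    (h0 : l * z = (A 0 0 : ℂ) * z + A 0 1) (h1 : l = (A 1 0 : ℂ) * z + A 1 1) :
    (A.det : ℝ) = Complex.normSq l := by
  have h0' := congrArg (starRingEnd ℂ) h0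
  have h1' := congrArg (starRingEnd ℂ) h1
  simp only [map_mul, map_add, map_intCast] at h0' h1'
  set w := (starRingEnd ℂ) (z : ℂ)
  set m := (starRingEnd ℂ) l
  have hzw : (z : ℂ) - w ≠ 0 := fun h => by
    have h2 := congrArg Complex.im h
    have h3 : (z : ℂ).im ≠ 0 := z.im_ne_zero
    simp only [w, Complex.sub_im, Complex.conj_im, Complex.zero_im] at h2
    exact h3 (by linarith)
  -- Conjugation gives the second eigenvector (w, 1) with eigenvalue m. The matrix of the two
  -- eigenvectors has determinant z − w ≠ 0, which can be cancelled.
  have h2 : (A.det : ℂ) = l * m := by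
    refine mul_right_cancel₀ hzw ?_
    rw [Matrix.det_fin_two]
    push_cast
    linear_combination (-m) * h0 + l * h0' + ((A 0 0 : ℂ) * w + A 0 1) * h1
      - ((A 0 0 : ℂ) * z + A 0 1) * h1'
  have h3 : ((A.det : ℝ) : ℂ) = Complex.normSq l := by
    rw [← Complex.mul_conj]
    exact_mod_cast h2
  exact_mod_cast h3

lemma moebius_eq_self_of_eigen {A : Matrix (Fin 2) (Fin 2) ℤ} (hA : 0 < A.det) {z : ℍ} {l : ℂ}
    (h0 : l * z = (A 0 0 : ℂ) * z + A 0 1) (h1 : l = (A 1 0 : ℂ) * z + A 1 1) :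
    moebius A z = z := by
  have hl : l ≠ 0 := h1 ▸ autFactor_ne_zero hA z
  ext
  rw [coe_moebius A hA, ← h0, ← h1, mul_div_cancel_left₀ _ hl]

/-- At the fixed point the two discriminants cancel, and the automorphy factor is the eigenvalue l.
-/
lemma phi_mul_pow_of_eigen {A : Matrix (Fin 2) (Fin 2) ℤ} (hA : 0 < A.det) {z : ℍ} {l : ℂ}
    (h0 : l * z = (A 0 0 : ℂ) * z + A 0 1) (h1 : l = (A 1 0 : ℂ) * z + A 1 1) :
    phi A z * l ^ 12 = (A.det : ℂ) ^ 12 := by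
  have hl : autFactor A z ≠ 0 := autFactor_ne_zero hA z
  have hl' : autFactor A z = l := h1.symm
  have hD := ModularForm.discriminant_ne_zero z
  rw [phi_eq hA, moebius_eq_self_of_eigen hA h0 h1, ← hl']
  field_simp

lemma not_isSquare_prime_mul {p n : ℕ} (hp : p.Prime) (hn : ¬ p ∣ n) : ¬ IsSquare (p * n) := by
  rintro ⟨k, hk⟩
  have h1 : p ∣ k := (or_self_iff).mp ((Nat.Prime.dvd_mul hp).mp (Dvd.intro n hk))
  obtain ⟨r, rfl⟩ := h1
  refine hn ⟨r * r, Nat.eq_of_mul_eq_mul_left hp.pos (hk.trans (by ring))⟩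

/-- Two ideals which divide `q` agree if they agree up to ideals prime to `q`. -/
lemma ideal_eq_of_mul_eq {O : Type*} [CommRing O] {X B Y M Q : Ideal O} (hX : Q ≤ X) (hB : Q ≤ B)
    (hY : IsCoprime Y Q) (hM : IsCoprime M Q) (h : X * Y = B * M) : X = B := by
  -- An ideal Z containing Q is recovered as ZW + Q when W is prime to Q.
  have key : ∀ Z W : Ideal O, Q ≤ Z → IsCoprime W Q → Z = Z * W ⊔ Q := fun Z W hZ hW => by
    refine le_antisymm ?_ (sup_le Ideal.mul_le_left hZ)
    calc Z = Z * (W ⊔ Q) := by rw [Ideal.isCoprime_iff_sup_eq.mp hW, Ideal.mul_top]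
      _ = Z * W ⊔ Z * Q := Ideal.mul_sup _ _ _
      _ ≤ Z * W ⊔ Q := sup_le_sup_left Ideal.mul_le_right _
  rw [key X Y hX hY, key B M hB hM, h]

section Multiplier

variable {K : Type*} [Field K] {p : ℕ} {𝔭 : Ideal (𝓞 K)} {R : Subalgebra ℤ (𝓞 K)}
  {𝔞 : Submodule R K} {v : Fin 2 → K}

/-- `l` is an element of the order `R` such that `(l) = 𝔭 𝔢` with `𝔢` prime to `p`, and `A` is the
matrix of the multiplication by `l` on the ideal `𝔞` with the basis `v`. -/
structure IsMultiplier (p : ℕ) (𝔭 : Ideal (𝓞 K)) (𝔞 : Submodule R K) (v : Fin 2 → K) (l : 𝓞 K)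
    (𝔢 : Ideal (𝓞 K)) (n : ℕ) (A : Matrix (Fin 2) (Fin 2) ℤ) : Prop where
  span_eq : Ideal.span {l} = 𝔭 * 𝔢
  coprime : IsCoprime 𝔢 (Ideal.span {(p : 𝓞 K)})
  not_dvd : ¬ p ∣ n
  natAbs_det : A.det.natAbs = p * n
  smul_eq : (l : K) • v = A.map (Int.cast : ℤ → K) *ᵥ v
  mem_iff : ∀ x, x ∈ idealIn R 𝔭 • 𝔞 ↔ ∃ a ∈ 𝔞, ∃ b ∈ 𝔞, x = (l : K) * a + p * b

lemma exists_isMultiplier [NumberField K] (hK : Module.finrank ℚ K = 2) (hp : p.Prime)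
    (h𝔭 : 𝔭.IsPrime) {𝔭bar : Ideal (𝓞 K)} (h𝔭bar : 𝔭bar.IsPrime)
    (hsplit : 𝔭 * 𝔭bar = Ideal.span {(p : 𝓞 K)})
    (hcond : ¬ Ideal.span {(p : 𝓞 K)} ∣ conductor R) (hv : IsBasisOf v 𝔞) :
    ∃ l 𝔢 n A, IsMultiplier p 𝔭 𝔞 v l 𝔢 n A := by
  obtain ⟨c, hc, hcR⟩ := exists_int_mem_conductor hK R hcond
  obtain ⟨l, 𝔢, hlR, hl0, hl𝔢, hcop⟩ := exists_mem_span_eq_mul hK hp h𝔭 h𝔭bar hsplit hc hcR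
  obtain ⟨A, hA⟩ := exists_eq_map_mulVec (v := v) (w := (l : K) • v) fun i => by
    rw [← SetLike.mem_coe, hv.2]
    exact 𝔞.smul_mem (⟨l, hlR⟩ : R) (by
      rw [← SetLike.mem_coe, ← hv.2]
      exact Submodule.subset_span ⟨i, rfl⟩)
  have h𝔢 : 𝔢 ≠ ⊥ := fun h => hl0 (by
    rw [h, Ideal.mul_bot, Ideal.span_singleton_eq_bot] at hl𝔢
    exact hl𝔢)
  refine ⟨l, 𝔢, Ideal.absNorm 𝔢, A, hl𝔢, hcop, not_dvd_absNorm_of_isCoprime hp h𝔢 hcop, ?_,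
    hA, mem_idealIn_smul_iff hlR ?_ ?_ (fun x hxR hx =>
      exists_eq_mul_add_mul hp hsplit hc hcR hl𝔢 hcop hxR hx) 𝔞⟩
  · rw [natAbs_det_eq_absNorm hK hv.1 hA, hl𝔢, map_mul,
      absNorm_eq_of_mul_eq hK hp h𝔭 h𝔭bar hsplit]
  · exact Ideal.mul_le_left (hl𝔢 ▸ Ideal.mem_span_singleton_self l)
  · exact Ideal.mul_le_left (hsplit ▸ Ideal.mem_span_singleton_self (p : 𝓞 K))

variable {l : 𝓞 K} {𝔢 : Ideal (𝓞 K)} {n : ℕ} {A : Matrix (Fin 2) (Fin 2) ℤ}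

/-- In coordinates of the basis v, l𝔞 + p𝔞 is the lattice generated by the rows of A and pℤ², so
`exists_det_eq_prime` supplies a basis of it. -/
lemma IsMultiplier.exists_isTransition (h : IsMultiplier p 𝔭 𝔞 v l 𝔢 n A) (hp : p.Prime)
    (hA : A.det = ((p * n : ℕ) : ℤ)) (hv : IsBasisOf v 𝔞) : ∃ P, IsTransition p v 𝔞 𝔭 P := by
  obtain ⟨P, C, D, U, V, hP, hC, hD, hUV⟩ := exists_det_eq_prime hp h.not_dvd A hA
  have hp0 : (p : ℤ) ≠ 0 := by exact_mod_cast hp.ne_zero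
  have hpv : (p : K) • v = D.map (Int.cast : ℤ → K) *ᵥ (P.map (Int.cast : ℤ → K) *ᵥ v) := by
    rw [← map_mul_mulVec, ← hD]
    funext i
    simp only [Matrix.mulVec, dotProduct, Fin.sum_univ_two, Matrix.map_apply, Matrix.smul_apply,
      Matrix.one_apply, smul_eq_mul, Pi.smul_apply]
    fin_cases i <;> simp
  have hlv : (l : K) • v = C.map (Int.cast : ℤ → K) *ᵥ (P.map (Int.cast : ℤ → K) *ᵥ v) := by
    rw [← map_mul_mulVec, ← hC, h.smul_eq]
  have hPv : ∀ i, (P.map (Int.cast : ℤ → K) *ᵥ v) i =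
      (l : K) * (U.map (Int.cast : ℤ → K) *ᵥ v) i + p * (V.map (Int.cast : ℤ → K) *ᵥ v) i := by
    intro i
    have h1 : P.map (Int.cast : ℤ → K) *ᵥ v = U.map (Int.cast : ℤ → K) *ᵥ ((l : K) • v) +
        (p : K) • (V.map (Int.cast : ℤ → K) *ᵥ v) := by
      rw [h.smul_eq, ← map_mul_mulVec, hUV]
      funext i
      simp only [Matrix.mulVec, dotProduct, Fin.sum_univ_two, Matrix.map_apply, Matrix.add_apply,
        Matrix.smul_apply, Pi.add_apply, Pi.smul_apply, smul_eq_mul]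
      push_cast
      ring
    rw [h1, Matrix.mulVec_smul]
    rfl
  have hmem : ∀ i, v i ∈ 𝔞 := fun i => by
    rw [← SetLike.mem_coe, ← hv.2]
    exact Submodule.subset_span ⟨i, rfl⟩
  have hmem' : ∀ (M : Matrix (Fin 2) (Fin 2) ℤ) i, (M.map (Int.cast : ℤ → K) *ᵥ v) i ∈ 𝔞 :=
    fun M i => by
      rw [← SetLike.mem_coe, ← hv.2]
      exact map_mulVec_mem_span M v i
  have hmul : ∀ (s : K) (M : Matrix (Fin 2) (Fin 2) ℤ) (w : Fin 2 → K),
      s • v = M.map (Int.cast : ℤ → K) *ᵥ w → ∀ a ∈ 𝔞,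
      s * a ∈ Submodule.span ℤ (Set.range w) := fun s M w hs a ha => by
    rw [← SetLike.mem_coe, ← hv.2, SetLike.mem_coe,
      Submodule.mem_span_range_iff_exists_fun] at ha
    obtain ⟨c, rfl⟩ := ha
    rw [Finset.mul_sum]
    refine Submodule.sum_mem _ fun i _ => ?_
    rw [mul_smul_comm]
    refine Submodule.smul_mem _ _ ?_
    have h2 := congrFun hs i
    rw [Pi.smul_apply, smul_eq_mul] at h2
    rw [h2]
    exact map_mulVec_mem_span M w i
  refine ⟨P, hP, linearIndependent_map_mulVec hv.1 (hP ▸ hp0), Set.Subset.antisymm ?_ ?_⟩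
  · intro x hx
    rw [SetLike.mem_coe, Submodule.mem_span_range_iff_exists_fun] at hx
    obtain ⟨c, rfl⟩ := hx
    refine Submodule.sum_mem _ fun i _ => ?_
    refine zsmul_mem ?_ _
    rw [h.mem_iff, hPv]
    exact ⟨_, hmem' U i, _, hmem' V i, rfl⟩
  · intro x hx
    rw [SetLike.mem_coe, h.mem_iff] at hx
    obtain ⟨a, ha, b, hb, rfl⟩ := hx
    exact Submodule.add_mem _ (hmul _ _ _ hlv a ha) (hmul _ _ _ hpv b hb)

/-- Multiplication by `l` factors through the transition to `𝔞 𝔭_R`. -/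
lemma IsMultiplier.exists_eq_mul (h : IsMultiplier p 𝔭 𝔞 v l 𝔢 n A) (hp : p.Prime)
    (hA : A.det = ((p * n : ℕ) : ℤ)) (hv : IsBasisOf v 𝔞) {P : Matrix (Fin 2) (Fin 2) ℤ}
    (hP : IsTransition p v 𝔞 𝔭 P) : ∃ C : Matrix (Fin 2) (Fin 2) ℤ, C.det = n ∧ A = C * P := by
  obtain ⟨C, hC⟩ := exists_eq_map_mulVec (v := P.map (Int.cast : ℤ → K) *ᵥ v)
    (w := (l : K) • v) fun i => by
      rw [← SetLike.mem_coe, hP.2.2, SetLike.mem_coe, h.mem_iff]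
      refine ⟨v i, ?_, 0, zero_mem _, by simp⟩
      rw [← SetLike.mem_coe, ← hv.2]
      exact Submodule.subset_span ⟨i, rfl⟩
  rw [← map_mul_mulVec, h.smul_eq] at hC
  have hAC := eq_of_map_mulVec_eq hv.1 hC
  refine ⟨C, ?_, hAC⟩
  have hdet := congrArg Matrix.det hAC
  rw [Matrix.det_mul, hA, hP.1] at hdet
  have hp0 : (p : ℤ) ≠ 0 := by exact_mod_cast hp.ne_zero
  refine mul_right_cancel₀ hp0 ?_
  rw [← hdet]
  push_cast
  ring

end Multiplier

/-! ### The ideal generated by `φ_P(α)` -/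

section Divisor

variable {K : IntermediateField ℚ ℂ} {p : ℕ} {𝔭 𝔭bar : Ideal (𝓞 K)} {R : Subalgebra ℤ (𝓞 K)}
  {𝔞 : Submodule R K} {v : Fin 2 → K} {l : 𝓞 K} {𝔢 : Ideal (𝓞 K)} {n : ℕ}
  {A : Matrix (Fin 2) (Fin 2) ℤ} {α : ℍ}

lemma coe_algebraMap_ringOfIntegers (x : 𝓞 K) :
    ((algebraMap (𝓞 K) (𝓞 ℂ) x : 𝓞 ℂ) : ℂ) = ((x : K) : ℂ) := rfl

lemma IsMultiplier.eigen (h : IsMultiplier p 𝔭 𝔞 v l 𝔢 n A) (hv : IsBasisOf v 𝔞)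
    (hα : (α : ℂ) = (v 0 : ℂ) / (v 1 : ℂ)) :
    ((l : K) : ℂ) * α = (A 0 0 : ℂ) * α + A 0 1 ∧ ((l : K) : ℂ) = (A 1 0 : ℂ) * α + A 1 1 := by
  have hv1 : (v 1 : ℂ) ≠ 0 := by
    have := hv.1.ne_zero 1
    exact_mod_cast this
  have key : ∀ i, ((l : K) : ℂ) * (v i : ℂ) = (A i 0 : ℂ) * v 0 + A i 1 * v 1 := fun i => by
    have h1 := congrFun h.smul_eq i
    simp only [Matrix.mulVec, dotProduct, Fin.sum_univ_two, Matrix.map_apply, smul_eq_mul,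
      Pi.smul_apply] at h1
    exact_mod_cast congrArg (fun x : K => (x : ℂ)) h1
  have h0 := key 0
  have h1 := key 1
  rw [hα]
  constructor <;> field_simp
  · linear_combination h0
  · linear_combination h1

/-- The ideal norm determines det A only up to sign; the sign is positive because det A = |l|². -/
lemma IsMultiplier.det_eq (h : IsMultiplier p 𝔭 𝔞 v l 𝔢 n A) (hv : IsBasisOf v 𝔞)
    (hα : (α : ℂ) = (v 0 : ℂ) / (v 1 : ℂ)) : A.det = ((p * n : ℕ) : ℤ) := by
  have h1 := det_eq_normSq (h.eigen hv hα).1 (h.eigen hv hα).2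
  have h2 : (0 : ℝ) ≤ A.det := h1 ▸ Complex.normSq_nonneg _
  rw [← h.natAbs_det, Int.natAbs_of_nonneg (by exact_mod_cast h2)]

lemma IsMultiplier.pos (h : IsMultiplier p 𝔭 𝔞 v l 𝔢 n A) : 0 < n :=
  Nat.pos_of_ne_zero fun hn => h.not_dvd (hn ▸ dvd_zero p)

lemma IsMultiplier.isFixedPoint (h : IsMultiplier p 𝔭 𝔞 v l 𝔢 n A) (hp : p.Prime)
    (hv : IsBasisOf v 𝔞) (hα : (α : ℂ) = (v 0 : ℂ) / (v 1 : ℂ)) : IsFixedPoint α := by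
  have hA := h.det_eq hv hα
  have hpos : 0 < A.det := by rw [hA]; exact_mod_cast Nat.mul_pos hp.pos h.pos
  exact ⟨p * n, A, not_isSquare_prime_mul hp h.not_dvd, hA,
    moebius_eq_self_of_eigen hpos (h.eigen hv hα).1 (h.eigen hv hα).2⟩

theorem IsMultiplier.generatesSameDivisor (h : IsMultiplier p 𝔭 𝔞 v l 𝔢 n A) (hp : p.Prime)
    (hsplit : 𝔭 * 𝔭bar = Ideal.span {(p : 𝓞 K)}) (hv : IsBasisOf v 𝔞)
    (hα : (α : ℂ) = (v 0 : ℂ) / (v 1 : ℂ)) {P : Matrix (Fin 2) (Fin 2) ℤ}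
    (hP : IsTransition p v 𝔞 𝔭 P) : GeneratesSameDivisor (phi P α) (𝔭bar ^ 12) := by
  have hA := h.det_eq hv hα
  have hApos : 0 < A.det := by rw [hA]; exact_mod_cast Nat.mul_pos hp.pos h.pos
  have hPpos : 0 < P.det := by rw [hP.1]; exact_mod_cast hp.pos
  obtain ⟨C, hC, hAC⟩ := h.exists_eq_mul hp hA hv hP
  have hCpos : 0 < C.det := by rw [hC]; exact_mod_cast h.pos
  have hfix := h.isFixedPoint hp hv hα
  obtain ⟨x, x', hx, hxx'⟩ := hfix.exists_phi hp.pos hP.1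
  obtain ⟨y, y', hy, hyy'⟩ := (hfix.moebius hp.pos hP.1).exists_phi h.pos hC
  have hxy : x * y * algebraMap (𝓞 K) (𝓞 ℂ) l ^ 12 = (p : 𝓞 ℂ) ^ 12 * (n : 𝓞 ℂ) ^ 12 := by
    have h1 := phi_mul_pow_of_eigen hApos (h.eigen hv hα).1 (h.eigen hv hα).2
    have h2 := phi_mul hCpos hPpos α
    rw [hAC.symm, ← hx, ← hy] at h2
    rw [h2, hA, ← coe_algebraMap_ringOfIntegers] at h1
    apply NumberField.RingOfIntegers.ext
    simp only [NumberField.RingOfIntegers.coe_eq_algebraMap] at h1 ⊢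
    push_cast [map_mul, map_pow, map_natCast] at h1 ⊢
    linear_combination h1
  let e : Ideal (𝓞 K) →+* Ideal (𝓞 ℂ) := Ideal.mapHom (algebraMap (𝓞 K) (𝓞 ℂ))
  have he : ∀ z : 𝓞 K, e (Ideal.span {z}) = Ideal.span {algebraMap (𝓞 K) (𝓞 ℂ) z} := fun z => by
    rw [Ideal.mapHom_apply, Ideal.map_span, Set.image_singleton]
  have hep : e 𝔭 * e 𝔭bar = Ideal.span {(p : 𝓞 ℂ)} := by
    rw [← map_mul, hsplit, he, map_natCast]
  set Q : Ideal (𝓞 ℂ) := Ideal.span {(p : 𝓞 ℂ) ^ 12} with hQ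
  have hQ' : Q = Ideal.span {(p : 𝓞 ℂ)} ^ 12 := (Ideal.span_singleton_pow _ _).symm
  have hp0 : (p : 𝓞 ℂ) ≠ 0 := by exact_mod_cast hp.ne_zero
  have hn : IsCoprime (Ideal.span {(n : 𝓞 ℂ) ^ 12}) Q := by
    rw [hQ, Ideal.isCoprime_span_singleton_iff]
    have h1 : IsCoprime (n : ℤ) (p : ℤ) := by
      rw [Nat.isCoprime_iff_coprime]
      exact ((Nat.Prime.coprime_iff_not_dvd hp).mpr h.not_dvd).symm
    have h2 := h1.map (Int.castRingHom (𝓞 ℂ))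
    simp only [eq_intCast, Int.cast_natCast] at h2
    exact h2.pow
  have hE : IsCoprime (e 𝔢 ^ 12) Q := by
    have h1 := h.coprime.map e
    rw [he, map_natCast] at h1
    rw [hQ']
    exact h1.pow
  have hY : IsCoprime (Ideal.span {y}) Q := by
    rw [hQ, Ideal.isCoprime_span_singleton_iff] at hn ⊢
    rw [← hyy'] at hn
    exact hn.of_mul_left_left
  refine ⟨x, hx, ?_⟩
  change _ = e (𝔭bar ^ 12)
  rw [map_pow]
  refine ideal_eq_of_mul_eq (Q := Q) (Y := Ideal.span {y} * e 𝔢 ^ 12)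
    (M := Ideal.span {(n : 𝓞 ℂ) ^ 12}) ?_ ?_ (hY.mul_left hE) hn ?_
  · rw [hQ, Ideal.span_singleton_le_span_singleton]
    exact Dvd.intro _ hxx'
  · rw [hQ', ← hep, mul_pow]
    exact Ideal.mul_le_right
  · have h1 : Ideal.span {x} * Ideal.span {y} * (e 𝔭 * e 𝔢) ^ 12 =
        (e 𝔭 * e 𝔭bar) ^ 12 * Ideal.span {(n : 𝓞 ℂ) ^ 12} := by
      rw [← map_mul, ← h.span_eq, he, hep, Ideal.span_singleton_pow, Ideal.span_singleton_pow,
        Ideal.span_singleton_mul_span_singleton, Ideal.span_singleton_mul_span_singleton,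
        Ideal.span_singleton_mul_span_singleton, hxy]
    -- The factor e 𝔭¹² must be cancelled without unique factorization of ideals in `𝓞 ℂ`.
    -- Multiplying by e 𝔭bar¹² turns it into the principal ideal Q, whose generator is nonzero.
    have h2 : Q * (Ideal.span {x} * (Ideal.span {y} * e 𝔢 ^ 12)) =
        Q * (e 𝔭bar ^ 12 * Ideal.span {(n : 𝓞 ℂ) ^ 12}) := by
      rw [hQ', ← hep]
      calc _ = Ideal.span {x} * Ideal.span {y} * (e 𝔭 * e 𝔢) ^ 12 * e 𝔭bar ^ 12 := by ring
        _ = _ := by rw [h1]; ring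
    exact (Ideal.span_singleton_mul_right_inj (pow_ne_zero 12 hp0)).mp h2

/-- The value of an entire integral function at `α` is divisible by `𝔭`. -/
theorem isAlgebraic_and_divisibleBy (hp : p.Prime) (h𝔭 : 𝔭.IsMaximal) (h𝔭bar : 𝔭bar.IsMaximal)
    (hsplit : 𝔭 * 𝔭bar = Ideal.span {(p : 𝓞 K)}) (hne : 𝔭 ≠ 𝔭bar) (hα : IsFixedPoint α)
    {P : Matrix (Fin 2) (Fin 2) ℤ} {f : ℍ → ℂ} (hP : P.det = p) (hf : IsEntireIntegral p P f)
    (hdiag : ∀ g, IsConjugate P f !![(p : ℤ), 0; 0, 1] g → ∃ a : ℤ → ℂ, HasQExpansion 1 g a ∧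
      ∀ ν, ∃ c : ℂ, IsIntegral ℤ c ∧ a ν = p * c)
    {P' : Matrix (Fin 2) (Fin 2) ℤ} (hP' : P'.det = p) {g : ℍ → ℂ} (hg : IsConjugate P f P' g)
    (hphi : GeneratesSameDivisor (phi P' α) (𝔭 ^ 12)) :
    IsAlgebraic ℚ (g α) ∧ DivisibleBy (g α) 𝔭 := by
  obtain ⟨x, y, w, t, r, u, hx, hy, hxw, hrel⟩ := hf.exists_relation hp hP hdiag hP' hg hα
  have hy_int : IsIntegral ℤ (g α) := hy ▸ y.isIntegral_coe
  refine ⟨(hy_int.tower_top (A := ℚ)).isAlgebraic, y, hy, ?_⟩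
  obtain ⟨x₁, hx₁, hspan⟩ := hphi
  obtain rfl : x₁ = x := NumberField.RingOfIntegers.ext (hx₁.trans hx.symm)
  let e : Ideal (𝓞 K) →+* Ideal (𝓞 ℂ) := Ideal.mapHom (algebraMap (𝓞 K) (𝓞 ℂ))
  have hp0 : (p : 𝓞 ℂ) ≠ 0 := by exact_mod_cast hp.ne_zero
  have hep : e 𝔭 * e 𝔭bar = Ideal.span {(p : 𝓞 ℂ)} := by
    rw [← map_mul, hsplit, Ideal.mapHom_apply, Ideal.map_span, Set.image_singleton, map_natCast]
  replace hspan : Ideal.span {x₁} = e 𝔭 ^ 12 := by rw [hspan, ← map_pow]; rfl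
  have hx0 : x₁ ≠ 0 := by
    rintro rfl
    rw [zero_mul] at hxw
    exact mul_ne_zero (pow_ne_zero 12 hp0) u.ne_zero hxw.symm
  -- Here (x₁)(w) = (p)¹² = e 𝔭¹² e 𝔭bar¹² and (x₁) = e 𝔭¹²; cancellation is allowed because (x₁) is
  -- principal and nonzero.
  have hw : Ideal.span {w} = e 𝔭bar ^ 12 := by
    refine (Ideal.span_singleton_mul_right_inj hx0).mp ?_
    rw [Ideal.span_singleton_mul_span_singleton, hxw,
      Ideal.span_singleton_mul_right_unit u.isUnit, hspan, ← mul_pow, hep,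
      Ideal.span_singleton_pow]
  have hcop : IsCoprime (e 𝔭) (Ideal.span {w}) := by
    rw [hw]
    exact IsCoprime.pow_right
      ((Ideal.isCoprime_of_isMaximal hne).map e)
  have hx𝔭 : x₁ ∈ e 𝔭 := Ideal.pow_le_self (by norm_num) (hspan ▸ Ideal.mem_span_singleton_self x₁)
  have hp𝔭 : (p : 𝓞 ℂ) ∈ e 𝔭 := Ideal.mul_le_left (hep ▸ Ideal.mem_span_singleton_self (p : 𝓞 ℂ))
  have hyw : y * w ∈ e 𝔭 := by
    rw [show y * w = r * p - t * x₁ by linear_combination hrel]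
    exact sub_mem (Ideal.mul_mem_left _ _ hp𝔭) (Ideal.mul_mem_left _ _ hx𝔭)
  obtain ⟨a, ha, b, hb, hab⟩ := Ideal.isCoprime_iff_exists.mp hcop
  obtain ⟨s, rfl⟩ := Ideal.mem_span_singleton.mp hb
  change y ∈ e 𝔭
  rw [show y = y * a + s * (y * w) by linear_combination (-y) * hab]
  exact add_mem (Ideal.mul_mem_left _ _ ha) (Ideal.mul_mem_left _ _ hyw)

end Divisor

end CM

end

/-! ### Assembly of the main theorem -/

theorem mainTheorem6 (p : ℕ) (hp : p.Prime)
    (K : IntermediateField ℚ ℂ) (hK : Module.finrank ℚ K = 2)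
    (𝔭 𝔭bar : Ideal (𝓞 K)) (h𝔭 : 𝔭.IsPrime) (h𝔭bar : 𝔭bar.IsPrime)
    (hsplit : 𝔭 * 𝔭bar = Ideal.span {(p : 𝓞 K)})
    (R : Subalgebra ℤ (𝓞 K)) (hR : CM.IsOrder R)
    (hcond : ¬ Ideal.span {(p : 𝓞 K)} ∣ CM.conductor R)
    (𝔞 : Submodule R K) (v : Fin 2 → K) (hv : CM.IsBasisOf v 𝔞)
    (α : UpperHalfPlane) (hα : (α : ℂ) = (v 0 : ℂ) / (v 1 : ℂ)) :
    -- the matrix `P_𝔭` exists and is unique up to equivalence, and `φ_{P_𝔭}(α) ≈ 𝔭bar¹²`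
    (∃ P, CM.IsTransition p v 𝔞 𝔭 P) ∧
    (∀ P P', CM.IsTransition p v 𝔞 𝔭 P → CM.IsTransition p v 𝔞 𝔭 P' →
      ∃ M : SL(2, ℤ), P' = (M : Matrix (Fin 2) (Fin 2) ℤ) * P) ∧
    (∀ P, CM.IsTransition p v 𝔞 𝔭 P → CM.GeneratesSameDivisor (CM.phi P α) (𝔭bar ^ 12)) ∧
    -- if `𝔭 ≠ 𝔭bar`, then `f_{P_𝔭bar}(α)` is algebraic and divisible by `𝔭`
    (𝔭 ≠ 𝔭bar → ∀ (P : Matrix (Fin 2) (Fin 2) ℤ) (f : UpperHalfPlane → ℂ),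
      P.det = p → CM.IsEntireIntegral p P f →
      (∀ g, CM.IsConjugate P f !![(p : ℤ), 0; 0, 1] g →
        ∃ a : ℤ → ℂ, CM.HasQExpansion 1 g a ∧
          ∀ ν, ∃ c : ℂ, IsIntegral ℤ c ∧ a ν = p * c) →
      ∀ P' g, CM.IsTransition p v 𝔞 𝔭bar P' → CM.IsConjugate P f P' g →
        IsAlgebraic ℚ (g α) ∧ CM.DivisibleBy (g α) 𝔭) := by
  have : Module.Finite ℚ K := Module.finite_of_finrank_pos (hK ▸ two_pos)
  have : NumberField K := ⟨⟩
  have hsplit' : 𝔭bar * 𝔭 = Ideal.span {(p : 𝓞 K)} := (mul_comm _ _).trans hsplit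
  have hbot : 𝔭 * 𝔭bar ≠ ⊥ := by
    rw [hsplit, Ne, Ideal.span_singleton_eq_bot]
    exact_mod_cast hp.ne_zero
  have hmax : 𝔭.IsMaximal := h𝔭.isMaximal (left_ne_zero_of_mul hbot)
  have hmax' : 𝔭bar.IsMaximal := h𝔭bar.isMaximal (right_ne_zero_of_mul hbot)
  obtain ⟨l, 𝔢, n, A, h⟩ := CM.exists_isMultiplier hK hp h𝔭 h𝔭bar hsplit hcond hv
  obtain ⟨l', 𝔢', n', A', h'⟩ := CM.exists_isMultiplier hK hp h𝔭bar h𝔭 hsplit' hcond hv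
  refine ⟨h.exists_isTransition hp (h.det_eq hv hα) hv,
    fun P P' hP hP' => hP.unique hp.ne_zero hv.1 hP',
    fun P hP => h.generatesSameDivisor hp hsplit hv hα hP,
    fun hne P f hP hf hdiag P' g hP' hg => ?_⟩
  -- Part 1 with the two primes exchanged provides (φ_{P'}(α)) = 𝔭¹², the input of part 2.
  exact CM.isAlgebraic_and_divisibleBy hp hmax hmax' hsplit hne (h.isFixedPoint hp hv hα) hP hf
    hdiag hP'.1 hg (h'.generatesSameDivisor hp hsplit' hv hα hP')
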